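/- Manifolds and Lie groups are finite-dimensional, smooth, Hausdorff and second countable. Let $(M,g,G,\sigma)$ be a homogeneous Riemannian manifold: $(M,g)$ is a Riemannian manifold and $\sigma$ is a smooth transitive isometric action of the Lie group $G$ on $M$, written $h\cdot x$. Fix $p_0\in M$, let $K$ be the isotropy subgroup of $G$ at $p_0$, with Lie algebra $\mathfrak k\subset\mathfrak g$. *Statistical connections.* A statistical connection on $(M,g)$ is a torsion-free affine connection $\nabla$ such that $\nabla g$ is totally symmetric; its cubic form is $C^\nabla(X,Y,Z)=-2g(\nabla_XY-\nabla^g_XY,Z)$, where $\nabla^g$ is the Levi-Civita connection. $\mathrm{Stat}^G(M,g)$ is the set of $G$-invariant statistical connections, and $\Gamma(S^3T^*M)^G$ the space of $G$-invariant smooth symmetric $(0,3)$-tensor fields. The latter is finite-dimensional and carries its canonical Hausdorff vector space topology; $\nabla\mapsto C^\nabla$ is a bijection $\mathrm{Stat}^G(M,g)\to\Gamma(S^3T^*M)^G$, and $\mathrm{Stat}^G(M,g)$ carries the transported topology. For $\nabla,\nabla'\in\mathrm{Stat}^G(M,g)$ write $\nabla\sim_{\mathbf{HS}}\nabla'$ if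 there are a Lie group automorphism $\phi$ of $G$ and a diffeomorphism $f$ of $M$ with $f(h\cdot x)=\phi(h)\cdot f(x)$, $f^*g=g$ and $f^*\nabla'=\nabla$. The HS-moduli space is the quotient space $\mathcal M_{\mathbf{HS}}\mathrm{Stat}^G(M,g)=\mathrm{Stat}^G(M,g)/{\sim_{\mathbf{HS}}}$. *Automorphisms.* $\Upsilon:\mathfrak g/\mathfrak k\to T_{p_0}M$, $[X]\mapsto\frac{d}{dt}\big|_{t=0}\exp(-tX)\cdot p_0$, is a linear isomorphism; let $g_0$ be the inner product on $\mathfrak g/\mathfrak k$ induced by $g_{p_0}$ through $\Upsilon$. $\mathrm{Aut}(G,K)$ is the group of Lie group automorphisms $\phi$ of $G$ with $\phi(K)=K$; each induces $\phi_{\mathfrak g/\mathfrak k}:[X]\mapsto[\phi_*X]$, and $\mathrm{Aut}(G,K,g_0)$ is the subgroup of those $\phi$ for which $\phi_{\mathfrak g/\mathfrak k}$ preserves $g_0$. For $\phi\in\mathrm{Aut}(G,K,g_0)$ the map $f_\phi:M\to M$, $h\cdot p_0\mapsto\phi(h)\cdot p_0$, is a well-defined diffeomorphism. $\mathrm{Aut}(G,K,g_0)$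 acts on $\mathrm{Stat}^G(M,g)$ and on $\Gamma(S^3T^*M)^G$ by pullback along $f_\phi^{-1}$, on the space $S^3(T^*_{p_0}M)^K$ of $K$-invariant symmetric trilinear forms on $T_{p_0}M$ by pullback along $(df_\phi^{-1})_{p_0}$, and on the space $S^3((\mathfrak g/\mathfrak k)^*)^K$ of $K$-invariant symmetric trilinear forms on $\mathfrak g/\mathfrak k$ by pullback along $\phi_{\mathfrak g/\mathfrak k}^{-1}$. **Theorem.** 1. $\sim_{\mathbf{HS}}$ is the orbit equivalence relation of $\mathrm{Aut}(G,K,g_0)$ on $\mathrm{Stat}^G(M,g)$; that is, $\mathcal M_{\mathbf{HS}}\mathrm{Stat}^G(M,g)=\mathrm{Aut}(G,K,g_0)\backslash\mathrm{Stat}^G(M,g)$. 2. The maps $\nabla\mapsto C^\nabla$, $C\mapsto C_{p_0}$ and $\Upsilon^*$ are homeomorphisms $\mathrm{Stat}^G(M,g)\simeq\Gamma(S^3T^*M)^G\simeq S^3(T^*_{p_0}M)^K\simeq S^3((\mathfrak g/\mathfrak k)^*)^K$, and they induce homeomorphisms $$\mathcal M_{\mathbf{HS}}\mathrm{Stat}^G(M,g)\simeq\mathrm{Aut}(G,K,g_0)\backslash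 S^3(T^*_{p_0}M)^K\simeq\mathrm{Aut}(G,K,g_0)\backslash S^3((\mathfrak g/\mathfrak k)^*)^K .$$ 3. Let $\mathcal C$ be a class of statistical manifolds, that is, a full replete subcategory of the category of statistical manifolds and statistical immersions (equivalently, a collection of statistical manifolds closed under isomorphism: diffeomorphisms $f$ with $f^*g'=g$, $f^*\nabla'=\nabla$). Let $\mathrm{Stat}^G_{\mathcal C}(M,g)$ be the set of $\nabla\in\mathrm{Stat}^G(M,g)$ with $(M,g,\nabla)$ in $\mathcal C$, and let $\Gamma(S^3T^*M)^G_{g\text{-}\mathcal C}$, $S^3(T^*_{p_0}M)^K_{g\text{-}\mathcal C}$, $S^3((\mathfrak g/\mathfrak k)^*)^K_{g\text{-}\mathcal C}$ be its images under the maps of 2, all with the subspace topologies. Then $\mathrm{Stat}^G_{\mathcal C}(M,g)$ is a union of $\sim_{\mathbf{HS}}$-classes, all four sets are $\mathrm{Aut}(G,K,g_0)$-stable, and, with $\mathcal M_{\mathbf{HS}}\mathrm{Stat}^G_{\mathcal C}(M,g)=\mathrm{Stat}^G_{\mathcal C}(M,g)/{\sim_{\mathbf{HS}}}$, the maps of 2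 induce homeomorphisms $$\mathcal M_{\mathbf{HS}}\mathrm{Stat}^G_{\mathcal C}(M,g)\simeq\mathrm{Aut}(G,K,g_0)\backslash\mathrm{Stat}^G_{\mathcal C}(M,g)\simeq\mathrm{Aut}(G,K,g_0)\backslash\Gamma(S^3T^*M)^G_{g\text{-}\mathcal C}$$ $$\simeq\mathrm{Aut}(G,K,g_0)\backslash S^3(T^*_{p_0}M)^K_{g\text{-}\mathcal C}\simeq\mathrm{Aut}(G,K,g_0)\backslash S^3((\mathfrak g/\mathfrak k)^*)^K_{g\text{-}\mathcal C}.$$ -/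

import Mathlib

universe u v w

open scoped Manifold ContDiff
open Bundle

noncomputable section

namespace HomogStat



/-! ### Vector fields, metrics, connections -/

section Manifolds

variable (n : ℕ) (M : Type u) [TopologicalSpace M] [ChartedSpace (EuclideanSpace ℝ (Fin n)) M]
  [IsManifold (𝓡 n) ∞ M]

/-- Smooth vector fields on an `n`-dimensional manifold `M`. -/
abbrev VF : Type u :=
  ContMDiffSection (𝓡 n) (EuclideanSpace ℝ (Fin n)) ∞ (TangentSpace (𝓡 n) : M → Type)

/-- Smooth Riemannian metrics on `M`. -/
abbrev RMetric : Type u :=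
  ContMDiffRiemannianMetric (𝓡 n) ∞ (EuclideanSpace ℝ (Fin n)) (TangentSpace (𝓡 n) : M → Type)

variable {n M}

/-- The vector field `f X`, for a smooth function `f` and a smooth vector field `X`. -/
def VF.fsmul (f : C^∞⟮𝓡 n, M; 𝓘(ℝ, ℝ), ℝ⟯) (X : VF n M) : VF n M :=
  ⟨fun x => f x • X x, f.contMDiff.smul_section X.contMDiff⟩

/-- The derivative `X f` of a real function along a vector field. -/
def VF.deriv (X : VF n M) (f : M → ℝ) (x : M) : ℝ :=
  mfderiv (𝓡 n) 𝓘(ℝ, ℝ) f x (X x)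

variable (n M) in
/-- Affine connections on `M` (Koszul connections on the tangent bundle): `toFun X Y` is
`∇_X Y`. -/
structure AffineConnection where
  toFun : VF n M → VF n M → VF n M
  add_left : ∀ X X' Y, toFun (X + X') Y = toFun X Y + toFun X' Y
  fsmul_left : ∀ f X Y, toFun (VF.fsmul f X) Y = VF.fsmul f (toFun X Y)
  add_right : ∀ X Y Y', toFun X (Y + Y') = toFun X Y + toFun X Y'
  leibniz : ∀ X (f : C^∞⟮𝓡 n, M; 𝓘(ℝ, ℝ), ℝ⟯) Y x,
    toFun X (VF.fsmul f Y) x = f x • toFun X Y x + X.deriv f x • Y x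

instance : CoeFun (AffineConnection n M) fun _ => VF n M → VF n M → VF n M :=
  ⟨AffineConnection.toFun⟩

/-- The function `g(X, Y)`. -/
def RMetric.app (g : RMetric n M) (X Y : VF n M) (x : M) : ℝ := g.inner x (X x) (Y x)

/-- The function `(∇_X g)(Y, Z) = X g(Y, Z) - g(∇_X Y, Z) - g(Y, ∇_X Z)`. -/
def covDerivMetric (g : RMetric n M) (D : AffineConnection n M) (X Y Z : VF n M) (x : M) : ℝ :=
  X.deriv (g.app Y Z) x - g.app (D X Y) Z x - g.app Y (D X Z) x

/-- `∇_X Y - ∇_Y X = [X, Y]`. -/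
def AffineConnection.TorsionFree (D : AffineConnection n M) : Prop :=
  ∀ (X Y : VF n M) (x : M), D X Y x - D Y X x = VectorField.mlieBracket (𝓡 n) X Y x

/-- Statistical connections on `(M, g)`: torsion-free, with `∇g` totally symmetric. -/
def IsStatistical (g : RMetric n M) (D : AffineConnection n M) : Prop :=
  D.TorsionFree ∧
    ∀ (X Y Z : VF n M) (x : M), covDerivMetric g D X Y Z x = covDerivMetric g D Y X Z x

/-- The Levi-Civita connection: torsion-free, with `∇g = 0`. -/
def IsLeviCivita (g : RMetric n M) (D : AffineConnection n M) : Prop :=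
  D.TorsionFree ∧ ∀ (X Y Z : VF n M) (x : M), covDerivMetric g D X Y Z x = 0

/-! ### Symmetric trilinear forms and symmetric `(0,3)`-tensor fields -/

/-- Symmetric trilinear forms on a real vector space `V`, that is, `S³(V*)`. -/
def Sym3 (V : Type w) [AddCommGroup V] [Module ℝ V] :
    Submodule ℝ (MultilinearMap ℝ (fun _ : Fin 3 => V) ℝ) where
  carrier := {C | ∀ (τ : Equiv.Perm (Fin 3)) (v : Fin 3 → V), C (fun i => v (τ i)) = C v}
  add_mem' hC hC' τ v := by simp [hC τ v, hC' τ v]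
  zero_mem' _ _ := by simp
  smul_mem' c C hC τ v := by simp [hC τ v]

variable (n M) in
/-- Smooth symmetric `(0,3)`-tensor fields, that is, `Γ(S³T*M)`. Smoothness of `C` means that
`C(X, Y, Z)` is smooth for all smooth vector fields `X`, `Y`, `Z`. -/
def Sym3Field :
    Submodule ℝ (∀ x : M, MultilinearMap ℝ (fun _ : Fin 3 => TangentSpace (𝓡 n) x) ℝ) where
  carrier := {C | (∀ x, C x ∈ Sym3 (TangentSpace (𝓡 n) x)) ∧
    ∀ X Y Z : VF n M, ContMDiff (𝓡 n) 𝓘(ℝ, ℝ) ∞ fun x => C x ![X x, Y x, Z x]}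
  add_mem' hC hC' := ⟨fun x => add_mem (hC.1 x) (hC'.1 x),
    fun X Y Z => (hC.2 X Y Z).add (hC'.2 X Y Z)⟩
  zero_mem' := ⟨fun _ => zero_mem _, fun _ _ _ => contMDiff_const⟩
  smul_mem' c _ hC := ⟨fun x => Submodule.smul_mem _ c (hC.1 x),
    fun X Y Z => contMDiff_const.mul (hC.2 X Y Z)⟩

/-- `C` is the cubic form of `∇` with respect to `g`:
`C(X, Y, Z) = -2 g(∇_X Y - ∇^g_X Y, Z)`, where `∇^g` is the Levi-Civita connection of `g`. -/
def IsCubicForm (g : RMetric n M) (D : AffineConnection n M)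
    (C : ∀ x : M, MultilinearMap ℝ (fun _ : Fin 3 => TangentSpace (𝓡 n) x) ℝ) : Prop :=
  ∃ Dg : AffineConnection n M, IsLeviCivita g Dg ∧
    ∀ (X Y Z : VF n M) (x : M), C x ![X x, Y x, Z x] = -2 * g.app (D X Y - Dg X Y) Z x

end Manifolds

/-! ### Pullbacks along diffeomorphisms -/

section Pullback

variable {n : ℕ} {M : Type u} [TopologicalSpace M] [ChartedSpace (EuclideanSpace ℝ (Fin n)) M]
  [IsManifold (𝓡 n) ∞ M]
  {n' : ℕ} {M' : Type v} [TopologicalSpace M'] [ChartedSpace (EuclideanSpace ℝ (Fin n')) M']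
  [IsManifold (𝓡 n') ∞ M']

/-- `X'` is `f`-related to `X`; for a diffeomorphism `f` this means `X' = f_* X`. -/
def VF.Related (f : M ≃ₘ⟮𝓡 n, 𝓡 n'⟯ M') (X : VF n M) (X' : VF n' M') : Prop :=
  ∀ x, mfderiv (𝓡 n) (𝓡 n') f x (X x) = X' (f x)

/-- `f^* g' = g`. -/
def IsIsometric (f : M ≃ₘ⟮𝓡 n, 𝓡 n'⟯ M') (g : RMetric n M) (g' : RMetric n' M') : Prop :=
  ∀ (x : M) (v w : TangentSpace (𝓡 n) x),
    g'.inner (f x) (mfderiv (𝓡 n) (𝓡 n') f x v) (mfderiv (𝓡 n) (𝓡 n') f x w) = g.inner x v w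

/-- `∇ = f^* ∇'` for a diffeomorphism `f`, that is, `f_* (∇_X Y) = ∇'_{f_* X} (f_* Y)`. -/
def IsPullback (f : M ≃ₘ⟮𝓡 n, 𝓡 n'⟯ M') (D' : AffineConnection n' M')
    (D : AffineConnection n M) : Prop :=
  ∀ (X Y : VF n M) (X' Y' : VF n' M'), X.Related f X' → Y.Related f Y' →
    (D X Y).Related f (D' X' Y')

end Pullback

/-! ### Classes of statistical manifolds -/

/-- Statistical manifolds. -/
structure StatMfd : Type (u + 1) where
  dim : ℕ
  carrier : Type u
  [top : TopologicalSpace carrier]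
  [t2 : T2Space carrier]
  [secondCountable : SecondCountableTopology carrier]
  [charts : ChartedSpace (EuclideanSpace ℝ (Fin dim)) carrier]
  [smooth : IsManifold (𝓡 dim) ∞ carrier]
  metric : RMetric dim carrier
  conn : AffineConnection dim carrier
  statistical : IsStatistical metric conn

attribute [instance] StatMfd.top StatMfd.t2 StatMfd.secondCountable StatMfd.charts StatMfd.smooth

/-- Two statistical manifolds are isomorphic if there is a diffeomorphism `f` between them that is
a statistical immersion, that is, `f^* g' = g` and `f^* ∇' = ∇`. -/
def StatMfd.Iso (A B : StatMfd.{u}) : Prop :=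
  ∃ f : A.carrier ≃ₘ⟮𝓡 A.dim, 𝓡 B.dim⟯ B.carrier,
    IsIsometric f A.metric B.metric ∧ IsPullback f B.conn A.conn

/-- A class of statistical manifolds: a full replete subcategory of the category of statistical
manifolds, given by its objects, which are closed under isomorphism. -/
structure StatClass where
  mem : StatMfd.{u} → Prop
  replete : ∀ A B, A.Iso B → mem A → mem B

/-! ### The Lie algebra of the isotropy group and automorphisms of `(G, K)` -/

section Group

variable (m : ℕ) (G : Type v) [TopologicalSpace G] [ChartedSpace (EuclideanSpace ℝ (Fin m)) G]
  [Group G]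

/-- The Lie algebra `𝔤 = T_1 G`. -/
abbrev LieAlg : Type := TangentSpace (𝓡 m) (1 : G)

variable {m G}

/-- `X ∈ 𝔤` is the velocity at time `0` of the curve `γ`, which passes through `1` at time `0`. -/
def HasVelocity (γ : ℝ → G) (X : LieAlg m G) : Prop :=
  (mfderiv 𝓘(ℝ, ℝ) (𝓡 m) γ 0 (1 : ℝ) : EuclideanSpace ℝ (Fin m)) = X

theorem HasVelocity.smul {γ : ℝ → G} {X : LieAlg m G}
    (hγ : ContMDiff 𝓘(ℝ, ℝ) (𝓡 m) ∞ γ) (hX : HasVelocity γ X) (c : ℝ) :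
    HasVelocity (fun t => γ (c * t)) (c • X) := by
  have h1 := hγ.mdifferentiableAt (x := c * 0) (by simp)
  have h2 : HasMFDerivAt 𝓘(ℝ, ℝ) 𝓘(ℝ, ℝ) (fun t : ℝ => c * t) 0
      (c • ContinuousLinearMap.id ℝ ℝ) := by
    apply HasFDerivAt.hasMFDerivAt
    exact (hasFDerivAt_id (0 : ℝ)).const_mul c
  unfold HasVelocity at *
  have := (h1.hasMFDerivAt.comp (0 : ℝ) h2).mfderiv
  have e : (fun t => γ (c * t)) = γ ∘ fun t => c * t := rfl
  rw [e, this, ← hX]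
  have h0 : c * (0 : ℝ) = 0 := mul_zero c
  change (mfderiv 𝓘(ℝ, ℝ) (𝓡 m) γ (c * 0) (c • (1 : ℝ)) : EuclideanSpace ℝ (Fin m)) = _
  rw [h0]
  exact map_smul (mfderiv 𝓘(ℝ, ℝ) (𝓡 m) γ 0) c (1 : ℝ)

theorem HasVelocity.comp {γ : ℝ → G} {X : LieAlg m G} (hγ : ContMDiff 𝓘(ℝ, ℝ) (𝓡 m) ∞ γ)
    (hγ0 : γ 0 = 1) (hX : HasVelocity γ X)
    {n : ℕ} {N : Type u} [TopologicalSpace N] [ChartedSpace (EuclideanSpace ℝ (Fin n)) N]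
    {f : G → N} (hf : ContMDiff (𝓡 m) (𝓡 n) ∞ f) :
    (mfderiv 𝓘(ℝ, ℝ) (𝓡 n) (fun t => f (γ t)) 0 (1 : ℝ) : EuclideanSpace ℝ (Fin n)) =
      mfderiv (𝓡 m) (𝓡 n) f 1 X := by
  have h1 := hγ.mdifferentiableAt (x := 0) (by simp)
  have h2 := hf.mdifferentiableAt (x := γ 0) (by simp)
  have e : (fun t => f (γ t)) = f ∘ γ := rfl
  unfold HasVelocity at hX
  rw [e, mfderiv_comp (I' := 𝓡 m) 0 h2 h1, ← hX]
  change (mfderiv (𝓡 m) (𝓡 n) f (γ 0) (mfderiv 𝓘(ℝ, ℝ) (𝓡 m) γ 0 (1 : ℝ)) :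
    EuclideanSpace ℝ (Fin n)) = _
  rw [hγ0]

variable (m) in
/-- The group `Aut(G, K)` of automorphisms `φ` of the Lie group `G` with `φ(K) = K`. -/
def AutGK (K : Subgroup G) : Subgroup (MulAut G) where
  carrier := {φ | ContMDiff (𝓡 m) (𝓡 m) ∞ φ ∧ ContMDiff (𝓡 m) (𝓡 m) ∞ φ.symm ∧
    ∀ h, φ h ∈ K ↔ h ∈ K}
  mul_mem' := by
    rintro φ ψ ⟨h1, h2, h3⟩ ⟨k1, k2, k3⟩
    exact ⟨h1.comp k1, k2.comp h2, fun h => (h3 (ψ h)).trans (k3 h)⟩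
  one_mem' := ⟨contMDiff_id, contMDiff_id, fun _ => Iff.rfl⟩
  inv_mem' := by
    rintro φ ⟨h1, h2, h3⟩
    refine ⟨h2, h1, fun h => ?_⟩
    rw [← h3]
    change φ (φ.symm h) ∈ K ↔ _
    rw [MulEquiv.apply_symm_apply]

/-- The differential `φ_* : 𝔤 → 𝔤` at `1` of a map `φ : G → G` with `φ(1) = 1`. -/
def diffOne (φ : MulAut G) : LieAlg m G →ₗ[ℝ] LieAlg m G :=
  (mfderiv (𝓡 m) (𝓡 m) φ (1 : G)).toLinearMap

theorem diffOne_mul {φ ψ : MulAut G} (hφ : ContMDiff (𝓡 m) (𝓡 m) ∞ φ)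
    (hψ : ContMDiff (𝓡 m) (𝓡 m) ∞ ψ) :
    diffOne (m := m) (φ * ψ) = diffOne φ ∘ₗ diffOne ψ := by
  ext1 X
  have h1 := hψ.mdifferentiableAt (x := 1) (by simp)
  have h2 := hφ.mdifferentiableAt (x := ψ 1) (by simp)
  have := mfderiv_comp (I' := 𝓡 m) (1 : G) h2 h1
  change mfderiv (𝓡 m) (𝓡 m) (φ ∘ ψ) 1 X = mfderiv (𝓡 m) (𝓡 m) φ 1 (diffOne ψ X)
  rw [this]
  change mfderiv (𝓡 m) (𝓡 m) φ (ψ 1) (diffOne ψ X) = _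
  rw [map_one]

variable [LieGroup (𝓡 m) ∞ G]

theorem HasVelocity.mul {γ δ : ℝ → G} {X Y : LieAlg m G}
    (hγ : ContMDiff 𝓘(ℝ, ℝ) (𝓡 m) ∞ γ) (hδ : ContMDiff 𝓘(ℝ, ℝ) (𝓡 m) ∞ δ)
    (hγ0 : γ 0 = 1) (hδ0 : δ 0 = 1) (hX : HasVelocity γ X) (hY : HasVelocity δ Y) :
    HasVelocity (fun t => γ t * δ t) (X + Y) := by
  have e : (fun t => γ t * δ t) = (fun p : G × G => p.1 * p.2) ∘ fun t => (γ t, δ t) := rfl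
  have hm : MDifferentiableAt ((𝓡 m).prod (𝓡 m)) (𝓡 m) (fun p : G × G => p.1 * p.2)
      (γ 0, δ 0) :=
    (contMDiff_mul (𝓡 m) ∞).mdifferentiableAt (by simp)
  have h1 := hγ.mdifferentiableAt (x := 0) (by simp)
  have h2 := hδ.mdifferentiableAt (x := 0) (by simp)
  unfold HasVelocity at *
  rw [e, mfderiv_comp (I' := (𝓡 m).prod (𝓡 m)) 0 hm (h1.prodMk h2), mfderiv_prodMk h1 h2]
  have a : (fun z : G => z * δ 0) = id := by ext; simp [hδ0]
  have b : (fun z : G => γ 0 * z) = id := by ext; simp [hγ0]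
  have a' : ∀ u : TangentSpace (𝓡 m) (γ 0),
      (mfderiv (𝓡 m) (𝓡 m) (fun z : G => z * δ 0) (γ 0) u : EuclideanSpace ℝ (Fin m)) = u := by
    intro u; rw [a, mfderiv_id]; rfl
  have b' : ∀ u : TangentSpace (𝓡 m) (δ 0),
      (mfderiv (𝓡 m) (𝓡 m) (fun z : G => γ 0 * z) (δ 0) u : EuclideanSpace ℝ (Fin m)) = u := by
    intro u; rw [b, mfderiv_id]; rfl
  rw [← hX, ← hY]
  refine (mfderiv_prod_eq_add_apply hm).trans ?_
  exact congrArg₂ (fun x y : EuclideanSpace ℝ (Fin m) => x + y) (a' _) (b' _)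

variable (m) in
/-- The Lie algebra of a closed subgroup `K` of `G`: the velocities at `1` of the smooth curves of
`G` that lie in `K`. -/
def lieAlgOf (K : Subgroup G) : Submodule ℝ (LieAlg m G) where
  carrier := {X | ∃ γ : ℝ → G, ContMDiff 𝓘(ℝ, ℝ) (𝓡 m) ∞ γ ∧ γ 0 = 1 ∧ (∀ t, γ t ∈ K) ∧
    HasVelocity γ X}
  add_mem' := by
    rintro X Y ⟨γ, hγ, hγ0, hγK, hX⟩ ⟨δ, hδ, hδ0, hδK, hY⟩
    exact ⟨fun t => γ t * δ t, hγ.mul hδ, by simp [hγ0, hδ0],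
      fun t => mul_mem (hγK t) (hδK t), hX.mul hγ hδ hγ0 hδ0 hY⟩
  zero_mem' := ⟨fun _ => 1, contMDiff_const, rfl, fun _ => one_mem K, by
    unfold HasVelocity; rw [mfderiv_const]; rfl⟩
  smul_mem' := by
    rintro c X ⟨γ, hγ, hγ0, hγK, hX⟩
    exact ⟨fun t => γ (c * t), hγ.comp (contDiff_const.mul contDiff_id).contMDiff,
      by simp [hγ0], fun t => hγK _, hX.smul hγ c⟩

theorem diffOne_mem {K : Subgroup G} {φ : MulAut G} (hφ : φ ∈ AutGK m K) :
    lieAlgOf m K ≤ (lieAlgOf m K).comap (diffOne φ) := by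
  rintro X ⟨γ, hγ, hγ0, hγK, hX⟩
  exact ⟨fun t => φ (γ t), hφ.1.comp hγ, by simp [hγ0], fun t => (hφ.2.2 _).2 (hγK t),
    hX.comp hγ hγ0 hφ.1⟩

variable (m) in
/-- The quotient vector space `𝔤/𝔨`. -/
abbrev QuotGK (K : Subgroup G) : Type := LieAlg m G ⧸ lieAlgOf m K

/-- The representation `φ ↦ φ_{𝔤/𝔨}`, `[X] ↦ [φ_* X]`, of `Aut(G, K)` on `𝔤/𝔨`. -/
def quotRep (K : Subgroup G) : AutGK m K →* Module.End ℝ (QuotGK m K) where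
  toFun φ := (lieAlgOf m K).mapQ (lieAlgOf m K) (diffOne φ.1) (diffOne_mem φ.2)
  map_one' := by
    apply Submodule.linearMap_qext
    ext1 X
    change Submodule.Quotient.mk (mfderiv (𝓡 m) (𝓡 m) (id : G → G) 1 X) = _
    rw [mfderiv_id]
    rfl
  map_mul' φ ψ := by
    apply Submodule.linearMap_qext
    ext1 X
    change Submodule.Quotient.mk (diffOne (φ.1 * ψ.1) X) = _
    rw [diffOne_mul φ.2.1 ψ.2.1]
    rfl

/-- Conjugation by `k ∈ K`, as an element of `Aut(G, K)`. -/
def innK (K : Subgroup G) (k : K) : AutGK m K :=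
  ⟨MulAut.conj (k : G), (contMDiff_mul_left (a := (k : G))).mul contMDiff_const, by
    refine (contMDiff_mul_left (a := (k : G)⁻¹)).mul contMDiff_const, fun h => by
    rw [MulAut.conj_apply, K.mul_mem_cancel_right (inv_mem k.2), K.mul_mem_cancel_left k.2]⟩

/-- The representation of `K` on `𝔤/𝔨` induced by the adjoint representation of `G`. -/
def AdQ (K : Subgroup G) (k : K) : QuotGK m K →ₗ[ℝ] QuotGK m K := quotRep K (innK K k)

variable (m) in
/-- The space `S³((𝔤/𝔨)*)^K` of `K`-invariant symmetric trilinear forms on `𝔤/𝔨`. -/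
def S3Q (K : Subgroup G) : Submodule ℝ (MultilinearMap ℝ (fun _ : Fin 3 => QuotGK m K) ℝ) where
  carrier := {C | C ∈ Sym3 (QuotGK m K) ∧ ∀ (k : K) v, C (fun i => AdQ K k (v i)) = C v}
  add_mem' hC hC' := ⟨add_mem hC.1 hC'.1, fun k v => by simp [hC.2 k v, hC'.2 k v]⟩
  zero_mem' := ⟨zero_mem _, fun _ _ => by simp⟩
  smul_mem' c C hC := ⟨Submodule.smul_mem _ c hC.1, fun k v => by simp [hC.2 k v]⟩

instance S3Q.topology (K : Subgroup G) : TopologicalSpace (S3Q m K) := moduleTopology ℝ _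

/-- The action of `Aut(G, K)` on `S³((𝔤/𝔨)*)^K` by `φ • C = (φ⁻¹)^* C`. -/
instance S3Q.action (K : Subgroup G) : MulAction (AutGK m K) (S3Q m K) where
  smul φ C := ⟨C.1.compLinearMap fun _ => quotRep K φ⁻¹, fun τ v => C.2.1 τ fun i => quotRep K φ⁻¹ (v i), fun k v => by
    have h : φ⁻¹ * innK K k = innK K ⟨φ.1.symm k, (φ⁻¹).2.2.2 k |>.2 k.2⟩ * φ⁻¹ := by
      apply Subtype.ext
      apply MulEquiv.ext
      intro x
      change φ.1.symm (k * x * (k : G)⁻¹) = φ.1.symm k * φ.1.symm x * (φ.1.symm k)⁻¹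
      simp
    have h' : ∀ u, quotRep K φ⁻¹ (AdQ K k u) =
        AdQ K ⟨φ.1.symm k, (φ⁻¹).2.2.2 k |>.2 k.2⟩ (quotRep K φ⁻¹ u) := fun u => by
      have := congrArg (fun a => quotRep K a u) h
      simpa [AdQ] using this
    simp only [MultilinearMap.compLinearMap_apply, h']
    exact C.2.2 _ _⟩
  one_smul C := by
    apply Subtype.ext
    ext v
    change C.1 (fun i => quotRep K 1⁻¹ (v i)) = C.1 v
    simp
  mul_smul φ ψ C := by
    apply Subtype.ext
    ext v
    change C.1 (fun i => quotRep K (φ * ψ)⁻¹ (v i)) =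
      C.1 (fun i => quotRep K ψ⁻¹ (quotRep K φ⁻¹ (v i)))
    simp

end Group


set_option linter.unusedSectionVars false

/-! ### Homogeneous Riemannian manifolds -/

section Homogeneous

variable {m : ℕ} (G : Type v) [TopologicalSpace G] [ChartedSpace (EuclideanSpace ℝ (Fin m)) G]
  [Group G] [LieGroup (𝓡 m) ∞ G]
  {n : ℕ} {M : Type u} [TopologicalSpace M] [ChartedSpace (EuclideanSpace ℝ (Fin n)) M]
  [IsManifold (𝓡 n) ∞ M] [MulAction G M] [ContMDiffSMul (𝓡 m) (𝓡 n) ∞ G M]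

/-- The diffeomorphism `σ_h : x ↦ h • x` of `M`. -/
abbrev actBy (m : ℕ) {G : Type v} [TopologicalSpace G]
    [ChartedSpace (EuclideanSpace ℝ (Fin m)) G] [Group G] (n : ℕ) (M : Type u)
    [TopologicalSpace M] [ChartedSpace (EuclideanSpace ℝ (Fin n)) M] [MulAction G M]
    [ContMDiffSMul (𝓡 m) (𝓡 n) ∞ G M] (h : G) : M ≃ₘ⟮𝓡 n, 𝓡 n⟯ M :=
  Diffeomorph.smul (𝓡 m) (𝓡 n) ∞ h

variable (m) in
/-- The metric `g` is `G`-invariant. -/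
def IsInvMetric (g : RMetric n M) : Prop := ∀ h : G, IsIsometric (actBy m n M h) g g

variable (m) in
/-- `Stat^G(M, g)`, the set of `G`-invariant statistical connections on `(M, g)`. -/
def StatG (g : RMetric n M) : Type u :=
  {D : AffineConnection n M // IsStatistical g D ∧ ∀ h : G, IsPullback (actBy m n M h) D D}

variable (m n M) in
/-- `Γ(S³T*M)^G`, the space of `G`-invariant symmetric `(0,3)`-tensor fields. -/
def InvField :
    Submodule ℝ (∀ x : M, MultilinearMap ℝ (fun _ : Fin 3 => TangentSpace (𝓡 n) x) ℝ) where
  carrier := {C | C ∈ Sym3Field n M ∧ ∀ (h : G) (x : M) (v : Fin 3 → TangentSpace (𝓡 n) x),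
    C (actBy m n M h x) (fun i => mfderiv (𝓡 n) (𝓡 n) (actBy m n M h) x (v i)) = C x v}
  add_mem' hC hC' := ⟨add_mem hC.1 hC'.1,
    fun h x v => congrArg₂ (fun a b : ℝ => a + b) (hC.2 h x v) (hC'.2 h x v)⟩
  zero_mem' := ⟨zero_mem _, fun _ _ _ => rfl⟩
  smul_mem' c _ hC := ⟨Submodule.smul_mem _ c hC.1,
    fun h x v => congrArg (fun a : ℝ => c * a) (hC.2 h x v)⟩

/-- The canonical (Hausdorff vector space) topology of the finite-dimensional space
`Γ(S³T*M)^G`. -/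
instance InvField.topology : TopologicalSpace (InvField m G n M) := moduleTopology ℝ _

/-- The map `∇ ↦ C^∇`, `Stat^G(M, g) → Γ(S³T*M)^G`, sending a connection to its cubic form. -/
def cubic (g : RMetric n M) (D : StatG m G g) : InvField m G n M :=
  open Classical in
  if h : ∃ C : InvField m G n M, IsCubicForm g D.1 C.1 then h.choose else 0

/-- `Stat^G(M, g)` carries the topology transported from `Γ(S³T*M)^G` by `∇ ↦ C^∇`. -/
instance StatG.topology (g : RMetric n M) : TopologicalSpace (StatG m G g) :=
  TopologicalSpace.induced (cubic G g) inferInstance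

variable (p₀ : M)

/-- The isotropy subgroup `K` of `G` at `p₀`. -/
abbrev Isot : Subgroup G := MulAction.stabilizer G p₀

variable (m n) in
/-- The isotropy representation of `K` on `T_{p₀} M`: the differential of `σ_k` at `p₀`. -/
def isotropy (k : Isot G p₀) : TangentSpace (𝓡 n) p₀ →ₗ[ℝ] TangentSpace (𝓡 n) p₀ :=
  (mfderiv (𝓡 n) (𝓡 n) (actBy m n M (k : G)) p₀).toLinearMap

variable (m n) in
/-- The space `S³(T*_{p₀} M)^K` of `K`-invariant symmetric trilinear forms on `T_{p₀} M`. -/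
def S3T : Submodule ℝ (MultilinearMap ℝ (fun _ : Fin 3 => TangentSpace (𝓡 n) p₀) ℝ) where
  carrier := {C | C ∈ Sym3 (TangentSpace (𝓡 n) p₀) ∧
    ∀ (k : Isot G p₀) v, C (fun i => isotropy m G n p₀ k (v i)) = C v}
  add_mem' hC hC' := ⟨add_mem hC.1 hC'.1, fun k v => by simp [hC.2 k v, hC'.2 k v]⟩
  zero_mem' := ⟨zero_mem _, fun _ _ => by simp⟩
  smul_mem' c C hC := ⟨Submodule.smul_mem _ c hC.1, fun k v => by simp [hC.2 k v]⟩

instance S3T.topology : TopologicalSpace (S3T m G n p₀) := moduleTopology ℝ _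

/-- The evaluation map `Γ(S³T*M)^G → S³(T*_{p₀} M)^K`, `C ↦ C_{p₀}`. -/
def evalAt : InvField m G n M →ₗ[ℝ] S3T m G n p₀ where
  toFun C := ⟨C.1 p₀, C.2.1.1 p₀, fun k v => by
    have h := C.2.2 k p₀ v
    have hk : actBy m n M (k : G) p₀ = p₀ := k.2
    have key : ∀ (y : M), y = p₀ → ∀ w : Fin 3 → EuclideanSpace ℝ (Fin n),
        (C.1 y : MultilinearMap ℝ (fun _ : Fin 3 => EuclideanSpace ℝ (Fin n)) ℝ) w =
        (C.1 p₀ : MultilinearMap ℝ (fun _ : Fin 3 => EuclideanSpace ℝ (Fin n)) ℝ) w := by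
      rintro y rfl w; rfl
    exact (key _ hk _).symm.trans h⟩
  map_add' _ _ := rfl
  map_smul' _ _ := rfl

/-- The orbit map `h ↦ h • p₀`. -/
def orb (h : G) : M := h • p₀

theorem orb_smooth : ContMDiff (𝓡 m) (𝓡 n) ∞ (orb G p₀) :=
  (ContMDiffSMul.contMDiff_smul (I := 𝓡 m) (I' := 𝓡 n) (n := ∞) (G := G) (M := M)).comp
    (contMDiff_id.prodMk contMDiff_const)

variable (m n) in
/-- The map `𝔤 → T_{p₀} M` sending `X` to the velocity at `t = 0` of `t ↦ exp(-tX) • p₀`; by the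
chain rule this is `-d(orb)_1 X`. -/
def velocity : LieAlg m G →ₗ[ℝ] TangentSpace (𝓡 n) p₀ :=
  -(mfderiv (𝓡 m) (𝓡 n) (orb G p₀) (1 : G)).toLinearMap

theorem lieAlgOf_le_ker : lieAlgOf m (Isot G p₀) ≤ LinearMap.ker (velocity m G n p₀) := by
  rintro X ⟨γ, hγ, hγ0, hγK, hX⟩
  have h := hX.comp hγ hγ0 (orb_smooth (m := m) (n := n) G p₀)
  have e : (fun t => orb G p₀ (γ t)) = fun _ => p₀ := funext fun t => hγK t
  rw [e, mfderiv_const] at h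
  rw [LinearMap.mem_ker]
  change -(mfderiv (𝓡 m) (𝓡 n) (orb G p₀) (1 : G) X : EuclideanSpace ℝ (Fin n)) = 0
  rw [← h]
  exact neg_zero

variable (m n) in
/-- The map `Υ : 𝔤/𝔨 → T_{p₀} M`, `[X] ↦ d/dt|_{t=0} exp(-tX) • p₀`. -/
def Ups : QuotGK m (Isot G p₀) →ₗ[ℝ] TangentSpace (𝓡 n) p₀ :=
  (lieAlgOf m (Isot G p₀)).liftQ (velocity m G n p₀) (lieAlgOf_le_ker G p₀)

theorem Ups_AdQ (k : Isot G p₀) (u : QuotGK m (Isot G p₀)) :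
    Ups m G n p₀ (AdQ _ k u) = isotropy m G n p₀ k (Ups m G n p₀ u) := by
  obtain ⟨X, rfl⟩ := Submodule.Quotient.mk_surjective _ u
  have e : orb G p₀ ∘ MulAut.conj (k : G) = actBy m n M (k : G) ∘ orb G p₀ := by
    funext h
    change ((k : G) * h * (k : G)⁻¹) • p₀ = (k : G) • h • p₀
    have : (k : G)⁻¹ • p₀ = p₀ := (k⁻¹).2
    rw [mul_smul, mul_smul, this]
  have hs := orb_smooth (m := m) (n := n) G p₀
  have hc : ContMDiff (𝓡 m) (𝓡 m) ∞ (MulAut.conj (k : G)) := (innK (m := m) _ k).2.1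
  have h1 := mfderiv_comp (I' := 𝓡 m) (1 : G)
    (hs.mdifferentiableAt (x := MulAut.conj (k : G) 1) (by simp))
    (hc.mdifferentiableAt (x := 1) (by simp))
  have h2 := mfderiv_comp (I' := 𝓡 n) (1 : G)
    ((actBy m n M (k : G)).contMDiff.mdifferentiableAt (x := orb G p₀ 1) (by simp))
    (hs.mdifferentiableAt (x := 1) (by simp))
  rw [e] at h1
  have h3 := congrArg (fun L => (L X : EuclideanSpace ℝ (Fin n))) (h1.symm.trans h2)
  have key1 : ∀ (a : G), a = 1 → ∀ w : EuclideanSpace ℝ (Fin m),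
      (mfderiv (𝓡 m) (𝓡 n) (orb G p₀) a w : EuclideanSpace ℝ (Fin n)) =
        mfderiv (𝓡 m) (𝓡 n) (orb G p₀) 1 w := by rintro a rfl w; rfl
  have key2 : ∀ (y : M), y = p₀ → ∀ w : EuclideanSpace ℝ (Fin n),
      (mfderiv (𝓡 n) (𝓡 n) (actBy m n M (k : G)) y w : EuclideanSpace ℝ (Fin n)) =
        mfderiv (𝓡 n) (𝓡 n) (actBy m n M (k : G)) p₀ w := by rintro y rfl w; rfl
  have h4 := (key1 _ (map_one _) _).symm.trans (h3.trans (key2 _ (one_smul G p₀) _))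
  exact (congrArg (fun a : EuclideanSpace ℝ (Fin n) => -a) h4).trans
    (map_neg (isotropy m G n p₀ k) _).symm

/-- The map `Υ^* : S³(T*_{p₀} M)^K → S³((𝔤/𝔨)*)^K`. -/
def pullUps : S3T m G n p₀ →ₗ[ℝ] S3Q m (Isot G p₀) where
  toFun C := ⟨C.1.compLinearMap fun _ => Ups m G n p₀,
    fun τ v => C.2.1 τ fun i => Ups m G n p₀ (v i), fun k v => by
      simp only [MultilinearMap.compLinearMap_apply, Ups_AdQ]
      exact C.2.2 k _⟩
  map_add' _ _ := rfl
  map_smul' _ _ := rfl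

variable (m) in
/-- The inner product `g₀` on `𝔤/𝔨` induced by `g` through `Υ`. -/
def g₀ (g : RMetric n M) (u v : QuotGK m (Isot G p₀)) : ℝ :=
  g.inner p₀ (Ups m G n p₀ u) (Ups m G n p₀ v)

variable (m) in
/-- The group `Aut(G, K, g₀)` of those `φ ∈ Aut(G, K)` for which `φ_{𝔤/𝔨}` preserves `g₀`. -/
def AutGKg (g : RMetric n M) : Subgroup (AutGK m (Isot G p₀)) where
  carrier := {φ | ∀ u v, g₀ m G p₀ g (quotRep _ φ u) (quotRep _ φ v) = g₀ m G p₀ g u v}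
  mul_mem' {φ ψ} hφ hψ u v := by
    rw [map_mul]
    exact (hφ _ _).trans (hψ u v)
  one_mem' u v := by rw [map_one]; rfl
  inv_mem' {φ} hφ u v := by
    have h : ∀ w, quotRep _ φ (quotRep _ φ⁻¹ w) = w := fun w => by
      rw [← Module.End.mul_apply, ← map_mul, mul_inv_cancel, map_one]
      rfl
    have := hφ (quotRep _ φ⁻¹ u) (quotRep _ φ⁻¹ v)
    rw [h, h] at this
    exact this.symm

variable {G}

/-- `∇ ∼ ∇'`: the homogeneous statistical manifolds `(M, g, ∇, G, σ)` and `(M, g, ∇', G, σ)` are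
isomorphic, that is, there are a Lie group automorphism `φ` of `G` and a diffeomorphism `f` of `M`
with `f(h • x) = φ(h) • f(x)`, `f^* g = g` and `f^* ∇' = ∇`. -/
def HSRel {g : RMetric n M} (D D' : StatG m G g) : Prop :=
  ∃ (φ : G ≃* G) (f : M ≃ₘ⟮𝓡 n, 𝓡 n⟯ M),
    ContMDiff (𝓡 m) (𝓡 m) ∞ φ ∧ ContMDiff (𝓡 m) (𝓡 m) ∞ φ.symm ∧
    (∀ (h : G) (x : M), f (h • x) = φ h • f x) ∧ IsIsometric f g g ∧ IsPullback f D'.1 D.1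

variable (m G) in
/-- The `HS`-moduli space `Stat^G(M, g) / ∼`, with the quotient topology. -/
abbrev Moduli (g : RMetric n M) : Type u := Quot (HSRel (m := m) (G := G) (g := g))

/-- The quotient `S / ∼` of a subset `S` of `Stat^G(M, g)`, with the quotient topology of the
subspace topology. -/
abbrev ModuliOf {g : RMetric n M} (S : Set (StatG m G g)) : Type u :=
  Quot fun D D' : S => HSRel D.1 D'.1

/-- `Stat^G_𝒞(M, g)`, the set of invariant statistical connections of class `𝒞`. -/
def StatC [T2Space M] [SecondCountableTopology M] (g : RMetric n M) (𝒞 : StatClass.{u}) :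
    Set (StatG m G g) :=
  {D | 𝒞.mem { dim := n, carrier := M, metric := g, conn := D.1, statistical := D.2.1 }}

variable (m G) in
/-- `Γ(S³T*M)^G_{g-𝒞}`, the subset of `Γ(S³T*M)^G` corresponding to `Stat^G_𝒞(M, g)`. -/
def InvFieldC [T2Space M] [SecondCountableTopology M] (g : RMetric n M) (𝒞 : StatClass.{u}) :
    Set (InvField m G n M) :=
  cubic G g '' StatC g 𝒞

variable (m G) in
/-- `S³(T*_{p₀} M)^K_{g-𝒞}`, the subset of `S³(T*_{p₀} M)^K` corresponding to
`Stat^G_𝒞(M, g)`. -/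
def S3TC [T2Space M] [SecondCountableTopology M] (g : RMetric n M) (𝒞 : StatClass.{u}) :
    Set (S3T m G n p₀) :=
  evalAt G p₀ '' InvFieldC m G g 𝒞

variable (m G) in
/-- `S³((𝔤/𝔨)*)^K_{g-𝒞}`, the subset of `S³((𝔤/𝔨)*)^K` corresponding to `Stat^G_𝒞(M, g)`. -/
def S3QC [T2Space M] [SecondCountableTopology M] (g : RMetric n M) (𝒞 : StatClass.{u}) :
    Set (S3Q m (Isot G p₀)) :=
  pullUps G p₀ '' S3TC m G p₀ g 𝒞

end Homogeneous

/-- The orbit space `A \ S` of an `A`-stable subset `S` of an `A`-space `X`, with the quotient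
topology. -/
abbrev OrbitSpace (A : Type v) {X : Type u} [Group A] [MulAction A X] (S : Set X) : Type u :=
  Quotient ((MulAction.orbitRel A X).comap (Subtype.val : S → X))

/-- The orbit of a point of `S`, as a point of `A \ S`. -/
abbrev OrbitSpace.mk (A : Type v) {X : Type u} [Group A] [MulAction A X] {S : Set X} (x : X)
    (hx : x ∈ S) : OrbitSpace A S :=
  Quotient.mk _ ⟨x, hx⟩

/-- `S` is stable under the action of `A`. -/
def IsStable (A : Type v) {X : Type u} [Group A] [MulAction A X] (S : Set X) : Prop :=
  ∀ (a : A), ∀ x ∈ S, a • x ∈ S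

end HomogStat

end

open HomogStat

set_option linter.unusedSectionVars false

/-! Three bijections carry the theorem, and all of them respect `Aut(G, K, g₀)`.

The first is ∇ ↦ C^∇. The difference of a connection and ∇^g is a tensor. After lowering an index
with g, torsion-freeness is symmetry in the first two slots, and symmetry of ∇g then gives symmetry
in all three. Conversely, every symmetric C gives ∇^g + S with g(S_X Y, Z) = -½ C(X, Y, Z). An
isometry preserves ∇^g by uniqueness, so ∇ is G-invariant exactly when C^∇ is
(`IsCubicForm.natural`, `IsCubicForm.isPullback`).

The second is C ↦ C_{p₀}. An invariant field is determined by its value at p₀ because the action is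
transitive. A K-invariant form at p₀ spreads over M by translation, and it does so smoothly because
the orbit map has smooth local sections. The third is Υ^*, a bijection because Υ is one.

Sections and Υ both rest on the orbit map G → M being a submersion (`surjective_orb`). By
homogeneity its rank nowhere exceeds the rank at 1. Were that rank deficient, small compact pieces
of G would have images without interior, and countably many of their translates would cover M,
against Baire's theorem. Once the map is a submersion, straightening it gives sections, and it also
gives curves in the fibres, which identify the kernel of its differential with 𝔨.

For the moduli spaces, an equivalence (φ, f) is composed with a group element that brings f(p₀) back
to p₀. This conjugates φ into Aut(G, K) and changes neither g nor ∇', both being invariant. The new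
f is f_φ, and it is isometric exactly when φ preserves g₀ (`hsRel_iff_exists`). Hence ∼ is the orbit
relation. The bijections are homeomorphisms, since linear bijections of finite-dimensional spaces
are and the topology on connections is transported, so they descend to the orbit spaces and to the
orbit spaces of stable subsets. -/

namespace HomogStat

/-! ### Local frames, tensoriality and duality of vector fields and forms -/

section Frames

open scoped Topology

variable {n : ℕ} {M : Type u} [TopologicalSpace M] [ChartedSpace (EuclideanSpace ℝ (Fin n)) M]
  [IsManifold (𝓡 n) ∞ M]

instance (x : M) : FiniteDimensional ℝ (TangentSpace (𝓡 n) x) :=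
  inferInstanceAs (FiniteDimensional ℝ (EuclideanSpace ℝ (Fin n)))

theorem finrank_tangentSpace (x : M) : Module.finrank ℝ (TangentSpace (𝓡 n) x) = n :=
  finrank_euclideanSpace_fin (𝕜 := ℝ) (n := n)

@[simp] theorem VF.fsmul_apply (f : C^∞⟮𝓡 n, M; 𝓘(ℝ, ℝ), ℝ⟯) (X : VF n M) (x : M) :
    VF.fsmul f X x = f x • X x := rfl

@[simp] theorem VF.add_apply (X Y : VF n M) (x : M) : (X + Y) x = X x + Y x := rfl

@[simp] theorem VF.sub_apply (X Y : VF n M) (x : M) : (X - Y) x = X x - Y x := rfl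

theorem VF.sum_apply {ι : Type*} (s : Finset ι) (X : ι → VF n M) (x : M) :
    (∑ i ∈ s, X i) x = ∑ i ∈ s, X i x := by
  classical
  induction s using Finset.induction_on with
  | empty => rfl
  | insert a s ha ih => rw [Finset.sum_insert ha, Finset.sum_insert ha, ← ih]; rfl

/-- The smooth function `g(X, Y)`. -/
theorem RMetric.app_contMDiffAt (g : RMetric n M) {V W : ∀ x : M, TangentSpace (𝓡 n) x} {x : M}
    (hV : ContMDiffAt (𝓡 n) ((𝓡 n).prod 𝓘(ℝ, EuclideanSpace ℝ (Fin n))) ∞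
      (fun x => TotalSpace.mk' (EuclideanSpace ℝ (Fin n)) x (V x)) x)
    (hW : ContMDiffAt (𝓡 n) ((𝓡 n).prod 𝓘(ℝ, EuclideanSpace ℝ (Fin n))) ∞
      (fun x => TotalSpace.mk' (EuclideanSpace ℝ (Fin n)) x (W x)) x) :
    ContMDiffAt (𝓡 n) 𝓘(ℝ, ℝ) ∞ (fun x => g.inner x (V x) (W x)) x := by
  have : ContMDiffAt (𝓡 n) ((𝓡 n).prod 𝓘(ℝ)) ∞
      (fun m ↦ TotalSpace.mk' ℝ (E := Bundle.Trivial M ℝ) m (g.inner m (V m) (W m))) x :=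
    ContMDiffAt.clm_bundle_apply₂ (F₁ := EuclideanSpace ℝ (Fin n))
      (F₂ := EuclideanSpace ℝ (Fin n)) (g.contMDiff x) hV hW
  simp only [contMDiffAt_totalSpace] at this
  exact this.2

theorem RMetric.app_contMDiff (g : RMetric n M) (X Y : VF n M) :
    ContMDiff (𝓡 n) 𝓘(ℝ, ℝ) ∞ (g.app X Y) :=
  fun x => g.app_contMDiffAt (X.contMDiff x) (Y.contMDiff x)

theorem RMetric.eq_of_inner (g : RMetric n M) (x : M) {u v : TangentSpace (𝓡 n) x}
    (h : ∀ w, g.inner x u w = g.inner x v w) : u = v := by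
  by_contra huv
  have h1 := g.pos x (u - v) (sub_ne_zero.2 huv)
  have h2 := h (u - v)
  rw [map_sub (g.inner x), sub_apply, h2, sub_self] at h1
  exact lt_irrefl _ h1

theorem RMetric.exists_riesz (g : RMetric n M) (x : M) (α : TangentSpace (𝓡 n) x →ₗ[ℝ] ℝ) :
    ∃ u, ∀ w, g.inner x u w = α w := by
  let L : TangentSpace (𝓡 n) x →ₗ[ℝ] Module.Dual ℝ (TangentSpace (𝓡 n) x) :=
    { toFun := fun u => (g.inner x u).toLinearMap
      map_add' := fun u v => by ext w; simp
      map_smul' := fun c v => by ext w; simp }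
  have hL : Function.Injective L := fun u v huv =>
    g.eq_of_inner x fun w => congrArg (fun l => l w) huv
  have hs : Function.Surjective L :=
    (LinearMap.injective_iff_surjective_of_finrank_eq_finrank
      (Subspace.dual_finrank_eq (K := ℝ)).symm).1 hL
  obtain ⟨u, hu⟩ := hs α
  exact ⟨u, fun w => congrArg (fun l => l w) hu⟩

variable [T2Space M]

/-- A local frame of global vector fields around `x₀` together with cut off coordinate forms. -/
theorem exists_frame (x₀ : M) : ∃ (E : Fin n → VF n M)
    (θ : Fin n → ∀ x : M, TangentSpace (𝓡 n) x →ₗ[ℝ] ℝ) (χ : C^∞⟮𝓡 n, M; 𝓘(ℝ, ℝ), ℝ⟯),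
    (∀ (i : Fin n) (W : ∀ x : M, TangentSpace (𝓡 n) x) (x : M),
      ContMDiffAt (𝓡 n) ((𝓡 n).prod 𝓘(ℝ, EuclideanSpace ℝ (Fin n))) ∞
        (fun x => TotalSpace.mk' (EuclideanSpace ℝ (Fin n)) x (W x)) x →
      ContMDiffAt (𝓡 n) 𝓘(ℝ, ℝ) ∞ (fun x => θ i x (W x)) x) ∧
    (∀ x v, χ x • v = ∑ i, θ i x v • E i x) ∧ ∀ᶠ x in 𝓝 x₀, χ x = 1 := by
  let e := trivializationAt (EuclideanSpace ℝ (Fin n)) (TangentSpace (𝓡 n) : M → Type) x₀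
  let b := (EuclideanSpace.basisFun (Fin n) ℝ).toBasis
  have hx₀ : x₀ ∈ e.baseSet := FiberBundle.mem_baseSet_trivializationAt _ _ x₀
  obtain ⟨ψ, hψ⟩ := ((SmoothBumpFunction.nhds_basis_tsupport (I := 𝓡 n) x₀).mem_iff).1
    (e.open_baseSet.mem_nhds hx₀)
  have hψs : ContMDiff (𝓡 n) 𝓘(ℝ, ℝ) ∞ ψ := ψ.contMDiff
  -- The local frame and its coefficients are each cut off by ψ, so both extend by zero to all of M;
  -- their products then carry the factor ψ².
  refine ⟨fun i => ⟨fun x => ψ x • e.localFrame b i x, ?_⟩,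
    fun i x => ψ x • e.localFrameCoeff (𝓡 n) b i x, ⟨fun x => ψ x * ψ x, hψs.mul hψs⟩, ?_, ?_, ?_⟩
  · exact ContMDiffOn.smul_section_of_tsupport (u := e.baseSet) hψs.contMDiffOn e.open_baseSet hψ.2
      (e.contMDiffOn_localFrame_baseSet ∞ b i)
  · intro i W x hW
    by_cases hx : x ∈ e.baseSet
    · exact (hψs x).mul (contMDiffAt_localFrameCoeff b hx hW i)
    · have hx' : x ∉ tsupport ψ := fun h => hx (hψ.2 h)
      refine (contMDiffAt_const (c := (0 : ℝ))).congr_of_eventuallyEq ?_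
      filter_upwards [(isClosed_tsupport ψ).isOpen_compl.mem_nhds hx'] with y hy
      simp [image_eq_zero_of_notMem_tsupport hy]
  · intro x v
    by_cases hx : x ∈ e.baseSet
    · classical
      have hs := e.eq_sum_localFrameCoeff_smul (I := 𝓡 n) (b := b) (x' := x)
        (s := Function.update 0 x v) hx
      simp only [Function.update_self] at hs
      change (ψ x * ψ x) • v = ∑ i, (ψ x • e.localFrameCoeff (𝓡 n) b i x v) •
        (ψ x • e.localFrame b i x)
      conv_lhs => rw [hs]
      rw [Finset.smul_sum]
      refine Finset.sum_congr rfl fun i _ => ?_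
      simp only [smul_smul, smul_eq_mul]
      congr 1
      ring
    · have hx' : ψ x = 0 := image_eq_zero_of_notMem_tsupport fun h => hx (hψ.2 h)
      change (ψ x * ψ x) • v = ∑ i, (ψ x • e.localFrameCoeff (𝓡 n) b i x v) •
        (ψ x • e.localFrame b i x)
      simp [hx']
  · filter_upwards [ψ.eventuallyEq_one] with x hx
    change ψ x * ψ x = 1
    simp [hx]

/-- Every tangent vector extends to a smooth vector field. -/
theorem VF.exists_extend (x : M) (v : TangentSpace (𝓡 n) x) : ∃ X : VF n M, X x = v := by
  obtain ⟨E, θ, χ, -, h, h1⟩ := exists_frame (n := n) x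
  refine ⟨∑ i, (θ i x v) • E i, ?_⟩
  rw [VF.sum_apply]
  have := h x v
  rw [h1.self_of_nhds, one_smul] at this
  exact this.symm

/-- A `C^∞`-linear operation on vector fields is given by a linear map on the tangent space. -/
theorem VF.exists_linearMap {A : Type*} [AddCommGroup A] [Module ℝ A] (x : M) (Φ : VF n M → A)
    (hadd : ∀ X Y, Φ (X + Y) = Φ X + Φ Y) (hsmul : ∀ f X, Φ (VF.fsmul f X) = f x • Φ X) :
    ∃ α : TangentSpace (𝓡 n) x →ₗ[ℝ] A, ∀ X, Φ X = α (X x) := by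
  obtain ⟨E, θ, χ, hθ, h, h1⟩ := exists_frame (n := n) x
  refine ⟨∑ i, (θ i x).smulRight (Φ (E i)), fun X => ?_⟩
  -- Since χ x = 1, the value Φ X equals Φ (χ X), and χ X is globally a combination of the E i, so
  -- only the coefficients at x enter.
  have e : VF.fsmul χ X =
      ∑ i, VF.fsmul ⟨fun y => θ i y (X y), fun y => hθ i _ y (X.contMDiff y)⟩ (E i) := by
    ext1 y
    rw [VF.sum_apply]
    exact h y (X y)
  have hsum : ∀ (s : Finset (Fin n)) (Y : Fin n → VF n M),
      Φ (∑ i ∈ s, Y i) = ∑ i ∈ s, Φ (Y i) := fun s Y => by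
    let Ψ : VF n M →+ A := AddMonoidHom.mk' Φ hadd
    exact map_sum Ψ Y s
  have := hsmul χ X
  rw [h1.self_of_nhds, one_smul, e, hsum] at this
  rw [← this]
  rw [LinearMap.sum_apply]
  exact Finset.sum_congr rfl fun i _ => hsmul _ _

theorem contMDiffAt_det {k : ℕ} {A : M → Matrix (Fin k) (Fin k) ℝ} {x : M}
    (hA : ∀ i j, ContMDiffAt (𝓡 n) 𝓘(ℝ, ℝ) ∞ (fun y => A y i j) x) :
    ContMDiffAt (𝓡 n) 𝓘(ℝ, ℝ) ∞ (fun y => (A y).det) x := by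
  simp only [Matrix.det_apply']
  refine contMDiffAt_finsetSum fun σ _ => contMDiffAt_const.mul ?_
  exact contMDiffAt_finsetProd fun i _ => hA _ _

/-- Smoothness of vector fields can be tested by inner products with smooth vector fields. -/
theorem RMetric.contMDiff_of_inner (g : RMetric n M) (W : ∀ x : M, TangentSpace (𝓡 n) x)
    (hW : ∀ Z : VF n M, ContMDiff (𝓡 n) 𝓘(ℝ, ℝ) ∞ fun x => g.inner x (W x) (Z x)) :
    ContMDiff (𝓡 n) ((𝓡 n).prod 𝓘(ℝ, EuclideanSpace ℝ (Fin n))) ∞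
      (fun x => TotalSpace.mk' (EuclideanSpace ℝ (Fin n)) x (W x)) := by
  intro x₀
  obtain ⟨E, θ, χ, hθ, h, h1⟩ := exists_frame (n := n) x₀
  let A : M → Matrix (Fin n) (Fin n) ℝ := fun x => Matrix.of fun j i => g.app (E i) (E j) x
  let a : M → Fin n → ℝ := fun x j => g.inner x (W x) (E j x)
  have hA : ∀ i j, ContMDiffAt (𝓡 n) 𝓘(ℝ, ℝ) ∞ (fun y => A y i j) x₀ := fun i j =>
    g.app_contMDiff (E j) (E i) x₀
  -- The E i span at x₀, hence form a basis there. A kernel vector c of the Gram matrix makes ∑ c i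
  -- • E i orthogonal to every E j, hence zero.
  have hdet : (A x₀).det ≠ 0 := by
    intro h0
    obtain ⟨c, hc, hc'⟩ := Matrix.exists_mulVec_eq_zero_iff.2 h0
    have hspan : ⊤ ≤ Submodule.span ℝ (Set.range fun i => E i x₀) := by
      rintro v -
      have := h x₀ v
      rw [h1.self_of_nhds, one_smul] at this
      rw [this]
      exact Submodule.sum_mem _ fun i _ => Submodule.smul_mem _ _
        (Submodule.subset_span ⟨i, rfl⟩)
    have hli := linearIndependent_of_top_le_span_of_card_eq_finrank hspan
      ((Fintype.card_fin n).trans (finrank_tangentSpace x₀).symm)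
    have hzero : ∑ i, c i • E i x₀ = 0 := by
      refine g.eq_of_inner x₀ fun w => ?_
      have hw := h x₀ w
      rw [h1.self_of_nhds, one_smul] at hw
      rw [hw, map_zero, zero_apply, map_sum]
      refine Finset.sum_eq_zero fun j _ => ?_
      rw [map_smul, map_sum, sum_apply]
      have : ∑ i, (g.inner x₀ (c i • E i x₀)) (E j x₀) = (A x₀).mulVec c j := by
        rw [Matrix.mulVec, dotProduct]
        refine Finset.sum_congr rfl fun i _ => ?_
        rw [map_smul, smul_apply, smul_eq_mul, mul_comm]
        rfl
      rw [this, hc', Pi.zero_apply, smul_zero]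
    exact hc (funext (Fintype.linearIndependent_iff.1 hli c hzero))
  have hw : ∀ i, ContMDiffAt (𝓡 n) 𝓘(ℝ, ℝ) ∞ (fun x => θ i x (W x)) x₀ := by
    intro i
    -- The coefficients of W solve the linear system with the Gram matrix and right-hand side g(W, E
    -- j); Cramer's rule writes them as quotients of smooth functions.
    have key : ∀ᶠ x in 𝓝 x₀, θ i x (W x) = ((A x).updateCol i (a x)).det / (A x).det := by
      have hne := (contMDiffAt_det hA).continuousAt.eventually_ne hdet
      filter_upwards [h1, hne] with x hx hdx
      have hmul : (A x).mulVec (fun i => θ i x (W x)) = a x := by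
        funext j
        have hWx := h x (W x)
        rw [hx, one_smul] at hWx
        change ∑ i, g.inner x (E i x) (E j x) * θ i x (W x) = g.inner x (W x) (E j x)
        conv_rhs => rw [hWx]
        rw [map_sum, sum_apply]
        refine Finset.sum_congr rfl fun i _ => ?_
        rw [map_smul, smul_apply, smul_eq_mul, mul_comm]
      rw [eq_div_iff hdx, ← Matrix.cramer_apply, Matrix.cramer_eq_adjugate_mulVec, ← hmul,
        Matrix.mulVec_mulVec, Matrix.adjugate_mul, Matrix.smul_mulVec, Matrix.one_mulVec,
        Pi.smul_apply, smul_eq_mul, mul_comm]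
    refine ContMDiffAt.congr_of_eventuallyEq ?_ key
    refine ContMDiffAt.div₀ (contMDiffAt_det fun k j => ?_) (contMDiffAt_det hA) hdet
    by_cases hj : j = i
    · subst hj
      simp only [Matrix.updateCol_self]
      exact hW (E k) x₀
    · simp only [Matrix.updateCol_ne hj]
      exact hA k j
  have hsum : ContMDiffAt (𝓡 n) ((𝓡 n).prod 𝓘(ℝ, EuclideanSpace ℝ (Fin n))) ∞
      (fun x => TotalSpace.mk' (EuclideanSpace ℝ (Fin n)) x (∑ i, θ i x (W x) • E i x)) x₀ :=
    ContMDiffAt.sum_section fun i _ => (hw i).smul_section ((E i).contMDiff x₀)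
  refine hsum.congr_of_eventuallyEq ?_
  filter_upwards [h1] with x hx
  have := h x (W x)
  rw [hx, one_smul] at this
  rw [← this]

/-- The vector field dual to a `C^∞`-linear functional on vector fields. -/
theorem RMetric.exists_sharp (g : RMetric n M) (Φ : VF n M → M → ℝ)
    (hadd : ∀ X Y x, Φ (X + Y) x = Φ X x + Φ Y x)
    (hsmul : ∀ f X x, Φ (VF.fsmul f X) x = f x * Φ X x)
    (hsmooth : ∀ X, ContMDiff (𝓡 n) 𝓘(ℝ, ℝ) ∞ (Φ X)) :
    ∃ W : VF n M, ∀ Z x, g.app W Z x = Φ Z x := by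
  choose α hα using fun x => VF.exists_linearMap x (fun X => Φ X x) (fun X Y => hadd X Y x)
    (fun f X => hsmul f X x)
  choose W hW using fun x => g.exists_riesz x (α x)
  have hWΦ : ∀ (Z : VF n M) x, g.inner x (W x) (Z x) = Φ Z x := fun Z x =>
    (hW x _).trans (hα x Z).symm
  refine ⟨⟨W, g.contMDiff_of_inner W fun Z => ?_⟩, fun Z x => hWΦ Z x⟩
  simp only [hWΦ]
  exact hsmooth Z

/-- Reduces identities between vector fields, such as the axioms of a connection, to scalar
identities tested on global fields. -/
theorem RMetric.ext_app (g : RMetric n M) {X Y : VF n M} {x : M}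
    (h : ∀ Z : VF n M, g.app X Z x = g.app Y Z x) : X x = Y x :=
  g.eq_of_inner x fun w => by
    obtain ⟨Z, rfl⟩ := VF.exists_extend x w
    exact h Z

end Frames

/-! ### The Levi-Civita connection from the Koszul formula -/

section LeviCivita

variable {n : ℕ} {M : Type u} [TopologicalSpace M] [ChartedSpace (EuclideanSpace ℝ (Fin n)) M]
  [IsManifold (𝓡 n) ∞ M]

instance : IsManifold (𝓡 n) (minSmoothness ℝ 2) M :=
  .of_le (n := ∞) (by simpa using ENat.LEInfty.out)

instance : IsManifold (𝓡 n) (minSmoothness ℝ 3) M :=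
  .of_le (n := ∞) (by simpa using ENat.LEInfty.out)

instance : IsManifold (𝓡 n) (∞ + 1) M :=
  .of_le (n := ∞) le_rfl

theorem VF.mdifferentiableAt (X : VF n M) (x : M) :
    MDifferentiableAt (𝓡 n) ((𝓡 n).prod 𝓘(ℝ, EuclideanSpace ℝ (Fin n)))
      (fun x => TotalSpace.mk' (EuclideanSpace ℝ (Fin n)) x (X x)) x :=
  (X.contMDiff x).mdifferentiableAt (by simp)

/-- X f is the fibre component of the tangent map of f composed with the section X. -/
theorem VF.deriv_contMDiff (X : VF n M) {f : M → ℝ} (hf : ContMDiff (𝓡 n) 𝓘(ℝ, ℝ) ∞ f) :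
    ContMDiff (𝓡 n) 𝓘(ℝ, ℝ) ∞ (X.deriv f) := by
  have h := (hf.contMDiff_tangentMap (m := ∞) (by simp)).comp X.contMDiff
  intro x
  have := (contMDiffAt_totalSpace.1 (h x)).2
  simpa using! this

theorem VF.deriv_mul (X : VF n M) {f h : M → ℝ} {x : M}
    (hf : MDifferentiableAt (𝓡 n) 𝓘(ℝ, ℝ) f x) (hh : MDifferentiableAt (𝓡 n) 𝓘(ℝ, ℝ) h x) :
    X.deriv (fun y => f y * h y) x = f x * X.deriv h x + X.deriv f x * h x := by
  have := (hf.hasMFDerivAt.mul hh.hasMFDerivAt).mfderiv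
  have e := congrArg (fun L => (L (X x) : ℝ)) this
  refine Eq.trans e ?_
  change f x * X.deriv h x + h x * X.deriv f x = _
  ring

theorem VF.deriv_add (X : VF n M) {f h : M → ℝ} {x : M}
    (hf : MDifferentiableAt (𝓡 n) 𝓘(ℝ, ℝ) f x) (hh : MDifferentiableAt (𝓡 n) 𝓘(ℝ, ℝ) h x) :
    X.deriv (fun y => f y + h y) x = X.deriv f x + X.deriv h x := by
  have := (hf.hasMFDerivAt.add hh.hasMFDerivAt).mfderiv
  exact congrArg (fun L => (L (X x) : ℝ)) this

theorem VF.add_deriv (X Y : VF n M) (f : M → ℝ) (x : M) :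
    (X + Y).deriv f x = X.deriv f x + Y.deriv f x :=
  map_add (mfderiv (𝓡 n) 𝓘(ℝ, ℝ) f x) (X x) (Y x)

theorem VF.fsmul_deriv (f : C^∞⟮𝓡 n, M; 𝓘(ℝ, ℝ), ℝ⟯) (X : VF n M) (h : M → ℝ) (x : M) :
    (VF.fsmul f X).deriv h x = f x * X.deriv h x :=
  map_smul (mfderiv (𝓡 n) 𝓘(ℝ, ℝ) h x) (f x) (X x)

theorem smooth_mdifferentiableAt (f : C^∞⟮𝓡 n, M; 𝓘(ℝ, ℝ), ℝ⟯) (x : M) :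
    MDifferentiableAt (𝓡 n) 𝓘(ℝ, ℝ) f x :=
  (f.contMDiff x).mdifferentiableAt (by simp)

variable (g : RMetric n M)

theorem RMetric.app_mdifferentiableAt (X Y : VF n M) (x : M) :
    MDifferentiableAt (𝓡 n) 𝓘(ℝ, ℝ) (g.app X Y) x :=
  (g.app_contMDiff X Y x).mdifferentiableAt (by simp)

theorem RMetric.app_comm (X Y : VF n M) : g.app X Y = g.app Y X :=
  funext fun x => g.symm x _ _

theorem RMetric.app_add_left (X Y Z : VF n M) (x : M) :
    g.app (X + Y) Z x = g.app X Z x + g.app Y Z x := by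
  change g.inner x (X x + Y x) (Z x) = _
  rw [map_add, add_apply]
  rfl

theorem RMetric.app_add_right (X Y Z : VF n M) (x : M) :
    g.app X (Y + Z) x = g.app X Y x + g.app X Z x :=
  map_add (g.inner x (X x)) (Y x) (Z x)

theorem RMetric.app_fsmul_left (f : C^∞⟮𝓡 n, M; 𝓘(ℝ, ℝ), ℝ⟯) (X Y : VF n M) (x : M) :
    g.app (VF.fsmul f X) Y x = f x * g.app X Y x := by
  change g.inner x (f x • X x) (Y x) = _
  rw [map_smul, smul_apply]
  rfl

theorem RMetric.app_fsmul_right (f : C^∞⟮𝓡 n, M; 𝓘(ℝ, ℝ), ℝ⟯) (X Y : VF n M) (x : M) :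
    g.app X (VF.fsmul f Y) x = f x * g.app X Y x :=
  map_smul (g.inner x (X x)) (f x) (Y x)

theorem RMetric.app_sub_left (X Y Z : VF n M) (x : M) :
    g.app (X - Y) Z x = g.app X Z x - g.app Y Z x := by
  have := g.app_add_left (X - Y) Y Z x
  rw [sub_add_cancel] at this
  linarith

/-- The Lie bracket of vector fields. -/
noncomputable def VF.lie (X Y : VF n M) : VF n M :=
  ⟨VectorField.mlieBracket (𝓡 n) X Y, fun x =>
    ContMDiffAt.mlieBracket_vectorField (m := ⊤) (n := ⊤) (X.contMDiff x) (Y.contMDiff x)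
      (by simp)⟩

theorem VF.lie_apply (X Y : VF n M) (x : M) :
    X.lie Y x = VectorField.mlieBracket (𝓡 n) X Y x := rfl

theorem VF.lie_swap (X Y : VF n M) : X.lie Y = -Y.lie X := by
  ext1 x
  exact VectorField.mlieBracket_swap_apply

theorem VF.lie_add_left (X X' Y : VF n M) : (X + X').lie Y = X.lie Y + X'.lie Y := by
  ext1 x
  exact VectorField.mlieBracket_add_left (X.mdifferentiableAt x) (X'.mdifferentiableAt x)

theorem VF.lie_add_right (X Y Y' : VF n M) : X.lie (Y + Y') = X.lie Y + X.lie Y' := by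
  ext1 x
  exact VectorField.mlieBracket_add_right (Y.mdifferentiableAt x) (Y'.mdifferentiableAt x)

theorem VF.lie_fsmul_right (f : C^∞⟮𝓡 n, M; 𝓘(ℝ, ℝ), ℝ⟯) (X Y : VF n M) (x : M) :
    X.lie (VF.fsmul f Y) x = X.deriv f x • Y x + f x • X.lie Y x :=
  VectorField.mlieBracket_smul_right (smooth_mdifferentiableAt f x) (Y.mdifferentiableAt x)

theorem RMetric.app_lie_swap (X Y Z : VF n M) (x : M) :
    g.app (X.lie Y) Z x = -g.app (Y.lie X) Z x := by
  change g.inner x (X.lie Y x) (Z x) = _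
  rw [VF.lie_swap]
  change g.inner x (-Y.lie X x) (Z x) = _
  rw [map_neg]
  rfl

theorem RMetric.app_lie_fsmul_right (f : C^∞⟮𝓡 n, M; 𝓘(ℝ, ℝ), ℝ⟯) (X Y Z : VF n M) (x : M) :
    g.app (X.lie (VF.fsmul f Y)) Z x = X.deriv f x * g.app Y Z x + f x * g.app (X.lie Y) Z x := by
  change g.inner x (X.lie (VF.fsmul f Y) x) (Z x) = _
  rw [VF.lie_fsmul_right, map_add, add_apply, map_smul, map_smul]
  rfl

theorem RMetric.app_lie_fsmul_left (f : C^∞⟮𝓡 n, M; 𝓘(ℝ, ℝ), ℝ⟯) (X Y Z : VF n M) (x : M) :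
    g.app ((VF.fsmul f X).lie Y) Z x =
      -(Y.deriv f x * g.app X Z x) + f x * g.app (X.lie Y) Z x := by
  rw [g.app_lie_swap, g.app_lie_fsmul_right, g.app_lie_swap X Y]
  ring

theorem RMetric.deriv_app_add_left (X Y Y' Z : VF n M) (x : M) :
    X.deriv (g.app (Y + Y') Z) x = X.deriv (g.app Y Z) x + X.deriv (g.app Y' Z) x := by
  rw [← X.deriv_add (g.app_mdifferentiableAt Y Z x) (g.app_mdifferentiableAt Y' Z x)]
  exact congrArg (fun f => X.deriv f x) (funext fun y => g.app_add_left Y Y' Z y)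

theorem RMetric.deriv_app_add_right (X Y Z Z' : VF n M) (x : M) :
    X.deriv (g.app Y (Z + Z')) x = X.deriv (g.app Y Z) x + X.deriv (g.app Y Z') x := by
  rw [g.app_comm, g.deriv_app_add_left, g.app_comm Z, g.app_comm Z']

theorem RMetric.deriv_app_fsmul_left (f : C^∞⟮𝓡 n, M; 𝓘(ℝ, ℝ), ℝ⟯) (X Y Z : VF n M) (x : M) :
    X.deriv (g.app (VF.fsmul f Y) Z) x =
      f x * X.deriv (g.app Y Z) x + X.deriv f x * g.app Y Z x := by
  rw [← X.deriv_mul (smooth_mdifferentiableAt f x) (g.app_mdifferentiableAt Y Z x)]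
  exact congrArg (fun f => X.deriv f x) (funext fun y => g.app_fsmul_left f Y Z y)

theorem RMetric.deriv_app_fsmul_right (f : C^∞⟮𝓡 n, M; 𝓘(ℝ, ℝ), ℝ⟯) (X Y Z : VF n M) (x : M) :
    X.deriv (g.app Y (VF.fsmul f Z)) x =
      f x * X.deriv (g.app Y Z) x + X.deriv f x * g.app Y Z x := by
  rw [g.app_comm, g.deriv_app_fsmul_left, g.app_comm Z]

/-- The right hand side of the Koszul formula. -/
noncomputable def RMetric.koszul (X Y Z : VF n M) (x : M) : ℝ :=
  2⁻¹ * (X.deriv (g.app Y Z) x + Y.deriv (g.app Z X) x - Z.deriv (g.app X Y) x +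
    g.app (X.lie Y) Z x - g.app (Y.lie Z) X x + g.app (Z.lie X) Y x)

theorem RMetric.koszul_contMDiff (X Y Z : VF n M) :
    ContMDiff (𝓡 n) 𝓘(ℝ, ℝ) ∞ (g.koszul X Y Z) :=
  contMDiff_const.mul ((((((X.deriv_contMDiff (g.app_contMDiff Y Z)).add
    (Y.deriv_contMDiff (g.app_contMDiff Z X))).sub
    (Z.deriv_contMDiff (g.app_contMDiff X Y))).add (g.app_contMDiff _ _)).sub
    (g.app_contMDiff _ _)).add (g.app_contMDiff _ _))

theorem AffineConnection.ext' {D D' : AffineConnection n M} (h : ∀ X Y x, D X Y x = D' X Y x) :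
    D = D' := by
  cases D
  cases D'
  congr
  funext X Y
  ext1 x
  exact h X Y x

variable [T2Space M]

/-- The Levi-Civita connection as an operator on vector fields, given by the Koszul formula. -/
theorem RMetric.exists_koszul (X Y : VF n M) :
    ∃ W : VF n M, ∀ Z x, g.app W Z x = g.koszul X Y Z x := by
  refine g.exists_sharp (g.koszul X Y) (fun Z Z' x => ?_) (fun f Z x => ?_)
    fun Z => g.koszul_contMDiff X Y Z
  · simp only [RMetric.koszul, g.deriv_app_add_right, g.deriv_app_add_left, VF.add_deriv,
      VF.lie_add_left, VF.lie_add_right, g.app_add_left, g.app_add_right]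
    ring
  -- The terms in X f and Y f produced by the derivatives cancel against those produced by the
  -- brackets, so the formula is tensorial in Z.
  · simp only [RMetric.koszul, g.deriv_app_fsmul_right, g.deriv_app_fsmul_left, VF.fsmul_deriv,
      g.app_lie_fsmul_left, g.app_lie_fsmul_right, g.app_fsmul_right]
    rw [g.app_comm Z X, g.app_comm Z Y]
    ring

/-- The Levi-Civita connection. -/
noncomputable def RMetric.leviCivita : AffineConnection n M :=
  have key : ∀ X Y Z x, g.app ((g.exists_koszul X Y).choose) Z x = g.koszul X Y Z x :=
    fun X Y => (g.exists_koszul X Y).choose_spec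
  { toFun := fun X Y => (g.exists_koszul X Y).choose
    add_left := fun X X' Y => by
      ext1 x
      refine g.ext_app fun Z => ?_
      simp only [g.app_add_left, key]
      simp only [RMetric.koszul, g.deriv_app_add_right, g.deriv_app_add_left, VF.add_deriv,
        VF.lie_add_left, VF.lie_add_right, g.app_add_left, g.app_add_right]
      ring
    add_right := fun X Y Y' => by
      ext1 x
      refine g.ext_app fun Z => ?_
      simp only [g.app_add_left, key]
      simp only [RMetric.koszul, g.deriv_app_add_right, g.deriv_app_add_left, VF.add_deriv,
        VF.lie_add_left, VF.lie_add_right, g.app_add_left, g.app_add_right]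
      ring
    fsmul_left := fun f X Y => by
      ext1 x
      refine g.ext_app fun Z => ?_
      simp only [g.app_fsmul_left, key]
      simp only [RMetric.koszul, g.deriv_app_fsmul_right, g.deriv_app_fsmul_left, VF.fsmul_deriv,
        g.app_lie_fsmul_left, g.app_lie_fsmul_right, g.app_fsmul_right]
      rw [g.app_comm Z X]
      ring
    leibniz := fun X f Y x => by
      refine g.eq_of_inner x fun w => ?_
      obtain ⟨Z, rfl⟩ := VF.exists_extend x w
      rw [map_add, add_apply, map_smul, map_smul]
      change g.app _ Z x = f x * g.app _ Z x + X.deriv f x * g.app Y Z x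
      rw [key, key]
      -- Two terms (X f) g(Y, Z) arise, one from a derivative and one from a bracket, and absorb the
      -- factor `2⁻¹`; the two terms in Z f cancel.
      simp only [RMetric.koszul, g.deriv_app_fsmul_right, g.deriv_app_fsmul_left, VF.fsmul_deriv,
        g.app_lie_fsmul_left, g.app_lie_fsmul_right, g.app_fsmul_right]
      rw [g.app_comm X Y]
      ring }

theorem RMetric.app_leviCivita (X Y Z : VF n M) (x : M) :
    g.app (g.leviCivita X Y) Z x = g.koszul X Y Z x :=
  (g.exists_koszul X Y).choose_spec Z x

theorem RMetric.isLeviCivita_leviCivita : IsLeviCivita g g.leviCivita := by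
  refine ⟨fun X Y x => ?_, fun X Y Z x => ?_⟩
  · rw [← VF.lie_apply, ← VF.sub_apply]
    refine g.ext_app fun Z => ?_
    rw [g.app_sub_left, g.app_leviCivita, g.app_leviCivita, RMetric.koszul, RMetric.koszul,
      g.app_lie_swap Y X, g.app_lie_swap X Z, g.app_lie_swap Z Y, g.app_comm X Z, g.app_comm Z Y,
      g.app_comm Y X]
    ring
  · rw [covDerivMetric, g.app_leviCivita, g.app_comm Y (g.leviCivita X Z), g.app_leviCivita,
      RMetric.koszul,
      RMetric.koszul, g.app_lie_swap X Z, g.app_lie_swap Z Y, g.app_lie_swap Y X, g.app_comm X Z,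
      g.app_comm Z Y, g.app_comm Y X]
    ring

/-- Torsion-freeness turns each bracket, and compatibility with g each derivative, into values of D;
in the Koszul expression everything but 2 g(D_X Y, Z) cancels. Uniqueness follows. -/
theorem IsLeviCivita.app_eq_koszul {g : RMetric n M} {D : AffineConnection n M}
    (hD : IsLeviCivita g D) (X Y Z : VF n M) (x : M) :
    g.app (D X Y) Z x = g.koszul X Y Z x := by
  have ht : ∀ X Y Z, g.app (X.lie Y) Z x = g.app (D X Y) Z x - g.app (D Y X) Z x :=
    fun X Y Z => by
      rw [← g.app_sub_left]
      change g.inner x (X.lie Y x) (Z x) = g.inner x (D X Y x - D Y X x) (Z x)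
      rw [hD.1]
      rfl
  have hm : ∀ X Y Z, X.deriv (g.app Y Z) x = g.app (D X Y) Z x + g.app (D X Z) Y x :=
    fun X Y Z => by
      have := hD.2 X Y Z x
      rw [covDerivMetric, g.app_comm Y (D X Z)] at this
      linarith
  rw [RMetric.koszul, ht, ht, ht, hm, hm, hm]
  ring

theorem IsLeviCivita.eq {g : RMetric n M} {D : AffineConnection n M}
    (hD : IsLeviCivita g D) : D = g.leviCivita :=
  AffineConnection.ext' fun X Y x => g.ext_app fun Z => by
    rw [hD.app_eq_koszul, g.app_leviCivita]

theorem existsUnique_isLeviCivita : ∃! D : AffineConnection n M, IsLeviCivita g D :=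
  ⟨g.leviCivita, g.isLeviCivita_leviCivita, fun _ hD => hD.eq⟩

end LeviCivita

/-! ### Push forward of fields, pullback of connections, naturality under isometries -/

section Naturality

variable {n : ℕ} {M : Type u} [TopologicalSpace M] [ChartedSpace (EuclideanSpace ℝ (Fin n)) M]
  [IsManifold (𝓡 n) ∞ M]

theorem diffeo_mdifferentiableAt (f : M ≃ₘ⟮𝓡 n, 𝓡 n⟯ M) (x : M) :
    MDifferentiableAt (𝓡 n) (𝓡 n) f x :=
  (f.contMDiff x).mdifferentiableAt (by simp)

theorem diffeo_isInvertible (f : M ≃ₘ⟮𝓡 n, 𝓡 n⟯ M) (x : M) :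
    (mfderiv (𝓡 n) (𝓡 n) f x).IsInvertible :=
  ⟨f.mfderivToContinuousLinearEquiv (by simp) x,
    f.mfderivToContinuousLinearEquiv_coe (by simp)⟩

theorem diffeo_mfderiv_injective (f : M ≃ₘ⟮𝓡 n, 𝓡 n⟯ M) (x : M) :
    Function.Injective (mfderiv (𝓡 n) (𝓡 n) f x) :=
  (f.mfderivToContinuousLinearEquiv (by simp) x).injective

theorem diffeo_mfderiv_surjective (f : M ≃ₘ⟮𝓡 n, 𝓡 n⟯ M) (x : M) :
    Function.Surjective (mfderiv (𝓡 n) (𝓡 n) f x) :=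
  (f.mfderivToContinuousLinearEquiv (by simp) x).surjective

theorem mfderiv_symm_apply (f : M ≃ₘ⟮𝓡 n, 𝓡 n⟯ M) (x : M) (v : TangentSpace (𝓡 n) x) :
    (mfderiv (𝓡 n) (𝓡 n) f.symm (f x) (mfderiv (𝓡 n) (𝓡 n) f x v) :
      EuclideanSpace ℝ (Fin n)) = v := by
  have h := mfderiv_comp x (diffeo_mdifferentiableAt f.symm (f x)) (diffeo_mdifferentiableAt f x)
  have e : f.symm ∘ f = id := funext fun y => f.symm_apply_apply y
  rw [e, mfderiv_id] at h
  exact (congrArg (fun L => (L v : EuclideanSpace ℝ (Fin n))) h).symm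

/-- The push forward of a vector field along a diffeomorphism. -/
noncomputable def VF.push (f : M ≃ₘ⟮𝓡 n, 𝓡 n⟯ M) (X : VF n M) : VF n M :=
  ⟨fun y => (mfderiv (𝓡 n) (𝓡 n) f (f.symm y) (X (f.symm y)) : EuclideanSpace ℝ (Fin n)), by
    have h := ((f.contMDiff.contMDiff_tangentMap (m := ∞) (by simp)).comp X.contMDiff).comp
      f.symm.contMDiff
    refine h.congr fun y => ?_
    -- All tangent spaces are by definition the model space, so a vector can be kept fixed while its
    -- base point is replaced by an equal one. The same device recurs below wherever base points
    -- agree only propositionally.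
    have key : ∀ z : M, z = y → ∀ v : EuclideanSpace ℝ (Fin n),
        (TotalSpace.mk' (EuclideanSpace ℝ (Fin n)) y v : TangentBundle (𝓡 n) M) =
          TotalSpace.mk' (EuclideanSpace ℝ (Fin n)) z v := by rintro z rfl v; rfl
    exact key _ (f.apply_symm_apply y) _⟩

theorem VF.related_push (f : M ≃ₘ⟮𝓡 n, 𝓡 n⟯ M) (X : VF n M) : X.Related f (X.push f) := by
  intro x
  have key : ∀ z : M, z = x →
      (mfderiv (𝓡 n) (𝓡 n) f x (X x) : EuclideanSpace ℝ (Fin n)) =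
        mfderiv (𝓡 n) (𝓡 n) f z (X z) := by rintro z rfl; rfl
  exact key _ (f.symm_apply_apply x)

theorem VF.Related.symm {f : M ≃ₘ⟮𝓡 n, 𝓡 n⟯ M} {X X' : VF n M} (h : X.Related f X') :
    X'.Related f.symm X := by
  intro y
  obtain ⟨x, rfl⟩ : ∃ x, f x = y := f.surjective y
  have key : ∀ z : M, z = x → (X z : EuclideanSpace ℝ (Fin n)) = X x := by rintro z rfl; rfl
  rw [← h x]
  exact (mfderiv_symm_apply f x (X x)).trans (key _ (f.symm_apply_apply x)).symm

theorem VF.Related.unique {f : M ≃ₘ⟮𝓡 n, 𝓡 n⟯ M} {X X' X'' : VF n M} (h : X.Related f X')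
    (h' : X.Related f X'') : X' = X'' := by
  ext1 y
  obtain ⟨x, rfl⟩ : ∃ x, f x = y := f.surjective y
  exact (h x).symm.trans (h' x)

theorem VF.Related.eq_push {f : M ≃ₘ⟮𝓡 n, 𝓡 n⟯ M} {X X' : VF n M} (h : X.Related f X') :
    X' = X.push f := h.unique (X.related_push f)

theorem VF.Related.unique_left {f : M ≃ₘ⟮𝓡 n, 𝓡 n⟯ M} {X X' X'' : VF n M} (h : X.Related f X'')
    (h' : X'.Related f X'') : X = X' := h.symm.unique h'.symm

theorem VF.push_related (f : M ≃ₘ⟮𝓡 n, 𝓡 n⟯ M) (X : VF n M) : (X.push f.symm).Related f X :=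
  (X.related_push f.symm).symm

theorem VF.Related.trans {f h : M ≃ₘ⟮𝓡 n, 𝓡 n⟯ M} {X X' X'' : VF n M} (h₁ : X.Related f X')
    (h₂ : X'.Related h X'') : X.Related (f.trans h) X'' := by
  intro x
  have e := mfderiv_comp x (diffeo_mdifferentiableAt h (f x)) (diffeo_mdifferentiableAt f x)
  have e' := congrArg (fun L => (L (X x) : EuclideanSpace ℝ (Fin n))) e
  refine e'.trans ?_
  change (mfderiv (𝓡 n) (𝓡 n) h (f x) (mfderiv (𝓡 n) (𝓡 n) f x (X x)) :
    EuclideanSpace ℝ (Fin n)) = _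
  rw [h₁ x]
  exact h₂ (f x)

theorem VF.Related.add {f : M ≃ₘ⟮𝓡 n, 𝓡 n⟯ M} {X X' Y Y' : VF n M} (h : X.Related f X')
    (h' : Y.Related f Y') : (X + Y).Related f (X' + Y') := fun x => by
  rw [VF.add_apply, VF.add_apply, map_add, h x, h' x]

theorem VF.Related.fsmul {f : M ≃ₘ⟮𝓡 n, 𝓡 n⟯ M} {X X' : VF n M} (h : X.Related f X')
    {a a' : C^∞⟮𝓡 n, M; 𝓘(ℝ, ℝ), ℝ⟯} (ha : ∀ x, a x = a' (f x)) :
    (VF.fsmul a X).Related f (VF.fsmul a' X') := fun x => by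
  rw [VF.fsmul_apply, VF.fsmul_apply, map_smul, h x, ha]

theorem VF.Related.deriv {f : M ≃ₘ⟮𝓡 n, 𝓡 n⟯ M} {X X' : VF n M} (h : X.Related f X')
    {a a' : M → ℝ} (ha : ∀ x, a x = a' (f x)) (x : M)
    (ha' : MDifferentiableAt (𝓡 n) 𝓘(ℝ, ℝ) a' (f x)) : X.deriv a x = X'.deriv a' (f x) := by
  obtain rfl : a = a' ∘ f := funext ha
  unfold VF.deriv
  rw [← h x, mfderiv_comp x ha' (diffeo_mdifferentiableAt f x)]
  rfl

theorem VF.Related.lie {f : M ≃ₘ⟮𝓡 n, 𝓡 n⟯ M} {X X' Y Y' : VF n M} (h : X.Related f X')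
    (h' : Y.Related f Y') : (X.lie Y).Related f (X'.lie Y') := by
  -- For a diffeomorphism, being related means being the pullback, and pullback commutes with
  -- brackets.
  have key : ∀ {X X' : VF n M}, X.Related f X' →
      VectorField.mpullback (𝓡 n) (𝓡 n) f X' = X := fun {X X'} h => by
    funext x
    rw [VectorField.mpullback_apply, ← h x]
    exact (diffeo_isInvertible f x).inverse_apply_eq.2 rfl
  intro x
  have := VectorField.mpullback_mlieBracket (n := ∞) (X'.mdifferentiableAt (f x))
    (Y'.mdifferentiableAt (f x)) (f.contMDiff x) (by simpa using ENat.LEInfty.out)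
  rw [key h, key h', VectorField.mpullback_apply] at this
  exact ((diffeo_isInvertible f x).inverse_apply_eq.1 this).symm

theorem IsIsometric.app {f : M ≃ₘ⟮𝓡 n, 𝓡 n⟯ M} {g : RMetric n M} (hf : IsIsometric f g g)
    {X X' Y Y' : VF n M} (h : X.Related f X') (h' : Y.Related f Y') (x : M) :
    g.app X Y x = g.app X' Y' (f x) := by
  unfold RMetric.app
  rw [← hf, h x, h' x]

theorem IsPullback.trans {f h : M ≃ₘ⟮𝓡 n, 𝓡 n⟯ M} {D D' D'' : AffineConnection n M}
    (h₁ : IsPullback f D' D) (h₂ : IsPullback h D'' D') : IsPullback (f.trans h) D'' D :=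
  fun X Y X' Y' hX hY => by
    -- Related fields are unique, so the given ones are the two-step push forwards, on which both
    -- hypotheses apply.
    rw [hX.unique ((X.related_push f).trans ((X.push f).related_push h)),
      hY.unique ((Y.related_push f).trans ((Y.push f).related_push h))]
    exact (h₁ _ _ _ _ (X.related_push f) (Y.related_push f)).trans
      (h₂ _ _ _ _ ((X.push f).related_push h) ((Y.push f).related_push h))

theorem IsPullback.unique {f : M ≃ₘ⟮𝓡 n, 𝓡 n⟯ M} {D' D₁ D₂ : AffineConnection n M}
    (h₁ : IsPullback f D' D₁) (h₂ : IsPullback f D' D₂) : D₁ = D₂ :=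
  AffineConnection.ext' fun X Y x => by
    rw [(h₁ X Y _ _ (X.related_push f) (Y.related_push f)).unique_left
      (h₂ X Y _ _ (X.related_push f) (Y.related_push f))]

/-- The pullback of a connection along a diffeomorphism. -/
noncomputable def AffineConnection.pull (D : AffineConnection n M) (f : M ≃ₘ⟮𝓡 n, 𝓡 n⟯ M) :
    AffineConnection n M where
  toFun X Y := (D (X.push f) (Y.push f)).push f.symm
  add_left X X' Y := by
    rw [← ((X.related_push f).add (X'.related_push f)).eq_push, D.add_left]
    exact ((VF.related_push f.symm _).add (VF.related_push f.symm _)).eq_push.symm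
  add_right X Y Y' := by
    rw [← ((Y.related_push f).add (Y'.related_push f)).eq_push, D.add_right]
    exact ((VF.related_push f.symm _).add (VF.related_push f.symm _)).eq_push.symm
  fsmul_left a X Y := by
    let a' : C^∞⟮𝓡 n, M; 𝓘(ℝ, ℝ), ℝ⟯ := ⟨a ∘ f.symm, a.contMDiff.comp f.symm.contMDiff⟩
    have ha : ∀ x, a x = a' (f x) := fun x => congrArg a (f.symm_apply_apply x).symm
    rw [← ((X.related_push f).fsmul ha).eq_push, D.fsmul_left]
    exact ((VF.related_push f.symm _).fsmul fun x => rfl).eq_push.symm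
  leibniz X a Y x := by
    let a' : C^∞⟮𝓡 n, M; 𝓘(ℝ, ℝ), ℝ⟯ := ⟨a ∘ f.symm, a.contMDiff.comp f.symm.contMDiff⟩
    have ha : ∀ x, a x = a' (f x) := fun x => congrArg a (f.symm_apply_apply x).symm
    rw [← ((Y.related_push f).fsmul ha).eq_push]
    -- The Leibniz rule is checked after applying the differential of f, where it becomes the rule
    -- for D.
    apply diffeo_mfderiv_injective f x
    rw [map_add, map_smul, map_smul, VF.push_related f _ x, VF.push_related f _ x,
      VF.related_push f Y x, D.leibniz, ha,
      (X.related_push f).deriv ha x (smooth_mdifferentiableAt a' (f x))]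

theorem AffineConnection.isPullback_pull (D : AffineConnection n M) (f : M ≃ₘ⟮𝓡 n, 𝓡 n⟯ M) :
    IsPullback f D (D.pull f) := fun X Y X' Y' h h' => by
  rw [h.eq_push, h'.eq_push]
  exact VF.push_related f _

theorem IsPullback.torsionFree {f : M ≃ₘ⟮𝓡 n, 𝓡 n⟯ M} {D D' : AffineConnection n M}
    (h : IsPullback f D' D) (hD' : D'.TorsionFree) : D.TorsionFree := fun X Y x => by
  have hX := X.related_push f
  have hY := Y.related_push f
  apply diffeo_mfderiv_injective f x
  rw [map_sub, h _ _ _ _ hX hY x, h _ _ _ _ hY hX x, hD']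
  exact (hX.lie hY x).symm

theorem IsPullback.covDerivMetric_eq {f : M ≃ₘ⟮𝓡 n, 𝓡 n⟯ M} {D D' : AffineConnection n M}
    {g : RMetric n M} (h : IsPullback f D' D) (hf : IsIsometric f g g) (X Y Z : VF n M) (x : M) :
    covDerivMetric g D X Y Z x =
      covDerivMetric g D' (X.push f) (Y.push f) (Z.push f) (f x) := by
  have hX := X.related_push f
  have hY := Y.related_push f
  have hZ := Z.related_push f
  rw [covDerivMetric, covDerivMetric, hf.app (h _ _ _ _ hX hY) hZ, hf.app hY (h _ _ _ _ hX hZ),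
    hX.deriv (hf.app hY hZ) x (g.app_mdifferentiableAt _ _ _)]

theorem IsPullback.isLeviCivita {f : M ≃ₘ⟮𝓡 n, 𝓡 n⟯ M} {D D' : AffineConnection n M}
    {g : RMetric n M} (h : IsPullback f D' D) (hf : IsIsometric f g g)
    (hD' : IsLeviCivita g D') : IsLeviCivita g D :=
  ⟨h.torsionFree hD'.1, fun X Y Z x => by rw [h.covDerivMetric_eq hf, hD'.2]⟩

theorem IsIsometric.symm {f : M ≃ₘ⟮𝓡 n, 𝓡 n⟯ M} {g : RMetric n M} (hf : IsIsometric f g g) :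
    IsIsometric f.symm g g := by
  intro y v w
  obtain ⟨x, rfl⟩ : ∃ x, f x = y := f.surjective y
  obtain ⟨v, rfl⟩ := diffeo_mfderiv_surjective f x v
  obtain ⟨w, rfl⟩ := diffeo_mfderiv_surjective f x w
  rw [hf]
  have key : ∀ z : M, z = x → ∀ v' w' : EuclideanSpace ℝ (Fin n), v' = v → w' = w →
      (g.inner z : EuclideanSpace ℝ (Fin n) →L[ℝ] EuclideanSpace ℝ (Fin n) →L[ℝ] ℝ) v' w' =
        g.inner x v w := by rintro z rfl v' w' rfl rfl; rfl
  exact key _ (f.symm_apply_apply x) _ _ (mfderiv_symm_apply f x v) (mfderiv_symm_apply f x w)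

theorem IsIsometric.trans {f h : M ≃ₘ⟮𝓡 n, 𝓡 n⟯ M} {g : RMetric n M} (hf : IsIsometric f g g)
    (hh : IsIsometric h g g) : IsIsometric (f.trans h) g g := by
  intro x v w
  have e := mfderiv_comp x (diffeo_mdifferentiableAt h (f x)) (diffeo_mdifferentiableAt f x)
  have e' : mfderiv (𝓡 n) (𝓡 n) (f.trans h) x =
    (mfderiv (𝓡 n) (𝓡 n) h (f x)).comp (mfderiv (𝓡 n) (𝓡 n) f x) := e
  rw [e']
  exact (hh (f x) _ _).trans (hf x v w)

variable [T2Space M]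

/-- The pulled back connection is again torsion-free and compatible with f^*g = g, hence is the
Levi-Civita connection by uniqueness. -/
theorem IsIsometric.isPullback_leviCivita {f : M ≃ₘ⟮𝓡 n, 𝓡 n⟯ M} {g : RMetric n M}
    (hf : IsIsometric f g g) : IsPullback f g.leviCivita g.leviCivita := by
  have h := g.leviCivita.isPullback_pull f
  rwa [(h.isLeviCivita hf g.isLeviCivita_leviCivita).eq] at h

end Naturality

/-! ### Symmetric trilinear forms -/

section Trilinear

variable {V : Type w} [AddCommGroup V] [Module ℝ V]

theorem vec3_eta {α : Type*} (v : Fin 3 → α) : ![v 0, v 1, v 2] = v := by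
  ext i
  fin_cases i <;> rfl

/-- A trilinear map as a multilinear map. -/
def trilin (t : V →ₗ[ℝ] V →ₗ[ℝ] V →ₗ[ℝ] ℝ) : MultilinearMap ℝ (fun _ : Fin 3 => V) ℝ where
  toFun v := t (v 0) (v 1) (v 2)
  map_update_add' := by
    intro inst v i x y
    obtain rfl : inst = instDecidableEqFin 3 := Subsingleton.elim _ _
    fin_cases i <;> simp [Function.update]
  map_update_smul' := by
    intro inst v i c x
    obtain rfl : inst = instDecidableEqFin 3 := Subsingleton.elim _ _
    fin_cases i <;> simp [Function.update]

theorem multilinear_add_fst (C : MultilinearMap ℝ (fun _ : Fin 3 => V) ℝ) (a a' b c : V) :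
    C ![a + a', b, c] = C ![a, b, c] + C ![a', b, c] := by
  have e : ∀ z, Function.update ![a, b, c] 0 z = ![z, b, c] := fun z => by
    ext i
    fin_cases i <;> rfl
  simpa only [e] using C.map_update_add ![a, b, c] 0 a a'

theorem multilinear_smul_fst (C : MultilinearMap ℝ (fun _ : Fin 3 => V) ℝ) (r : ℝ) (a b c : V) :
    C ![r • a, b, c] = r * C ![a, b, c] := by
  have e : ∀ z, Function.update ![a, b, c] 0 z = ![z, b, c] := fun z => by
    ext i
    fin_cases i <;> rfl
  simpa only [e, smul_eq_mul] using C.map_update_smul ![a, b, c] 0 r a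

theorem Sym3.swap01 {C : MultilinearMap ℝ (fun _ : Fin 3 => V) ℝ} (hC : C ∈ Sym3 V) (a b c : V) :
    C ![a, b, c] = C ![b, a, c] := by
  rw [← hC (Equiv.swap 0 1) ![a, b, c]]
  congr 1
  ext i
  fin_cases i <;> rfl

theorem Sym3.swap02 {C : MultilinearMap ℝ (fun _ : Fin 3 => V) ℝ} (hC : C ∈ Sym3 V) (a b c : V) :
    C ![a, b, c] = C ![c, b, a] := by
  rw [← hC (Equiv.swap 0 2) ![a, b, c]]
  congr 1
  ext i
  fin_cases i <;> rfl

theorem Sym3.swap12 {C : MultilinearMap ℝ (fun _ : Fin 3 => V) ℝ} (hC : C ∈ Sym3 V) (a b c : V) :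
    C ![a, b, c] = C ![a, c, b] := by
  rw [swap01 hC, swap02 hC, swap01 hC]

/-- The two adjacent transpositions generate the permutations of three letters. -/
theorem trilin_mem_sym3 (t : V →ₗ[ℝ] V →ₗ[ℝ] V →ₗ[ℝ] ℝ) (h01 : ∀ a b c, t a b c = t b a c)
    (h12 : ∀ a b c, t a b c = t a c b) : trilin t ∈ Sym3 V := by
  intro τ v
  change t (v (τ 0)) (v (τ 1)) (v (τ 2)) = t (v 0) (v 1) (v 2)
  have n01 : τ 0 ≠ τ 1 := fun h => by simpa using τ.injective h
  have n02 : τ 0 ≠ τ 2 := fun h => by simpa using τ.injective h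
  have n12 : τ 1 ≠ τ 2 := fun h => by simpa using τ.injective h
  -- Only the values of τ matter from here on: of the 27 triples, injectivity leaves the six
  -- permutations.
  generalize τ 0 = i at *
  generalize τ 1 = j at *
  generalize τ 2 = k at *
  have h02 : ∀ a b c, t a b c = t c b a := fun a b c => by rw [h01, h12, h01]
  fin_cases i <;> fin_cases j <;> fin_cases k <;>
    first
    | exact absurd rfl n01
    | exact absurd rfl n02
    | exact absurd rfl n12
    | rfl
    | exact h01 _ _ _
    | exact h12 _ _ _
    | exact h02 _ _ _
    | exact (h01 _ _ _).trans (h12 _ _ _)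
    | exact (h12 _ _ _).trans (h01 _ _ _)

end Trilinear

/-! ### The correspondence between statistical connections and cubic forms -/

section Cubic

variable {n : ℕ} {M : Type u} [TopologicalSpace M] [ChartedSpace (EuclideanSpace ℝ (Fin n)) M]
  [IsManifold (𝓡 n) ∞ M] [T2Space M]

/-- Tensoriality in the second slot gives a linear map for each X; this map depends tensorially on X
in turn. -/
theorem VF.exists_bilinearMap {A : Type*} [AddCommGroup A] [Module ℝ A] (x : M)
    (Φ : VF n M → VF n M → A)
    (hadd : ∀ X X' Y, Φ (X + X') Y = Φ X Y + Φ X' Y)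
    (hsmul : ∀ f X Y, Φ (VF.fsmul f X) Y = f x • Φ X Y)
    (hadd' : ∀ X Y Y', Φ X (Y + Y') = Φ X Y + Φ X Y')
    (hsmul' : ∀ f X Y, Φ X (VF.fsmul f Y) = f x • Φ X Y) :
    ∃ β : TangentSpace (𝓡 n) x →ₗ[ℝ] TangentSpace (𝓡 n) x →ₗ[ℝ] A,
      ∀ X Y, Φ X Y = β (X x) (Y x) := by
  choose α hα using fun X => VF.exists_linearMap x (Φ X) (hadd' X) (fun f Y => hsmul' f X Y)
  obtain ⟨β, hβ⟩ := VF.exists_linearMap x α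
    (fun X X' => by
      ext v
      obtain ⟨Y, rfl⟩ := VF.exists_extend x v
      rw [LinearMap.add_apply, ← hα, ← hα, ← hα, hadd])
    (fun f X => by
      ext v
      obtain ⟨Y, rfl⟩ := VF.exists_extend x v
      rw [LinearMap.smul_apply, ← hα, ← hα, hsmul])
  exact ⟨β, fun X Y => by rw [hα, hβ]⟩

variable {g : RMetric n M}

/-- Every statistical connection has a cubic form. -/
theorem IsStatistical.exists_cubicForm {D : AffineConnection n M} (hD : IsStatistical g D) :
    ∃ C ∈ Sym3Field n M, IsCubicForm g D C := by
  let L := g.leviCivita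
  have hL : IsLeviCivita g L := g.isLeviCivita_leviCivita
  have hB : ∀ x : M, ∃ β : TangentSpace (𝓡 n) x →ₗ[ℝ] TangentSpace (𝓡 n) x →ₗ[ℝ]
      TangentSpace (𝓡 n) x, ∀ X Y : VF n M, D X Y x - L X Y x = β (X x) (Y x) := fun x => by
    refine VF.exists_bilinearMap x (fun X Y => D X Y x - L X Y x) ?_ ?_ ?_ ?_
    · intro X X' Y
      simp only [AffineConnection.add_left, VF.add_apply]
      abel
    · intro f X Y
      simp only [AffineConnection.fsmul_left, VF.fsmul_apply, smul_sub]
    · intro X Y Y'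
      simp only [AffineConnection.add_right, VF.add_apply]
      abel
    -- The derivative terms of the two Leibniz rules are equal and drop out of the difference.
    · intro f X Y
      simp only [AffineConnection.leibniz, smul_sub]
      abel
  choose β hβ using hB
  let G : ∀ x : M, TangentSpace (𝓡 n) x →ₗ[ℝ] TangentSpace (𝓡 n) x →ₗ[ℝ] ℝ := fun x =>
    LinearMap.mk₂ ℝ (fun u v => -2 * g.inner x u v)
      (fun u u' v => by rw [map_add, add_apply]; ring)
      (fun r u v => by rw [map_smul, smul_apply, smul_eq_mul, smul_eq_mul]; ring)
      (fun u v v' => by rw [map_add]; ring)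
      (fun r u v => by rw [map_smul, smul_eq_mul, smul_eq_mul]; ring)
  let t : ∀ x : M, TangentSpace (𝓡 n) x →ₗ[ℝ] TangentSpace (𝓡 n) x →ₗ[ℝ]
      TangentSpace (𝓡 n) x →ₗ[ℝ] ℝ := fun x => (β x).compr₂ (G x)
  have ht : ∀ (X Y Z : VF n M) x, t x (X x) (Y x) (Z x) = -2 * g.app (D X Y - L X Y) Z x :=
    fun X Y Z x => by
      change -2 * g.inner x (β x (X x) (Y x)) (Z x) = _
      rw [← hβ]
      rfl
  have h01 : ∀ x a b c, t x a b c = t x b a c := fun x a b c => by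
    obtain ⟨X, rfl⟩ := VF.exists_extend x a
    obtain ⟨Y, rfl⟩ := VF.exists_extend x b
    change G x _ c = G x _ c
    congr 1
    rw [← hβ, ← hβ]
    have h1 := hD.1 X Y x
    rw [← hL.1 X Y x] at h1
    rw [show D X Y x = D X Y x - D Y X x + D Y X x by abel, h1]
    abel_nf
  -- Since ∇^g g = 0, one has (∇_Y g)(Z, X) = ½ (t(Y, Z, X) + t(Y, X, Z)). Exchanging Y and Z leaves
  -- the left side unchanged by hypothesis and the first summand by `h01`, hence also the second.
  have h12 : ∀ x a b c, t x a b c = t x a c b := fun x a b c => by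
    rw [h01, h01 x a c]
    have h := h01 x
    obtain ⟨X, rfl⟩ := VF.exists_extend x a
    obtain ⟨Y, rfl⟩ := VF.exists_extend x b
    obtain ⟨Z, rfl⟩ := VF.exists_extend x c
    have h1 := hD.2 Y Z X x
    have h2 := hL.2 Y Z X x
    have h3 := hL.2 Z Y X x
    have h4 := h (Z x) (Y x) (X x)
    rw [ht, ht] at h4 ⊢
    unfold covDerivMetric at h1 h2 h3
    rw [g.app_comm Z (D Y X), g.app_comm Y (D Z X)] at h1
    rw [g.app_comm Z (L Y X)] at h2
    rw [g.app_comm Y (L Z X)] at h3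
    simp only [g.app_sub_left] at h4 ⊢
    linarith
  refine ⟨fun x => trilin (t x), ⟨fun x => trilin_mem_sym3 _ (h01 x) (h12 x), fun X Y Z => ?_⟩,
    L, hL, ht⟩
  have : (fun x => trilin (t x) ![X x, Y x, Z x]) =
      fun x => -2 * g.app (D X Y - L X Y) Z x := funext fun x => ht X Y Z x
  rw [this]
  exact contMDiff_const.mul (g.app_contMDiff _ _)

/-- Every symmetric `(0,3)`-tensor field is the cubic form of a statistical connection. -/
theorem Sym3Field.exists_connection (g : RMetric n M)
    {C : ∀ x : M, MultilinearMap ℝ (fun _ : Fin 3 => TangentSpace (𝓡 n) x) ℝ}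
    (hC : C ∈ Sym3Field n M) :
    ∃ D, IsStatistical g D ∧ IsCubicForm g D C := by
  -- The factor -½ inverts the -2 in the definition of the cubic form; S X Y is the field dual to -½
  -- C(X, Y, ·).
  have hS : ∀ X Y : VF n M, ∃ W : VF n M, ∀ Z x,
      g.app W Z x = -2⁻¹ * C x ![X x, Y x, Z x] := fun X Y => by
    refine g.exists_sharp (fun Z x => -2⁻¹ * C x ![X x, Y x, Z x]) (fun Z Z' x => ?_)
      (fun f Z x => ?_) fun Z => contMDiff_const.mul (hC.2 X Y Z)
    · rw [VF.add_apply, Sym3.swap02 (hC.1 x), multilinear_add_fst, Sym3.swap02 (hC.1 x),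
        Sym3.swap02 (hC.1 x) (Z' x)]
      ring
    · rw [VF.fsmul_apply, Sym3.swap02 (hC.1 x), multilinear_smul_fst, Sym3.swap02 (hC.1 x)]
      ring
  choose S hS using hS
  let L := g.leviCivita
  have hL : IsLeviCivita g L := g.isLeviCivita_leviCivita
  let D : AffineConnection n M :=
    { toFun := fun X Y => L X Y + S X Y
      add_left := fun X X' Y => by
        ext1 x
        refine g.ext_app fun Z => ?_
        rw [L.add_left]
        simp only [g.app_add_left, hS, VF.add_apply, multilinear_add_fst]
        ring
      fsmul_left := fun f X Y => by
        ext1 x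
        refine g.ext_app fun Z => ?_
        rw [L.fsmul_left]
        simp only [g.app_add_left, hS, g.app_fsmul_left, VF.fsmul_apply, multilinear_smul_fst]
        ring
      add_right := fun X Y Y' => by
        ext1 x
        refine g.ext_app fun Z => ?_
        rw [L.add_right]
        simp only [g.app_add_left, hS, VF.add_apply]
        rw [Sym3.swap01 (hC.1 x), multilinear_add_fst, Sym3.swap01 (hC.1 x),
          Sym3.swap01 (hC.1 x) (Y' x)]
        ring
      leibniz := fun X f Y x => by
        have h : S X (VF.fsmul f Y) x = f x • S X Y x := by
          rw [← VF.fsmul_apply]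
          refine g.ext_app fun Z => ?_
          rw [g.app_fsmul_left, hS, hS, VF.fsmul_apply, Sym3.swap01 (hC.1 x),
            multilinear_smul_fst, Sym3.swap01 (hC.1 x)]
          ring
        rw [VF.add_apply, VF.add_apply, h, L.leibniz, smul_add]
        abel }
  have hD : ∀ X Y, D X Y = L X Y + S X Y := fun X Y => rfl
  refine ⟨D, ⟨fun X Y x => ?_, fun X Y Z x => ?_⟩, L, hL, fun X Y Z x => ?_⟩
  · rw [← hL.1 X Y x, hD, hD, VF.add_apply, VF.add_apply]
    have : S X Y x = S Y X x := g.ext_app fun Z => by rw [hS, hS, Sym3.swap01 (hC.1 x)]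
    rw [this]
    abel
  -- The two correction terms each contribute ½ C, so ∇g = C, which is symmetric.
  · have h1 := hL.2 X Y Z x
    have h2 := hL.2 Y X Z x
    unfold covDerivMetric at h1 h2 ⊢
    simp only [hD, g.app_add_left, g.app_add_right]
    rw [g.app_comm Y (S X Z), g.app_comm X (S Y Z)]
    simp only [hS]
    rw [Sym3.swap01 (hC.1 x) (Y x) (X x), Sym3.swap12 (hC.1 x) (X x) (Z x),
      Sym3.swap02 (hC.1 x) (Y x) (Z x), Sym3.swap01 (hC.1 x) (X x) (Z x)]
    rw [Sym3.swap01 (hC.1 x) (Z x) (X x), Sym3.swap12 (hC.1 x) (X x) (Z x)]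
    linarith
  · rw [hD, add_sub_cancel_left, hS]
    ring

theorem IsCubicForm.apply {D : AffineConnection n M}
    {C : ∀ x : M, MultilinearMap ℝ (fun _ : Fin 3 => TangentSpace (𝓡 n) x) ℝ}
    (h : IsCubicForm g D C) (X Y Z : VF n M) (x : M) :
    C x ![X x, Y x, Z x] = -2 * g.app (D X Y - g.leviCivita X Y) Z x := by
  obtain ⟨L, hL, h⟩ := h
  rw [h, hL.eq]

theorem IsCubicForm.unique {D : AffineConnection n M}
    {C C' : ∀ x : M, MultilinearMap ℝ (fun _ : Fin 3 => TangentSpace (𝓡 n) x) ℝ}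
    (h : IsCubicForm g D C) (h' : IsCubicForm g D C') : C = C' := by
  funext x
  ext v
  obtain ⟨X, hX⟩ := VF.exists_extend x (v 0)
  obtain ⟨Y, hY⟩ := VF.exists_extend x (v 1)
  obtain ⟨Z, hZ⟩ := VF.exists_extend x (v 2)
  rw [← vec3_eta v, ← hX, ← hY, ← hZ, h.apply, h'.apply]

theorem IsCubicForm.connection_unique {D D' : AffineConnection n M}
    {C : ∀ x : M, MultilinearMap ℝ (fun _ : Fin 3 => TangentSpace (𝓡 n) x) ℝ}
    (h : IsCubicForm g D C) (h' : IsCubicForm g D' C) : D = D' :=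
  AffineConnection.ext' fun X Y x => g.ext_app fun Z => by
    have := (h.apply X Y Z x).symm.trans (h'.apply X Y Z x)
    rw [g.app_sub_left, g.app_sub_left] at this
    linarith

/-- Naturality of the cubic form under isometries. -/
theorem IsCubicForm.natural {f : M ≃ₘ⟮𝓡 n, 𝓡 n⟯ M} (hf : IsIsometric f g g)
    {D D' : AffineConnection n M} (hD : IsPullback f D' D)
    {C C' : ∀ x : M, MultilinearMap ℝ (fun _ : Fin 3 => TangentSpace (𝓡 n) x) ℝ}
    (h : IsCubicForm g D C) (h' : IsCubicForm g D' C') (x : M)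
    (v : Fin 3 → TangentSpace (𝓡 n) x) :
    C' (f x) (fun i => mfderiv (𝓡 n) (𝓡 n) f x (v i)) = C x v := by
  obtain ⟨X, hX⟩ := VF.exists_extend x (v 0)
  obtain ⟨Y, hY⟩ := VF.exists_extend x (v 1)
  obtain ⟨Z, hZ⟩ := VF.exists_extend x (v 2)
  rw [← vec3_eta fun i => mfderiv (𝓡 n) (𝓡 n) f x (v i), ← vec3_eta v]
  simp only [← hX, ← hY, ← hZ]
  change C' (f x) ![mfderiv (𝓡 n) (𝓡 n) f x (X x), mfderiv (𝓡 n) (𝓡 n) f x (Y x),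
    mfderiv (𝓡 n) (𝓡 n) f x (Z x)] = _
  rw [X.related_push f x, Y.related_push f x, Z.related_push f x, h.apply, h'.apply,
    g.app_sub_left, g.app_sub_left,
    hf.app (hD _ _ _ _ (X.related_push f) (Y.related_push f)) (Z.related_push f),
    hf.app (hf.isPullback_leviCivita _ _ _ _ (X.related_push f) (Y.related_push f))
      (Z.related_push f)]

/-- A connection is determined by its cubic form, hence invariant if its cubic form is. -/
theorem IsCubicForm.isPullback {f : M ≃ₘ⟮𝓡 n, 𝓡 n⟯ M} (hf : IsIsometric f g g)
    {D D' : AffineConnection n M}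
    {C C' : ∀ x : M, MultilinearMap ℝ (fun _ : Fin 3 => TangentSpace (𝓡 n) x) ℝ}
    (h : IsCubicForm g D C) (h' : IsCubicForm g D' C')
    (hC : ∀ (x : M) (v : Fin 3 → TangentSpace (𝓡 n) x),
      C' (f x) (fun i => mfderiv (𝓡 n) (𝓡 n) f x (v i)) = C x v) : IsPullback f D' D := by
  -- C is also the cubic form of f^*D', because f preserves g and ∇^g; a connection being determined
  -- by its cubic form, D = f^*D'.
  have key : IsCubicForm g (D'.pull f) C := by
    refine ⟨g.leviCivita, g.isLeviCivita_leviCivita, fun X Y Z x => ?_⟩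
    rw [← hC, ← vec3_eta fun i => mfderiv (𝓡 n) (𝓡 n) f x _]
    change C' (f x) ![mfderiv (𝓡 n) (𝓡 n) f x (X x), mfderiv (𝓡 n) (𝓡 n) f x (Y x),
      mfderiv (𝓡 n) (𝓡 n) f x (Z x)] = _
    rw [X.related_push f x, Y.related_push f x, Z.related_push f x, h'.apply,
      g.app_sub_left, g.app_sub_left,
      hf.app (D'.isPullback_pull f _ _ _ _ (X.related_push f) (Y.related_push f))
        (Z.related_push f),
      hf.app (hf.isPullback_leviCivita _ _ _ _ (X.related_push f) (Y.related_push f))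
        (Z.related_push f)]
  rw [h.connection_unique key]
  exact D'.isPullback_pull f

end Cubic

/-! ### Submersions and rank-deficient maps between vector spaces -/

section Straightening

open scoped Topology

variable {E : Type*} [NormedAddCommGroup E] [NormedSpace ℝ E] [FiniteDimensional ℝ E]
  {F : Type*} [NormedAddCommGroup F] [NormedSpace ℝ F] [FiniteDimensional ℝ F]

/-- A submersion is locally a projection. -/
theorem exists_straightening {f : E → F} {U : Set E} (hU : IsOpen U) (hf : ContDiffOn ℝ ∞ f U)
    {a : E} (ha : a ∈ U) {A : E →L[ℝ] F} (hA : HasFDerivAt f A a)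
    (hs : Function.Surjective A) :
    ∃ (Ψ : F × LinearMap.ker A.toLinearMap → E) (T : Set (F × LinearMap.ker A.toLinearMap)),
      IsOpen T ∧ (f a, 0) ∈ T ∧ ContDiffOn ℝ ∞ Ψ T ∧ Ψ (f a, 0) = a ∧
      (∀ p ∈ T, Ψ p ∈ U ∧ f (Ψ p) = p.1) ∧
      (∀ T' ∈ 𝓝 (f a, (0 : LinearMap.ker A.toLinearMap)), Ψ '' T' ∈ 𝓝 a) ∧
      ∀ X : LinearMap.ker A.toLinearMap,
        ∃ Ψ' : F × LinearMap.ker A.toLinearMap →L[ℝ] E, HasFDerivAt Ψ Ψ' (f a, 0) ∧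
          Ψ' (0, X) = X := by
  set N := LinearMap.ker A.toLinearMap
  have : CompleteSpace E := FiniteDimensional.complete ℝ E
  obtain ⟨P, hP⟩ : ∃ P : E →L[ℝ] N, ∀ x : N, P x = x :=
    Submodule.ClosedComplemented.of_finiteDimensional N
  -- Completing f by a projection P onto ker A makes the derivative at a invertible; Ψ is the local
  -- inverse of H.
  let H : E → F × N := fun x => (f x, P (x - a))
  have hH : ContDiffOn ℝ ∞ H U :=
    hf.prodMk (P.contDiff.comp (contDiff_id.sub contDiff_const)).contDiffOn
  have hinj : Function.Injective (A.prod P) := by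
    refine (injective_iff_map_eq_zero _).2 fun x hx => ?_
    have h1 : A x = 0 := congrArg Prod.fst hx
    have h2 : P x = 0 := congrArg Prod.snd hx
    have h3 := hP ⟨x, h1⟩
    rw [h2] at h3
    exact (congrArg Subtype.val h3).symm
  have hsurj : Function.Surjective (A.prod P) := by
    rintro ⟨y, w⟩
    obtain ⟨x, rfl⟩ := hs y
    refine ⟨x - P x + w, Prod.ext ?_ ?_⟩
    · have h1 : A (P x) = 0 := (P x).2
      have h2 : A (w : E) = 0 := w.2
      change A (x - P x + w) = A x
      rw [map_add, map_sub, h1, h2, sub_zero, add_zero]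
    · change P (x - P x + w) = w
      rw [map_add, map_sub, hP, hP, sub_self, zero_add]
  let L : E ≃L[ℝ] F × N :=
    (LinearEquiv.ofBijective (A.prod P).toLinearMap ⟨hinj, hsurj⟩).toContinuousLinearEquiv
  have hLP : HasFDerivAt H (L : E →L[ℝ] F × N) a := by
    have h2 : HasFDerivAt (fun x => P (x - a)) P a :=
      P.hasFDerivAt.comp a ((hasFDerivAt_id a).sub_const a)
    exact hA.prodMk h2
  have hHa : ContDiffAt ℝ ∞ H a := hH.contDiffAt (hU.mem_nhds ha)
  let e := hHa.toOpenPartialHomeomorph H hLP (by simp)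
  -- Invertibility of the derivative is known only at a. Restricting to the open set where it holds
  -- makes the inverse smooth on its whole domain.
  let W : Set E := U ∩ {x | fderiv ℝ H x ∈ Set.range ((↑) : (E ≃L[ℝ] F × N) → E →L[ℝ] F × N)}
  have hW : IsOpen W :=
    (hH.continuousOn_fderiv_of_isOpen hU (by simp)).isOpen_inter_preimage hU
      (ContinuousLinearEquiv.isOpen (𝕜 := ℝ))
  have haW : a ∈ W := ⟨ha, L, hLP.fderiv.symm⟩
  let e' := e.restrOpen W hW
  have hae : a ∈ e'.source := ⟨hHa.mem_toOpenPartialHomeomorph_source hLP (by simp), haW⟩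
  have hHe : H a = (f a, 0) := Prod.ext rfl (by change P (a - a) = 0; rw [sub_self, map_zero])
  have hte : (f a, 0) ∈ e'.target := by
    rw [← hHe]
    exact e'.map_source hae
  have hsa : e'.symm (f a, 0) = a := by
    rw [← hHe]
    exact e'.left_inv hae
  have hmem : ∀ p ∈ e'.target, e'.symm p ∈ W := fun p hp => (e'.map_target hp).2
  have hright : ∀ p ∈ e'.target, H (e'.symm p) = p := fun p hp => e'.right_inv hp
  refine ⟨e'.symm, e'.target, e'.open_target, hte, fun p hp => ?_, hsa, fun p hp => ?_,
    fun T' hT' => ?_, fun X => ⟨L.symm, ?_, ?_⟩⟩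
  · obtain ⟨hpU, L', hL'⟩ := hmem p hp
    have hd : ContDiffAt ℝ ∞ H (e'.symm p) := hH.contDiffAt (hU.mem_nhds hpU)
    refine (e'.contDiffAt_symm (f₀' := L') hp ?_ hd).contDiffWithinAt
    rw [hL']
    exact (hd.differentiableAt (by simp)).hasFDerivAt
  · exact ⟨(hmem p hp).1, congrArg Prod.fst (hright p hp)⟩
  · have h1 : e'.source ∩ e' ⁻¹' T' ∈ 𝓝 a := by
      refine Filter.inter_mem (e'.open_source.mem_nhds hae) ?_
      refine (e'.continuousAt hae).preimage_mem_nhds ?_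
      change T' ∈ 𝓝 (H a)
      rwa [hHe]
    refine Filter.mem_of_superset h1 ?_
    rintro x ⟨hx, hxT⟩
    exact ⟨e' x, hxT, e'.left_inv hx⟩
  · refine e'.hasFDerivAt_symm (f' := L) hte ?_
    rw [hsa]
    exact hLP
  · have : L X = (0, X) := Prod.ext X.2 (hP X)
    rw [← this]
    exact L.symm_apply_apply _

/-- A map of locally constant deficient rank has locally a nowhere dense image. -/
theorem exists_dense_compl_image {f : E → F} {U : Set E} (hU : IsOpen U)
    (hf : ContDiffOn ℝ ∞ f U) {a : E} (ha : a ∈ U)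
    (hr : ∀ x ∈ U, Module.finrank ℝ (LinearMap.range (fderiv ℝ f x).toLinearMap) ≤
      Module.finrank ℝ (LinearMap.range (fderiv ℝ f a).toLinearMap))
    (ha' : Module.finrank ℝ (LinearMap.range (fderiv ℝ f a).toLinearMap) < Module.finrank ℝ F) :
    ∃ V ∈ 𝓝 a, Dense (f '' V)ᶜ := by
  set R := LinearMap.range (fderiv ℝ f a).toLinearMap
  obtain ⟨Q, hQ⟩ : ∃ Q : F →L[ℝ] R, ∀ x : R, Q x = x :=
    Submodule.ClosedComplemented.of_finiteDimensional R
  have hdf : ∀ x ∈ U, HasFDerivAt f (fderiv ℝ f x) x := fun x hx =>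
    ((hf.contDiffAt (hU.mem_nhds hx)).differentiableAt (by simp)).hasFDerivAt
  have hsurj : Function.Surjective (Q.comp (fderiv ℝ f a)) := fun y => by
    obtain ⟨x, hx⟩ := y.2
    refine ⟨x, ?_⟩
    change Q (fderiv ℝ f a x) = y
    have hx' : fderiv ℝ f a x = y := hx
    rw [hx', hQ]
  obtain ⟨Ψ, T, hT, haT, hΨ, hΨa, hΨT, hnhds, -⟩ :=
    exists_straightening hU (Q.contDiff.comp_contDiffOn hf) ha
      (Q.hasFDerivAt.comp a (hdf a ha)) hsurj
  let N := LinearMap.ker (Q.comp (fderiv ℝ f a)).toLinearMap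
  obtain ⟨ε, hε, hεT⟩ := Metric.isOpen_iff.1 hT _ haT
  let B₁ := Metric.ball (Q (f a)) ε
  let B₂ := Metric.ball (0 : N) ε
  have hB : B₁ ×ˢ B₂ ⊆ T := by
    rw [ball_prod_same]
    exact hεT
  have hft : ContDiffOn ℝ ∞ (f ∘ Ψ) T := hf.comp hΨ fun p hp => (hΨT p hp).1
  -- The range of K = d(f ∘ Ψ) has dimension at most dim R, yet Q maps it onto R because Q ∘ f ∘ Ψ
  -- is the first projection. So Q is injective on that range, and K(0, w), which Q kills, vanishes.
  have hzero : ∀ p ∈ T, ∀ w : N, fderiv ℝ (f ∘ Ψ) p (0, w) = 0 := by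
    intro p hp w
    have hΨp := ((hΨ.contDiffAt (hT.mem_nhds hp)).differentiableAt (by simp)).hasFDerivAt
    have hc := (hdf _ (hΨT p hp).1).comp p hΨp
    have hfst : Q.comp (fderiv ℝ (f ∘ Ψ) p) = ContinuousLinearMap.fst ℝ R N := by
      have h1 : HasFDerivAt (fun q => Q ((f ∘ Ψ) q)) (Q.comp (fderiv ℝ (f ∘ Ψ) p)) p :=
        Q.hasFDerivAt.comp p (hc.fderiv ▸ hc)
      have h2 : HasFDerivAt (fun q => Q ((f ∘ Ψ) q)) (ContinuousLinearMap.fst ℝ R N) p := by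
        refine hasFDerivAt_fst.congr_of_eventuallyEq ?_
        filter_upwards [hT.mem_nhds hp] with q hq
        exact (hΨT q hq).2
      exact h1.unique h2
    set K := fderiv ℝ (f ∘ Ψ) p with hK
    let q : LinearMap.range K.toLinearMap →ₗ[ℝ] R :=
      Q.toLinearMap.comp (LinearMap.range K.toLinearMap).subtype
    have hqs : Function.Surjective q := fun y => by
      refine ⟨⟨K (y, 0), (y, 0), rfl⟩, ?_⟩
      exact congrArg (fun l => l (y, (0 : N))) hfst
    have hle : Module.finrank ℝ (LinearMap.range K.toLinearMap) ≤ Module.finrank ℝ R := by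
      refine le_trans ?_ (hr _ (hΨT p hp).1)
      refine Submodule.finrank_mono ?_
      rw [hK, hc.fderiv]
      rintro _ ⟨z, rfl⟩
      exact ⟨fderiv ℝ Ψ p z, rfl⟩
    have hqi : Function.Injective q :=
      (LinearMap.injective_iff_surjective_of_finrank_eq_finrank
        (le_antisymm hle (LinearMap.finrank_le_finrank_of_surjective hqs))).2 hqs
    have h0 : q ⟨K (0, w), (0, w), rfl⟩ = q 0 := by
      rw [map_zero]
      exact congrArg (fun l => l ((0 : R), w)) hfst
    exact congrArg Subtype.val (hqi h0)
  have hconst : ∀ p ∈ B₁ ×ˢ B₂, f (Ψ p) = f (Ψ (p.1, 0)) := by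
    rintro ⟨y, w⟩ ⟨hy, hw⟩
    have hmaps : ∀ z ∈ B₂, (y, z) ∈ T := fun z hz => hB ⟨hy, hz⟩
    have hd : ∀ z ∈ B₂, HasFDerivAt (fun z => f (Ψ (y, z))) (0 : N →L[ℝ] F) z := fun z hz => by
      have h1 := ((hft.contDiffAt (hT.mem_nhds (hmaps z hz))).differentiableAt
        (by simp)).hasFDerivAt
      have h2 := h1.comp z (hasFDerivAt_prodMk_right y z)
      convert! h2 using 1
      ext w
      exact (hzero _ (hmaps z hz) w).symm
    refine Metric.isOpen_ball.is_const_of_fderiv_eq_zero (𝕜 := ℝ)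
      (convex_ball (0 : N) ε).isPreconnected
      (fun z hz => (hd z hz).differentiableAt.differentiableWithinAt) (fun z hz => (hd z hz).fderiv)
      hw (Metric.mem_ball_self hε)
  refine ⟨Ψ '' (B₁ ×ˢ B₂), hnhds _ (prod_mem_nhds (Metric.ball_mem_nhds _ hε)
    (Metric.ball_mem_nhds _ hε)), ?_⟩
  -- Near a the image of f is thus the C¹ image of a ball in R; as dim R < dim F, Hausdorff
  -- dimension makes its complement dense.
  have hcd : ContDiffOn ℝ 1 (fun y : R => f (Ψ (y, 0))) B₁ :=
    ((hft.comp (contDiff_prodMk_left (0 : N)).contDiffOn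
      fun y hy => hB ⟨hy, Metric.mem_ball_self hε⟩).of_le (by simp))
  have hdense := hcd.dense_compl_image_of_dimH_lt_finrank (convex_ball _ _) subset_rfl
    (lt_of_le_of_lt (dimH_mono (Set.subset_univ _)) (by
      rw [Real.dimH_univ_eq_finrank]
      exact_mod_cast ha'))
  refine hdense.mono (Set.compl_subset_compl.2 ?_)
  rintro _ ⟨_, ⟨p, hp, rfl⟩, rfl⟩
  exact ⟨p.1, hp.1, (hconst p hp).symm⟩

end Straightening

/-! ### Rank-deficient maps and submersions between manifolds, read in charts -/

theorem finrank_range_comp_equiv {E F : Type*} [NormedAddCommGroup E] [NormedSpace ℝ E]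
    [NormedAddCommGroup F] [NormedSpace ℝ F] (A : E →L[ℝ] F) (e₁ : F ≃L[ℝ] F) (e₂ : E ≃L[ℝ] E) :
    Module.finrank ℝ (LinearMap.range
      ((e₁ : F →L[ℝ] F).comp (A.comp (e₂ : E →L[ℝ] E))).toLinearMap) =
      Module.finrank ℝ (LinearMap.range A.toLinearMap) := by
  have : LinearMap.range ((e₁ : F →L[ℝ] F).comp (A.comp (e₂ : E →L[ℝ] E))).toLinearMap =
      (LinearMap.range A.toLinearMap).map (e₁.toLinearEquiv : F →ₗ[ℝ] F) := by
    ext y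
    constructor
    · rintro ⟨v, rfl⟩
      exact ⟨A (e₂ v), ⟨_, rfl⟩, rfl⟩
    · rintro ⟨_, ⟨v, rfl⟩, rfl⟩
      refine ⟨e₂.symm v, ?_⟩
      change e₁ (A (e₂ (e₂.symm v))) = e₁ (A v)
      rw [e₂.apply_symm_apply]
  rw [this]
  exact LinearEquiv.finrank_map_eq e₁.toLinearEquiv _

/-- The differential of a map, as a linear map between the model spaces. -/
noncomputable def euclDeriv (m n : ℕ) {N : Type v} [TopologicalSpace N]
    [ChartedSpace (EuclideanSpace ℝ (Fin m)) N] {M : Type u} [TopologicalSpace M]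
    [ChartedSpace (EuclideanSpace ℝ (Fin n)) M] (h : N → M) (x : N) :
    EuclideanSpace ℝ (Fin m) →L[ℝ] EuclideanSpace ℝ (Fin n) :=
  mfderiv (𝓡 m) (𝓡 n) h x

section ConstantRank

open scoped Topology

variable {m n : ℕ} {N : Type v} [TopologicalSpace N] [ChartedSpace (EuclideanSpace ℝ (Fin m)) N]
  [IsManifold (𝓡 m) ∞ N] {M : Type u} [TopologicalSpace M]
  [ChartedSpace (EuclideanSpace ℝ (Fin n)) M] [IsManifold (𝓡 n) ∞ M]

variable (m n) in
/-- The domain on which the coordinate expression of `h` around `x₀` is meaningful. -/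
def repDomain (h : N → M) (x₀ : N) : Set (EuclideanSpace ℝ (Fin m)) :=
  (extChartAt (𝓡 m) x₀).target ∩
    (extChartAt (𝓡 m) x₀).symm ⁻¹' (h ⁻¹' (extChartAt (𝓡 n) (h x₀)).source)

variable {h : N → M} (hh : ContMDiff (𝓡 m) (𝓡 n) ∞ h) (x₀ : N)

include hh

theorem isOpen_repDomain : IsOpen (repDomain m n h x₀) :=
  (continuousOn_extChartAt_symm x₀).isOpen_inter_preimage (isOpen_extChartAt_target x₀)
    ((isOpen_extChartAt_source (h x₀)).preimage hh.continuous)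

omit hh [IsManifold (𝓡 m) ∞ N] [IsManifold (𝓡 n) ∞ M] in
theorem mem_repDomain (h : N → M) : extChartAt (𝓡 m) x₀ x₀ ∈ repDomain m n h x₀ := by
  refine ⟨mem_extChartAt_target x₀, ?_⟩
  rw [Set.mem_preimage, Set.mem_preimage, extChartAt_to_inv x₀]
  exact mem_extChartAt_source (h x₀)

theorem contDiffOn_rep :
    ContDiffOn ℝ ∞ (writtenInExtChartAt (𝓡 m) (𝓡 n) x₀ h) (repDomain m n h x₀) := by
  rw [← contMDiffOn_iff_contDiffOn]
  refine (contMDiffOn_extChartAt (x := h x₀)).comp (hh.comp_contMDiffOn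
    ((contMDiffOn_extChartAt_symm x₀).mono Set.inter_subset_left)) fun x hx => ?_
  have := hx.2
  rwa [Set.mem_preimage, Set.mem_preimage, extChartAt_source] at this

omit hh in
theorem hasMFDerivAt_extChartAt_symm {x : EuclideanSpace ℝ (Fin m)}
    (hx : x ∈ (extChartAt (𝓡 m) x₀).target) :
    HasMFDerivAt 𝓘(ℝ, EuclideanSpace ℝ (Fin m)) (𝓡 m) (extChartAt (𝓡 m) x₀).symm x
      (mfderiv 𝓘(ℝ, EuclideanSpace ℝ (Fin m)) (𝓡 m) (extChartAt (𝓡 m) x₀).symm x) :=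
  (((contMDiffOn_extChartAt_symm x₀).contMDiffAt
    ((isOpen_extChartAt_target x₀).mem_nhds hx)).mdifferentiableAt (n := ∞) (by simp)).hasMFDerivAt

theorem hasFDerivAt_rep {x : EuclideanSpace ℝ (Fin m)} (hx : x ∈ repDomain m n h x₀) :
    ∃ (e₁ : EuclideanSpace ℝ (Fin n) ≃L[ℝ] EuclideanSpace ℝ (Fin n))
      (e₂ : EuclideanSpace ℝ (Fin m) ≃L[ℝ] EuclideanSpace ℝ (Fin m)),
      (∀ v, e₁ v = mfderiv (𝓡 n) 𝓘(ℝ, EuclideanSpace ℝ (Fin n)) (extChartAt (𝓡 n) (h x₀))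
        (h ((extChartAt (𝓡 m) x₀).symm x)) v) ∧
      (∀ v, e₂ v =
        mfderiv 𝓘(ℝ, EuclideanSpace ℝ (Fin m)) (𝓡 m) (extChartAt (𝓡 m) x₀).symm x v) ∧
      HasFDerivAt (writtenInExtChartAt (𝓡 m) (𝓡 n) x₀ h)
        ((e₁ : EuclideanSpace ℝ (Fin n) →L[ℝ] EuclideanSpace ℝ (Fin n)).comp
          ((euclDeriv m n h ((extChartAt (𝓡 m) x₀).symm x)).comp
            (e₂ : EuclideanSpace ℝ (Fin m) →L[ℝ] EuclideanSpace ℝ (Fin m)))) x := by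
  obtain ⟨e₁, he₁⟩ := isInvertible_mfderiv_extChartAt (I := 𝓡 n) hx.2
  obtain ⟨e₂, he₂⟩ := isInvertible_mfderivWithin_extChartAt_symm (I := 𝓡 m) hx.1
  rw [ModelWithCorners.range_eq_univ, mfderivWithin_univ] at he₂
  have h1 := hasMFDerivAt_extChartAt_symm x₀ hx.1
  have h2 := ((hh _).mdifferentiableAt (x := (extChartAt (𝓡 m) x₀).symm x)
    (by simp)).hasMFDerivAt
  have h3 := (mdifferentiableAt_extChartAt (I := 𝓡 n) (x := h x₀)
    (y := h ((extChartAt (𝓡 m) x₀).symm x)) (by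
      have := hx.2
      rwa [Set.mem_preimage, Set.mem_preimage, extChartAt_source] at this)).hasMFDerivAt
  rw [← he₂] at h1
  rw [← he₁] at h3
  exact ⟨e₁, e₂, fun v => congrArg (fun L => (L v : EuclideanSpace ℝ (Fin n))) he₁,
    fun v => congrArg (fun L => (L v : EuclideanSpace ℝ (Fin m))) he₂,
    hasMFDerivAt_iff_hasFDerivAt.1 (h3.comp x (h2.comp x h1))⟩

/-- The tangent space at a point is identified with the model space through the preferred chart
there, whose differential at that point is therefore the identity. No correcting isomorphisms
remain. -/
theorem hasFDerivAt_rep_self :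
    HasFDerivAt (writtenInExtChartAt (𝓡 m) (𝓡 n) x₀ h) (euclDeriv m n h x₀)
      (extChartAt (𝓡 m) x₀ x₀) := by
  obtain ⟨e₁, e₂, he₁, he₂, h0⟩ := hasFDerivAt_rep hh x₀ (mem_repDomain x₀ h)
  rw [extChartAt_to_inv x₀] at he₁ h0
  have a₁ := mfderiv_extChartAt_self (I := 𝓡 n) (x := h x₀)
  have a₂ := mfderivWithin_range_extChartAt_symm (I := 𝓡 m) (x := x₀)
  rw [ModelWithCorners.range_eq_univ, mfderivWithin_univ] at a₂
  have b₁ : ∀ v, e₁ v = v := fun v =>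
    (he₁ v).trans (congrArg (fun L => (L v : EuclideanSpace ℝ (Fin n))) a₁)
  have b₂ : ∀ v, e₂ v = v := fun v =>
    (he₂ v).trans (congrArg (fun L => (L v : EuclideanSpace ℝ (Fin m))) a₂)
  convert! h0 using 1
  ext1 v
  simp [b₁, b₂]

theorem finrank_range_fderiv_rep {x : EuclideanSpace ℝ (Fin m)} (hx : x ∈ repDomain m n h x₀) :
    Module.finrank ℝ
        (LinearMap.range (fderiv ℝ (writtenInExtChartAt (𝓡 m) (𝓡 n) x₀ h) x).toLinearMap) =
      Module.finrank ℝ (LinearMap.range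
        (euclDeriv m n h ((extChartAt (𝓡 m) x₀).symm x)).toLinearMap) := by
  obtain ⟨e₁, e₂, -, -, h0⟩ := hasFDerivAt_rep hh x₀ hx
  rw [h0.fderiv]
  set A := euclDeriv m n h ((extChartAt (𝓡 m) x₀).symm x)
  exact finrank_range_comp_equiv A e₁ e₂

/-- A smooth map of constant deficient rank has locally an image without interior. -/
theorem exists_interior_image_eq_empty
    (hr : ∀ x, Module.finrank ℝ (LinearMap.range (euclDeriv m n h x).toLinearMap) ≤
      Module.finrank ℝ (LinearMap.range (euclDeriv m n h x₀).toLinearMap))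
    (hlt : Module.finrank ℝ (LinearMap.range (euclDeriv m n h x₀).toLinearMap) < n) :
    ∃ V ∈ 𝓝 x₀, interior (h '' V) = ∅ := by
  have ha := finrank_range_fderiv_rep hh x₀ (mem_repDomain x₀ h)
  rw [extChartAt_to_inv x₀] at ha
  obtain ⟨V, hV, hd⟩ := exists_dense_compl_image (isOpen_repDomain hh x₀) (contDiffOn_rep hh x₀)
    (mem_repDomain x₀ h) (fun x hx => by
      rw [finrank_range_fderiv_rep hh x₀ hx, ha]
      exact hr _) (by rw [ha, finrank_euclideanSpace_fin]; exact hlt)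
  set c := extChartAt (𝓡 m) x₀
  set d := extChartAt (𝓡 n) (h x₀)
  refine ⟨c.source ∩ c ⁻¹' V ∩ h ⁻¹' d.source, Filter.inter_mem (Filter.inter_mem
    (extChartAt_source_mem_nhds x₀) ((continuousAt_extChartAt x₀).preimage_mem_nhds hV))
    (hh.continuous.continuousAt.preimage_mem_nhds (extChartAt_source_mem_nhds (h x₀))), ?_⟩
  rw [Set.eq_empty_iff_forall_notMem]
  intro y hy
  set O := interior (h '' (c.source ∩ c ⁻¹' V ∩ h ⁻¹' d.source))
  -- An interior point of the image would give a nonempty open set in the chart contained in the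
  -- image of V, whose complement is dense.
  have hO : IsOpen (d.target ∩ d.symm ⁻¹' O) :=
    (continuousOn_extChartAt_symm (h x₀)).isOpen_inter_preimage (isOpen_extChartAt_target (h x₀))
      isOpen_interior
  have hys : y ∈ d.source := by
    obtain ⟨x, hx, rfl⟩ := interior_subset hy
    exact hx.2
  obtain ⟨z, ⟨hz, hzO⟩, hzV⟩ := hd.inter_open_nonempty _ hO
    ⟨d y, d.map_source hys, by rw [Set.mem_preimage, d.left_inv hys]; exact hy⟩
  obtain ⟨x, hx, hxz⟩ := interior_subset hzO
  refine hzV ⟨c x, hx.1.2, ?_⟩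
  change d (h (c.symm (c x))) = z
  rw [c.left_inv hx.1.1, hxz, d.right_inv hz]

/-- A submersion has local sections. -/
theorem exists_local_section (hs : Function.Surjective (euclDeriv m n h x₀)) :
    ∃ s : M → N, ContMDiffAt (𝓡 n) (𝓡 m) ∞ s (h x₀) ∧ s (h x₀) = x₀ ∧
      ∀ᶠ y in 𝓝 (h x₀), h (s y) = y := by
  obtain ⟨Ψ, T, hT, haT, hΨ, hΨa, hΨT, -, -⟩ := exists_straightening (isOpen_repDomain hh x₀)
    (contDiffOn_rep hh x₀) (mem_repDomain x₀ h) (hasFDerivAt_rep_self hh x₀) hs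
  have hrep : writtenInExtChartAt (𝓡 m) (𝓡 n) x₀ h (extChartAt (𝓡 m) x₀ x₀) =
      extChartAt (𝓡 n) (h x₀) (h x₀) := by
    simp only [writtenInExtChartAt, Function.comp_apply, extChartAt_to_inv x₀]
  rw [hrep] at haT hΨa
  have hsm : ContMDiffAt (𝓡 n) 𝓘(ℝ, EuclideanSpace ℝ (Fin m)) ∞
      (fun y => Ψ (extChartAt (𝓡 n) (h x₀) y, 0)) (h x₀) := by
    have h1 : ContDiffAt ℝ ∞ (fun z => Ψ (z, 0)) (extChartAt (𝓡 n) (h x₀) (h x₀)) :=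
      ContDiffAt.comp _ (hΨ.contDiffAt (hT.mem_nhds haT)) (contDiff_prodMk_left _).contDiffAt
    exact h1.contMDiffAt.comp (h x₀) contMDiffAt_extChartAt
  -- In straightened coordinates h is the first projection, with section y ↦ (y, 0).
  refine ⟨fun y => (extChartAt (𝓡 m) x₀).symm (Ψ (extChartAt (𝓡 n) (h x₀) y, 0)),
    ContMDiffAt.comp (h x₀) ?_ hsm, ?_, ?_⟩
  · rw [hΨa]
    exact (contMDiffOn_extChartAt_symm x₀).contMDiffAt (extChartAt_target_mem_nhds x₀)
  · simp only [hΨa, extChartAt_to_inv x₀]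
  · have h2 : ∀ᶠ y in 𝓝 (h x₀), (extChartAt (𝓡 n) (h x₀) y, 0) ∈ T :=
      ((continuousAt_extChartAt (I := 𝓡 n) (h x₀)).prodMk continuousAt_const).eventually
        (hT.mem_nhds haT)
    filter_upwards [h2, extChartAt_source_mem_nhds (I := 𝓡 n) (h x₀)] with y hy hys
    obtain ⟨h3, h4⟩ := hΨT _ hy
    exact (extChartAt (𝓡 n) (h x₀)).injOn h3.2 hys h4

omit hh in
-- `lieAlgOf` asks for curves defined on all of ℝ, while straightening gives only short ones. This
-- bounded reparametrization extends them without changing the initial velocity.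
theorem exists_bounded_param {ε : ℝ} (hε : 0 < ε) : ∃ θ : ℝ → ℝ, ContDiff ℝ ∞ θ ∧
    (∀ t, |θ t| < ε) ∧ θ 0 = 0 ∧ HasDerivAt θ 1 0 := by
  refine ⟨fun t => ε / 2 * Real.sin (2 / ε * t), by fun_prop, fun t => ?_, by simp, ?_⟩
  · rw [abs_mul, abs_of_pos (half_pos hε)]
    have := Real.abs_sin_le_one (2 / ε * t)
    nlinarith
  · have h1 : HasDerivAt (fun t => 2 / ε * t) (2 / ε) (0 : ℝ) := by
      simpa using (hasDerivAt_id (0 : ℝ)).const_mul (2 / ε)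
    have h2 := (h1.sin).const_mul (ε / 2)
    convert! h2 using 1
    simp [hε.ne']

/-- A vector in the kernel of the differential of a submersion is the velocity of a curve in the
fibre. -/
theorem exists_curve_in_fibre (hs : Function.Surjective (euclDeriv m n h x₀))
    (X : EuclideanSpace ℝ (Fin m)) (hX : euclDeriv m n h x₀ X = 0) :
    ∃ γ : ℝ → N, ContMDiff 𝓘(ℝ, ℝ) (𝓡 m) ∞ γ ∧ γ 0 = x₀ ∧ (∀ t, h (γ t) = h x₀) ∧
      (mfderiv 𝓘(ℝ, ℝ) (𝓡 m) γ 0 (1 : ℝ) : EuclideanSpace ℝ (Fin m)) = X := by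
  obtain ⟨Ψ, T, hT, haT, hΨ, hΨa, hΨT, -, hder⟩ := exists_straightening (isOpen_repDomain hh x₀)
    (contDiffOn_rep hh x₀) (mem_repDomain x₀ h) (hasFDerivAt_rep_self hh x₀) hs
  have hrep : writtenInExtChartAt (𝓡 m) (𝓡 n) x₀ h (extChartAt (𝓡 m) x₀ x₀) =
      extChartAt (𝓡 n) (h x₀) (h x₀) := by
    simp only [writtenInExtChartAt, Function.comp_apply, extChartAt_to_inv x₀]
  obtain ⟨Ψ', hΨ', hΨX⟩ := hder ⟨X, hX⟩
  set b := writtenInExtChartAt (𝓡 m) (𝓡 n) x₀ h (extChartAt (𝓡 m) x₀ x₀) with hb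
  let X' : LinearMap.ker (euclDeriv m n h x₀).toLinearMap := ⟨X, hX⟩
  have hcont : Continuous fun t : ℝ => (b, t • X') := by fun_prop
  have h0 : (0 : ℝ) ∈ (fun t : ℝ => (b, t • X')) ⁻¹' T := by
    rw [Set.mem_preimage, zero_smul]
    exact haT
  obtain ⟨ε, hε, hεT⟩ := Metric.isOpen_iff.1 (hT.preimage hcont) 0 h0
  obtain ⟨θ, hθ, hθε, hθ0, hθ'⟩ := exists_bounded_param hε
  have hmem : ∀ t, (b, θ t • X') ∈ T := fun t => hεT (by
    rw [Metric.mem_ball, Real.dist_eq, sub_zero]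
    exact hθε t)
  have hδ : ContDiff ℝ ∞ fun t => Ψ (b, θ t • X') :=
    contDiffOn_univ.1 (hΨ.comp (contDiff_const.prodMk (hθ.smul contDiff_const)).contDiffOn
      fun t _ => hmem t)
  -- In straightened coordinates the fibre is {b} × ker, and the curve runs in it in the direction
  -- X.
  refine ⟨fun t => (extChartAt (𝓡 m) x₀).symm (Ψ (b, θ t • X')), ?_, ?_, fun t => ?_, ?_⟩
  · exact contMDiffOn_univ.1 ((contMDiffOn_extChartAt_symm x₀).comp hδ.contMDiff.contMDiffOn
      fun t _ => (hΨT _ (hmem t)).1.1)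
  · simp only [hθ0, zero_smul, hΨa, extChartAt_to_inv x₀]
  · obtain ⟨h3, h4⟩ := hΨT _ (hmem t)
    exact (extChartAt (𝓡 n) (h x₀)).injOn h3.2 (mem_extChartAt_source (h x₀)) (h4.trans hrep)
  · have hz : (b, θ 0 • X') = (b, 0) := by rw [hθ0, zero_smul]
    have h1 : HasFDerivAt (fun t => (b, θ t • X'))
        ((0 : ℝ →L[ℝ] EuclideanSpace ℝ (Fin n)).prod
          ((ContinuousLinearMap.toSpanSingleton ℝ (1 : ℝ)).smulRight X')) 0 :=
      (hasFDerivAt_const b (0 : ℝ)).prodMk (hθ'.hasFDerivAt.smul_const X')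
    have h2 : HasFDerivAt (fun t => Ψ (b, θ t • X')) _ 0 :=
      HasFDerivAt.comp (0 : ℝ) (by rw [hz]; exact hΨ') h1
    have h3 := hasMFDerivAt_extChartAt_symm x₀ (mem_extChartAt_target (I := 𝓡 m) x₀)
    have e2 := mfderivWithin_range_extChartAt_symm (I := 𝓡 m) (x := x₀)
    rw [ModelWithCorners.range_eq_univ, mfderivWithin_univ] at e2
    have hp : Ψ (b, θ 0 • X') = extChartAt (𝓡 m) x₀ x₀ := by rw [hz, hΨa]
    rw [← hp] at h3
    have h4 := (HasMFDerivAt.comp (0 : ℝ) h3 h2.hasMFDerivAt).mfderiv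
    have h5 := congrArg (fun L => (L (1 : ℝ) : EuclideanSpace ℝ (Fin m))) h4
    refine Eq.trans h5 ?_
    rw [hp]
    have h6 := congrArg (fun L => (L (Ψ' (((0 : ℝ →L[ℝ] EuclideanSpace ℝ (Fin n)).prod
      ((ContinuousLinearMap.toSpanSingleton ℝ (1 : ℝ)).smulRight X')) 1)) :
        EuclideanSpace ℝ (Fin m))) e2
    refine Eq.trans h6 ?_
    change Ψ' ((0 : EuclideanSpace ℝ (Fin n)), ((1 : ℝ) • (1 : ℝ)) • X') = X
    rw [one_smul, one_smul]
    exact hΨX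

end ConstantRank

/-! ### The chain rule and the orbit map of a transitive action -/

section EuclDeriv

variable {k m n : ℕ} {N : Type*} [TopologicalSpace N] [ChartedSpace (EuclideanSpace ℝ (Fin m)) N]
  {M : Type*} [TopologicalSpace M] [ChartedSpace (EuclideanSpace ℝ (Fin n)) M]
  {P : Type*} [TopologicalSpace P] [ChartedSpace (EuclideanSpace ℝ (Fin k)) P]

theorem euclDeriv_comp {h : M → P} {f : N → M} {x : N}
    (hh : MDifferentiableAt (𝓡 n) (𝓡 k) h (f x)) (hf : MDifferentiableAt (𝓡 m) (𝓡 n) f x) :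
    euclDeriv m k (h ∘ f) x = (euclDeriv n k h (f x)).comp (euclDeriv m n f x) :=
  mfderiv_comp x hh hf

end EuclDeriv

section OrbitMap

open scoped Topology

variable {m n : ℕ} {G : Type v} [TopologicalSpace G] [ChartedSpace (EuclideanSpace ℝ (Fin m)) G]
  [Group G] [LieGroup (𝓡 m) ∞ G]
  {M : Type u} [TopologicalSpace M] [ChartedSpace (EuclideanSpace ℝ (Fin n)) M]
  [IsManifold (𝓡 n) ∞ M] [MulAction G M] [ContMDiffSMul (𝓡 m) (𝓡 n) ∞ G M]

/-- The orbit map is σ_x ∘ orb ∘ L_{x⁻¹}, so its differential at x factors through the one at 1. -/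
theorem finrank_range_orb_le (p₀ : M) (x : G) :
    Module.finrank ℝ (LinearMap.range (euclDeriv m n (orb G p₀) x).toLinearMap) ≤
      Module.finrank ℝ (LinearMap.range (euclDeriv m n (orb G p₀) (1 : G)).toLinearMap) := by
  have hs := orb_smooth (m := m) (n := n) G p₀
  have hL : ContMDiff (𝓡 m) (𝓡 m) ∞ (fun y : G => x⁻¹ * y) := contMDiff_mul_left
  have e : orb G p₀ = actBy m n M x ∘ (orb G p₀ ∘ fun y => x⁻¹ * y) := by
    funext y
    change y • p₀ = x • (x⁻¹ * y) • p₀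
    rw [smul_smul, mul_inv_cancel_left]
  have hc : euclDeriv m n (orb G p₀) x = (euclDeriv n n (actBy m n M x)
      (orb G p₀ (x⁻¹ * x))).comp ((euclDeriv m n (orb G p₀) (x⁻¹ * x)).comp
        (euclDeriv m m (fun y : G => x⁻¹ * y) x)) := by
    conv_lhs => rw [e]
    rw [euclDeriv_comp (((actBy m n M x).contMDiff _).mdifferentiableAt (by simp))
      (((hs.comp hL) _).mdifferentiableAt (by simp)),
      euclDeriv_comp ((hs _).mdifferentiableAt (by simp)) ((hL _).mdifferentiableAt (by simp))]
    rfl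
  rw [inv_mul_cancel] at hc
  rw [hc]
  generalize euclDeriv n n (actBy m n M x) (orb G p₀ 1) = A
  generalize euclDeriv m n (orb G p₀) 1 = B
  generalize euclDeriv m m (fun y : G => x⁻¹ * y) x = C
  have : LinearMap.range (A.comp (B.comp C)).toLinearMap ≤
      (LinearMap.range B.toLinearMap).map A.toLinearMap := by
    rintro _ ⟨v, rfl⟩
    exact ⟨B (C v), ⟨_, rfl⟩, rfl⟩
  exact (Submodule.finrank_mono this).trans (Submodule.finrank_map_le _ _)

variable [T2Space M] [SecondCountableTopology G] [MulAction.IsPretransitive G M]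

/-- The orbit map of a transitive action is a submersion. -/
theorem surjective_orb (p₀ : M) : Function.Surjective (euclDeriv m n (orb G p₀) (1 : G)) := by
  by_contra hns
  have hlt : Module.finrank ℝ
      (LinearMap.range (euclDeriv m n (orb G p₀) (1 : G)).toLinearMap) < n := by
    have h1 : LinearMap.range (euclDeriv m n (orb G p₀) (1 : G)).toLinearMap < ⊤ :=
      lt_top_iff_ne_top.2 fun h => hns (LinearMap.range_eq_top.1 h)
    have := Submodule.finrank_lt h1.ne
    rwa [finrank_euclideanSpace_fin] at this
  have : LocallyCompactSpace G := Manifold.locallyCompact_of_finiteDimensional (𝓡 m)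
  have : LocallyCompactSpace M := Manifold.locallyCompact_of_finiteDimensional (𝓡 n)
  have : IsTopologicalGroup G := topologicalGroup_of_lieGroup (𝓡 m) ∞
  have hs := orb_smooth (m := m) (n := n) G p₀
  obtain ⟨V, hV, hVi⟩ := exists_interior_image_eq_empty hs (1 : G) (finrank_range_orb_le p₀) hlt
  obtain ⟨K, hK, hKV, hKc⟩ := local_compact_nhds hV
  -- The sets in question are the translates xK of a compact neighbourhood K of 1; second
  -- countability extracts a countable cover of G.
  obtain ⟨S, hS, hSu⟩ := TopologicalSpace.countable_cover_nhds
    (f := fun x : G => (fun y => x⁻¹ * y) ⁻¹' K) fun x =>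
      (continuous_const_mul x⁻¹).continuousAt.preimage_mem_nhds (by
        simpa using hK)
  have := hS.to_subtype
  have : Nonempty M := ⟨p₀⟩
  -- By transitivity M is the union of countably many closed sets xK • p₀, so by Baire one of them
  -- has an interior point; translating back contradicts the choice of V.
  obtain ⟨⟨x, hx⟩, y, hy⟩ := nonempty_interior_of_iUnion_of_closed
    (f := fun x : S => actBy m n M (x : G) '' (orb G p₀ '' K))
    (fun x => ((hKc.image hs.continuous).image (actBy m n M (x : G)).continuous).isClosed) (by
      rw [Set.eq_univ_iff_forall]
      intro y
      obtain ⟨a, rfl⟩ := MulAction.exists_smul_eq G p₀ y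
      have ha : a ∈ ⋃ x ∈ S, (fun y => x⁻¹ * y) ⁻¹' K := hSu ▸ Set.mem_univ a
      simp only [Set.mem_iUnion] at ha
      obtain ⟨x, hx, hax⟩ := ha
      refine Set.mem_iUnion.2 ⟨⟨x, hx⟩, _, ⟨_, hax, rfl⟩, ?_⟩
      change x • (x⁻¹ * a) • p₀ = a • p₀
      rw [smul_smul, mul_inv_cancel_left])
  have h2 := (actBy m n M x).toHomeomorph.image_interior (orb G p₀ '' K)
  have h3 : interior (orb G p₀ '' K) = ∅ :=
    Set.subset_empty_iff.1 (hVi ▸ interior_mono (Set.image_mono hKV))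
  rw [h3, Set.image_empty] at h2
  have h4 : y ∈ (∅ : Set M) := h2 ▸ hy
  exact h4

/-- The orbit map has smooth local sections. -/
theorem exists_orb_section (p₀ x : M) : ∃ s : M → G, ContMDiffAt (𝓡 n) (𝓡 m) ∞ s x ∧
    ∀ᶠ y in 𝓝 x, s y • p₀ = y := by
  obtain ⟨s, hs, -, hsy⟩ := exists_local_section (orb_smooth (m := m) (n := n) G p₀) (1 : G)
    (surjective_orb p₀)
  obtain ⟨a, rfl⟩ := MulAction.exists_smul_eq G p₀ x
  have h1 : orb G p₀ (1 : G) = p₀ := one_smul G p₀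
  rw [h1] at hs hsy
  have h2 : actBy m n M a⁻¹ (a • p₀) = p₀ := inv_smul_smul a p₀
  refine ⟨fun y => a * s (actBy m n M a⁻¹ y), contMDiffAt_const.mul (ContMDiffAt.comp (a • p₀)
    (by rw [h2]; exact hs) (actBy m n M a⁻¹).contMDiff.contMDiffAt), ?_⟩
  have h3 : Filter.Tendsto (actBy m n M a⁻¹) (𝓝 (a • p₀)) (𝓝 p₀) := by
    have := (actBy m n M a⁻¹).continuous.tendsto (a • p₀)
    rwa [h2] at this
  filter_upwards [h3.eventually hsy] with y hy
  have hy' : s (actBy m n M a⁻¹ y) • p₀ = a⁻¹ • y := hy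
  rw [mul_smul, hy', smul_inv_smul]

/-- Surjectivity is that of the orbit map's differential. For injectivity, a vector killed by this
differential is the velocity of a curve in the fibre over p₀, and this fibre is K. -/
theorem bijective_Ups (p₀ : M) : Function.Bijective (Ups m G n p₀) := by
  constructor
  · rw [← LinearMap.ker_eq_bot, Ups]
    apply Submodule.ker_liftQ_eq_bot'
    refine le_antisymm (lieAlgOf_le_ker G p₀) fun X hX => ?_
    have hX' : euclDeriv m n (orb G p₀) (1 : G) X = 0 := by
      have h : -(euclDeriv m n (orb G p₀) (1 : G) X) = 0 := hX
      exact neg_eq_zero.1 h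
    obtain ⟨γ, hγ, hγ0, hγK, hγX⟩ := exists_curve_in_fibre
      (orb_smooth (m := m) (n := n) G p₀) (1 : G) (surjective_orb p₀) X hX'
    exact ⟨γ, hγ, hγ0, fun t => (hγK t).trans (one_smul G p₀), hγX⟩
  · intro w
    obtain ⟨X, hX⟩ := surjective_orb (m := m) (n := n) (G := G) p₀ (-w : EuclideanSpace ℝ (Fin n))
    refine ⟨Submodule.Quotient.mk X, ?_⟩
    change -(euclDeriv m n (orb G p₀) (1 : G) X) = w
    rw [hX]
    exact neg_neg (w : EuclideanSpace ℝ (Fin n))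

end OrbitMap

/-! ### Smooth dependence of forms and of vector fields moved to the base point -/

theorem MultilinearMap.contDiff_euclidean {ι : Type*} [Fintype ι] {k : ℕ}
    (C : MultilinearMap ℝ (fun _ : ι => EuclideanSpace ℝ (Fin k)) ℝ) {r : ℕ∞ω} :
    ContDiff ℝ r fun v : ι → EuclideanSpace ℝ (Fin k) => C v := by
  -- Expanding in the standard basis shows that the form is polynomial in the coordinates of its
  -- arguments.
  classical
  have e : (fun v : ι → EuclideanSpace ℝ (Fin k) => C v) = fun v =>
      ∑ j : ι → Fin k, (∏ i, v i (j i)) •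
        C fun i => EuclideanSpace.basisFun (Fin k) ℝ (j i) := by
    funext v
    have hv : v = fun i => ∑ a, v i a • EuclideanSpace.basisFun (Fin k) ℝ a := by
      funext i
      have := (EuclideanSpace.basisFun (Fin k) ℝ).sum_repr (v i)
      simpa using this.symm
    conv_lhs => rw [hv]
    rw [MultilinearMap.map_sum]
    exact Finset.sum_congr rfl fun j _ => MultilinearMap.map_smul_univ C _ _
  rw [e]
  fun_prop

/-- Over its centre the preferred trivialization is the identity, so components of vectors in a
fixed fibre can be read off directly. -/
theorem trivializationAt_snd {n : ℕ} {M : Type u} [TopologicalSpace M]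
    [ChartedSpace (EuclideanSpace ℝ (Fin n)) M] [IsManifold (𝓡 n) ∞ M] {x y : M} (h : y = x)
    (w : EuclideanSpace ℝ (Fin n)) :
    (trivializationAt (EuclideanSpace ℝ (Fin n)) (TangentSpace (𝓡 n) : M → Type) x
      (TotalSpace.mk' (EuclideanSpace ℝ (Fin n)) y w)).2 = w := by
  subst h
  exact (tangentBundleCore (𝓡 n) M).coordChange_self (achart _ y) y (mem_chart_source _ y) w

section Smoothness

open scoped Topology

variable {m n : ℕ} {G : Type v} [TopologicalSpace G] [ChartedSpace (EuclideanSpace ℝ (Fin m)) G]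
  [Group G] [LieGroup (𝓡 m) ∞ G]
  {M : Type u} [TopologicalSpace M] [ChartedSpace (EuclideanSpace ℝ (Fin n)) M]
  [IsManifold (𝓡 n) ∞ M] [MulAction G M] [ContMDiffSMul (𝓡 m) (𝓡 n) ∞ G M]

/-- If `a y` moves `y` to the fixed point `p₀`, then moving a smooth vector field to `p₀` by `a`
gives a smooth map. -/
theorem contMDiffAt_translate {p₀ x : M} {a : M → G} (ha : ContMDiffAt (𝓡 n) (𝓡 m) ∞ a x)
    (hap : ∀ᶠ y in 𝓝 x, a y • y = p₀) (X : VF n M) :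
    ContMDiffAt (𝓡 n) 𝓘(ℝ, EuclideanSpace ℝ (Fin n)) ∞
      (fun y => euclDeriv n n (actBy m n M (a y)) y (X y)) x := by
  have hσ : ContMDiff ((𝓡 m).prod (𝓡 n)) (𝓡 n) ∞ (fun p : G × M => p.1 • p.2) :=
    ContMDiffSMul.contMDiff_smul
  -- The translated field is the tangent map of the action G × M → M applied to the pair of the zero
  -- vector at a y and X y.
  have h1 : ContMDiffAt (𝓡 n) (𝓡 m).tangent ∞
      (fun y => (TotalSpace.mk' (EuclideanSpace ℝ (Fin m)) (a y) 0 : TangentBundle (𝓡 m) G)) x :=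
    ContMDiffAt.comp x (Bundle.contMDiff_zeroSection ℝ
      (TangentSpace (𝓡 m) : G → Type _)).contMDiffAt ha
  have h2 : ContMDiffAt (𝓡 n) (𝓡 n).tangent ∞
      (fun y => (TotalSpace.mk' (EuclideanSpace ℝ (Fin n)) y (X y) : TangentBundle (𝓡 n) M)) x :=
    X.contMDiff x
  have h3 : ContMDiff ((𝓡 m).prod (𝓡 n)).tangent (𝓡 n).tangent ∞
      (tangentMap ((𝓡 m).prod (𝓡 n)) (𝓡 n) fun p : G × M => p.1 • p.2) :=
    hσ.contMDiff_tangentMap (by simp)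
  have h4 := h3.contMDiffAt.comp x (contMDiff_equivTangentBundleProd_symm.contMDiffAt.comp x
    (h1.prodMk h2))
  have h5 := (contMDiffAt_totalSpace.1 h4).2
  refine h5.congr_of_eventuallyEq ?_
  filter_upwards [hap] with y hy
  -- Near x all values lie in the single fibre over p₀, the centre of the trivialization in `h5`.
  have hx : a y • y = a x • x := hy.trans hap.self_of_nhds.symm
  refine Eq.symm ((trivializationAt_snd hx _).trans ?_)
  have h6 : MDifferentiableAt ((𝓡 m).prod (𝓡 n)) (𝓡 n) (fun p : G × M => p.1 • p.2) (a y, y) :=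
    (hσ _).mdifferentiableAt (by simp)
  refine (mfderiv_prod_eq_add_apply h6).trans ?_
  have h7 : (mfderiv (𝓡 m) (𝓡 n) (fun z : G => z • y) (a y) 0 : EuclideanSpace ℝ (Fin n)) = 0 :=
    map_zero _
  refine Eq.trans (congrArg (fun z : EuclideanSpace ℝ (Fin n) =>
    z + euclDeriv n n (actBy m n M (a y)) y (X y)) h7) ?_
  exact zero_add _

end Smoothness

/-! ### Invariant tensor fields and their values at the base point -/

section Evaluation

open scoped Topology

variable {m n : ℕ} {G : Type v} [TopologicalSpace G] [ChartedSpace (EuclideanSpace ℝ (Fin m)) G]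
  [Group G] [LieGroup (𝓡 m) ∞ G]
  {M : Type u} [TopologicalSpace M] [ChartedSpace (EuclideanSpace ℝ (Fin n)) M]
  [IsManifold (𝓡 n) ∞ M] [MulAction G M] [ContMDiffSMul (𝓡 m) (𝓡 n) ∞ G M]

theorem euclDeriv_diffeo_trans (f h : M ≃ₘ⟮𝓡 n, 𝓡 n⟯ M) (x : M) :
    euclDeriv n n (f.trans h) x = (euclDeriv n n h (f x)).comp (euclDeriv n n f x) :=
  euclDeriv_comp ((h.contMDiff _).mdifferentiableAt (by simp))
    ((f.contMDiff _).mdifferentiableAt (by simp))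

theorem euclDeriv_actBy_mul (a b : G) (x : M) :
    euclDeriv n n (actBy m n M (a * b)) x =
      (euclDeriv n n (actBy m n M a) (b • x)).comp (euclDeriv n n (actBy m n M b) x) := by
  have e : actBy m n M (a * b) = (actBy m n M b).trans (actBy m n M a) :=
    Diffeomorph.ext fun y => mul_smul a b y
  rw [e]
  exact euclDeriv_diffeo_trans _ _ x

theorem euclDeriv_actBy_surjective (a : G) (x : M) :
    Function.Surjective (euclDeriv n n (actBy m n M a) x) :=
  diffeo_mfderiv_surjective (actBy m n M a) x

/-- A form on the model space, seen as a form on a tangent space, pulled back along a linear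
map. -/
noncomputable def transportForm {x : M}
    (C : MultilinearMap ℝ (fun _ : Fin 3 => EuclideanSpace ℝ (Fin n)) ℝ)
    (A : EuclideanSpace ℝ (Fin n) →L[ℝ] EuclideanSpace ℝ (Fin n)) :
    MultilinearMap ℝ (fun _ : Fin 3 => TangentSpace (𝓡 n) x) ℝ :=
  C.compLinearMap fun _ => A.toLinearMap

theorem InvField.apply_smul (C : InvField m G n M) (h : G) (x : M)
    (v : Fin 3 → EuclideanSpace ℝ (Fin n)) :
    C.1 (h • x) (fun i => euclDeriv n n (actBy m n M h) x (v i)) = C.1 x v :=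
  C.2.2 h x v

/-- Two elements moving x to p₀ differ by an element of K, which C does not see. -/
theorem S3T.apply_eq {p₀ : M} (C : S3T m G n p₀) {a b : G} {x : M} (ha : a • x = p₀)
    (hb : b • x = p₀) (v : Fin 3 → EuclideanSpace ℝ (Fin n)) :
    C.1 (fun i => euclDeriv n n (actBy m n M a) x (v i)) =
      C.1 (fun i => euclDeriv n n (actBy m n M b) x (v i)) := by
  have hk : a * b⁻¹ ∈ Isot G p₀ := by
    rw [MulAction.mem_stabilizer_iff, mul_smul, ← hb, inv_smul_smul, hb, ha]
  have h1 := C.2.2 ⟨_, hk⟩ fun i => euclDeriv n n (actBy m n M b) x (v i)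
  refine Eq.trans ?_ h1
  congr 1
  funext i
  have h2 := euclDeriv_actBy_mul (m := m) (n := n) (a * b⁻¹) b x
  rw [inv_mul_cancel_right, hb] at h2
  rw [h2]
  rfl

variable [MulAction.IsPretransitive G M]

theorem InvField.ext_at (p₀ : M) {C C' : InvField m G n M} (h : C.1 p₀ = C'.1 p₀) : C = C' := by
  apply Subtype.ext
  funext x
  obtain ⟨a, rfl⟩ := MulAction.exists_smul_eq G p₀ x
  ext v
  choose w hw using fun i => euclDeriv_actBy_surjective (m := m) (n := n) a p₀ (v i)
  have hv : v = fun i => euclDeriv n n (actBy m n M a) p₀ (w i) := funext fun i => (hw i).symm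
  rw [hv]
  refine (InvField.apply_smul C a p₀ w).trans
    (Eq.trans ?_ (InvField.apply_smul C' a p₀ w).symm)
  rw [h]

variable [T2Space M] [SecondCountableTopology G]

/-- C_x is the form at p₀ pulled back by any element moving x to p₀. The arbitrary choice of `b` is
harmless by `S3T.apply_eq`; for smoothness it is replaced locally by the inverse of a smooth section
of the orbit map. -/
theorem exists_invField {p₀ : M} (C₀ : S3T m G n p₀) : ∃ C : InvField m G n M, C.1 p₀ = C₀.1 := by
  choose b hb using fun x : M => MulAction.exists_smul_eq G x p₀
  let C : ∀ x : M, MultilinearMap ℝ (fun _ : Fin 3 => TangentSpace (𝓡 n) x) ℝ := fun x =>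
    transportForm C₀.1 (euclDeriv n n (actBy m n M (b x)) x)
  have hC : ∀ (x : M) (a : G), a • x = p₀ → ∀ v : Fin 3 → EuclideanSpace ℝ (Fin n),
      C x v = C₀.1 (fun i => euclDeriv n n (actBy m n M a) x (v i)) := fun x a ha v =>
    S3T.apply_eq C₀ (hb x) ha v
  refine ⟨⟨C, ⟨fun x τ v => C₀.2.1 τ fun i => euclDeriv n n (actBy m n M (b x)) x (v i),
    fun X Y Z x => ?_⟩, fun h x v => ?_⟩, ?_⟩
  · obtain ⟨s, hs, hsy⟩ := exists_orb_section (m := m) (n := n) (G := G) p₀ x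
    have hs' : ∀ᶠ y in 𝓝 x, (s y)⁻¹ • y = p₀ := by
      filter_upwards [hsy] with y hy
      rw [inv_smul_eq_iff, hy]
    have hw := contMDiffAt_translate hs.inv hs'
    have h1 : ContMDiffAt (𝓡 n) 𝓘(ℝ, Fin 3 → EuclideanSpace ℝ (Fin n)) ∞
        (fun y => fun i : Fin 3 => euclDeriv n n (actBy m n M (s y)⁻¹) y
          ((![X, Y, Z] : Fin 3 → VF n M) i y)) x :=
      contMDiffAt_pi_space.2 fun i => hw _
    refine ((MultilinearMap.contDiff_euclidean (r := ∞)
      (C₀.1 : MultilinearMap ℝ (fun _ : Fin 3 => EuclideanSpace ℝ (Fin n)) ℝ)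
        ).contMDiff.contMDiffAt.comp x h1).congr_of_eventuallyEq ?_
    filter_upwards [hs'] with y hy
    refine (hC y _ hy _).trans (congrArg C₀.1 (funext fun i => ?_))
    fin_cases i <;> rfl
  · have h1 : (b (h • x) * h) • x = p₀ := by rw [mul_smul, hb]
    refine Eq.trans ?_ (hC x _ h1 v).symm
    rw [euclDeriv_actBy_mul]
    rfl
  · ext v
    refine (hC p₀ 1 (one_smul G p₀) v).trans (congrArg C₀.1 (funext fun i => ?_))
    have e : actBy m n M (1 : G) = Diffeomorph.refl (𝓡 n) M ∞ :=
      Diffeomorph.ext fun y => one_smul G y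
    rw [e]
    exact congrArg (fun L => (L (v i) : EuclideanSpace ℝ (Fin n)))
      (mfderiv_id (I := 𝓡 n) (x := p₀))

theorem bijective_evalAt (p₀ : M) :
    Function.Bijective (evalAt (m := m) (n := n) G p₀) := by
  refine ⟨fun C C' h => InvField.ext_at p₀ (congrArg Subtype.val h), fun C₀ => ?_⟩
  obtain ⟨C, hC⟩ := exists_invField C₀
  exact ⟨C, Subtype.ext hC⟩

theorem finiteDimensional_invField (p₀ : M) : FiniteDimensional ℝ (InvField m G n M) :=
  have : Module.Finite ℝ (MultilinearMap ℝ (fun _ : Fin 3 => TangentSpace (𝓡 n) p₀) ℝ) :=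
    Module.Finite.multilinearMap
  Module.Finite.of_injective (evalAt (m := m) (n := n) G p₀) (bijective_evalAt p₀).1

theorem bijective_pullUps (p₀ : M) :
    Function.Bijective (pullUps (m := m) (n := n) G p₀) := by
  have hU := bijective_Ups (m := m) (n := n) (G := G) p₀
  let U := LinearEquiv.ofBijective (Ups m G n p₀) hU
  have hU' : ∀ v, Ups m G n p₀ (U.symm v) = v := U.apply_symm_apply
  constructor
  · intro C C' h
    apply Subtype.ext
    ext v
    have h1 := congrArg (fun B : S3Q m (Isot G p₀) => B.1 fun i => U.symm (v i)) h
    change C.1 (fun i => Ups m G n p₀ (U.symm (v i))) =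
      C'.1 (fun i => Ups m G n p₀ (U.symm (v i))) at h1
    simpa only [hU'] using h1
  · intro B
    refine ⟨⟨B.1.compLinearMap fun _ => U.symm.toLinearMap,
      fun τ v => B.2.1 τ fun i => U.symm (v i), fun k v => ?_⟩, ?_⟩
    · change B.1 (fun i => U.symm (isotropy m G n p₀ k (v i))) = B.1 (fun i => U.symm (v i))
      refine Eq.trans ?_ (B.2.2 k fun i => U.symm (v i))
      refine congrArg B.1 (funext fun i => hU.1 ?_)
      rw [hU', Ups_AdQ, hU']
    · apply Subtype.ext
      ext v
      exact congrArg B.1 (funext fun i => U.symm_apply_apply (v i))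

end Evaluation

/-! ### The bijections are homeomorphisms -/

section Homeomorphisms

/-- Every linear map out of a space with the module topology is continuous, so the bijection and its
inverse both are. -/
theorem LinearMap.isHomeomorph_moduleTopology {E F : Type*} [AddCommMonoid E] [Module ℝ E]
    [TopologicalSpace E] [IsModuleTopology ℝ E] [AddCommMonoid F] [Module ℝ F]
    [TopologicalSpace F] [IsModuleTopology ℝ F] (f : E →ₗ[ℝ] F) (hf : Function.Bijective f) :
    IsHomeomorph f := by
  have := IsModuleTopology.toContinuousAdd ℝ E
  have := IsModuleTopology.toContinuousSMul ℝ E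
  have := IsModuleTopology.toContinuousAdd ℝ F
  have := IsModuleTopology.toContinuousSMul ℝ F
  let e := LinearEquiv.ofBijective f hf
  exact isHomeomorph_iff_exists_inverse.2 ⟨IsModuleTopology.continuous_of_linearMap f, e.symm,
    e.symm_apply_apply, e.apply_symm_apply,
    IsModuleTopology.continuous_of_linearMap e.symm.toLinearMap⟩

variable {m n : ℕ} {G : Type v} [TopologicalSpace G] [ChartedSpace (EuclideanSpace ℝ (Fin m)) G]
  [Group G] [LieGroup (𝓡 m) ∞ G]
  {M : Type u} [TopologicalSpace M] [ChartedSpace (EuclideanSpace ℝ (Fin n)) M]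
  [IsManifold (𝓡 n) ∞ M] [MulAction G M] [ContMDiffSMul (𝓡 m) (𝓡 n) ∞ G M]

instance : IsModuleTopology ℝ (InvField m G n M) := ⟨rfl⟩

instance (p₀ : M) : IsModuleTopology ℝ (S3T m G n p₀) := ⟨rfl⟩

instance (K : Subgroup G) : IsModuleTopology ℝ (S3Q m K) := ⟨rfl⟩

section Transitive

variable [T2Space M] [SecondCountableTopology G] [MulAction.IsPretransitive G M]

theorem isHomeomorph_evalAt (p₀ : M) : IsHomeomorph (evalAt (m := m) (n := n) G p₀) :=
  LinearMap.isHomeomorph_moduleTopology (evalAt (m := m) (n := n) G p₀) (bijective_evalAt p₀)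

theorem isHomeomorph_pullUps (p₀ : M) : IsHomeomorph (pullUps (m := m) (n := n) G p₀) :=
  LinearMap.isHomeomorph_moduleTopology (pullUps (m := m) (n := n) G p₀) (bijective_pullUps p₀)

end Transitive

variable [T2Space M] {g : RMetric n M}

/-- The junk value 0 in `cubic` never occurs: a cubic form exists, and it is invariant by naturality
applied to the isometries σ_h, which pull the connection back to itself. -/
theorem isCubicForm_cubic (hg : IsInvMetric m G g) (D : StatG m G g) :
    IsCubicForm g D.1 (cubic G g D).1 := by
  have h : ∃ C : InvField m G n M, IsCubicForm g D.1 C.1 := by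
    obtain ⟨C, hC, hDC⟩ := D.2.1.exists_cubicForm
    exact ⟨⟨C, hC, fun h x v => IsCubicForm.natural (hg h) (D.2.2 h) hDC hDC x v⟩, hDC⟩
  rw [cubic, dif_pos h]
  exact h.choose_spec

theorem bijective_cubic (hg : IsInvMetric m G g) : Function.Bijective (cubic (m := m) G g) := by
  constructor
  · intro D D' h
    apply Subtype.ext
    have h1 := isCubicForm_cubic hg D
    rw [h] at h1
    exact h1.connection_unique (isCubicForm_cubic hg D')
  · intro C
    obtain ⟨D, hD, hDC⟩ := Sym3Field.exists_connection g C.2.1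
    let D' : StatG m G g := ⟨D, hD, fun h => hDC.isPullback (hg h) hDC (C.2.2 h)⟩
    exact ⟨D', Subtype.ext ((isCubicForm_cubic hg D').unique hDC)⟩

/-- The topology on connections is induced along this very map, so bijectivity suffices. -/
theorem isHomeomorph_cubic (hg : IsInvMetric m G g) : IsHomeomorph (cubic (m := m) G g) :=
  isHomeomorph_iff_isEmbedding_surjective.2
    ⟨⟨⟨rfl⟩, (bijective_cubic hg).1⟩, (bijective_cubic hg).2⟩

end Homeomorphisms

/-! ### The diffeomorphisms attached to automorphisms of the pair (G, K) -/

section Automorphisms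

open scoped Topology

variable {m n : ℕ} {G : Type v} [TopologicalSpace G] [ChartedSpace (EuclideanSpace ℝ (Fin m)) G]
  [Group G] [LieGroup (𝓡 m) ∞ G]
  {M : Type u} [TopologicalSpace M] [ChartedSpace (EuclideanSpace ℝ (Fin n)) M]
  [IsManifold (𝓡 n) ∞ M] [MulAction G M] [ContMDiffSMul (𝓡 m) (𝓡 n) ∞ G M]
  [T2Space M] [SecondCountableTopology G] [MulAction.IsPretransitive G M]

/-- The map `h • p₀ ↦ φ(h) • p₀`. -/
noncomputable def homogFun (φ : MulAut G) (p₀ x : M) : M :=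
  φ (MulAction.exists_smul_eq G p₀ x).choose • p₀

theorem homogFun_smul {p₀ : M} {φ : MulAut G} (hφ : φ ∈ AutGK m (Isot G p₀)) (h : G) :
    homogFun φ p₀ (h • p₀) = φ h • p₀ := by
  have h1 := (MulAction.exists_smul_eq G p₀ (h • p₀)).choose_spec
  set a := (MulAction.exists_smul_eq G p₀ (h • p₀)).choose with ha
  -- The chosen element and h differ by an element of K, and φ maps K to K.
  have h2 : h⁻¹ * a ∈ Isot G p₀ := by
    rw [MulAction.mem_stabilizer_iff, mul_smul, h1, inv_smul_smul]
  have h3 := (hφ.2.2 _).2 h2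
  rw [MulAction.mem_stabilizer_iff, map_mul, map_inv, mul_smul, inv_smul_eq_iff] at h3
  exact h3

/-- Locally the map is orb ∘ φ ∘ s for a smooth section s of the orbit map. -/
theorem contMDiff_homogFun {p₀ : M} {φ : MulAut G} (hφ : φ ∈ AutGK m (Isot G p₀)) :
    ContMDiff (𝓡 n) (𝓡 n) ∞ (homogFun φ p₀) := fun x => by
  obtain ⟨s, hs, hsy⟩ := exists_orb_section (m := m) (n := n) (G := G) p₀ x
  have h1 : ContMDiffAt (𝓡 n) (𝓡 n) ∞ (orb G p₀ ∘ φ ∘ s) x :=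
    (orb_smooth (m := m) (n := n) G p₀).contMDiffAt.comp x (hφ.1.contMDiffAt.comp x hs)
  refine h1.congr_of_eventuallyEq ?_
  filter_upwards [hsy] with y hy
  conv_lhs => rw [← hy, homogFun_smul hφ]
  rfl

/-- The diffeomorphism `f_φ : h • p₀ ↦ φ(h) • p₀`. -/
noncomputable def homogDiffeo {p₀ : M} (φ : AutGK m (Isot G p₀)) : M ≃ₘ⟮𝓡 n, 𝓡 n⟯ M where
  toFun := homogFun φ.1 p₀
  invFun := homogFun (φ⁻¹).1 p₀
  left_inv x := by
    obtain ⟨a, rfl⟩ := MulAction.exists_smul_eq G p₀ x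
    rw [homogFun_smul φ.2, homogFun_smul (φ⁻¹).2]
    exact congrArg (· • p₀) (φ.1.symm_apply_apply a)
  right_inv x := by
    obtain ⟨a, rfl⟩ := MulAction.exists_smul_eq G p₀ x
    rw [homogFun_smul (φ⁻¹).2, homogFun_smul φ.2]
    exact congrArg (· • p₀) (φ.1.apply_symm_apply a)
  contMDiff_toFun := contMDiff_homogFun φ.2
  contMDiff_invFun := contMDiff_homogFun (φ⁻¹).2

variable {p₀ : M} (φ : AutGK m (Isot G p₀))

theorem homogDiffeo_smul_base (h : G) :
    homogDiffeo (n := n) φ (h • p₀) = φ.1 h • p₀ :=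
  homogFun_smul φ.2 h

theorem homogDiffeo_base : homogDiffeo (n := n) φ p₀ = p₀ := by
  have := homogDiffeo_smul_base (n := n) φ 1
  rwa [map_one, one_smul] at this

theorem homogDiffeo_smul (h : G) (x : M) :
    homogDiffeo (n := n) φ (h • x) = φ.1 h • homogDiffeo (n := n) φ x := by
  obtain ⟨a, rfl⟩ := MulAction.exists_smul_eq G p₀ x
  rw [smul_smul, homogDiffeo_smul_base, homogDiffeo_smul_base, map_mul, mul_smul]

theorem homogDiffeo_symm : (homogDiffeo (n := n) φ).symm = homogDiffeo (n := n) φ⁻¹ :=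
  Diffeomorph.ext fun _ => rfl

/-- Obtained by differentiating orb ∘ φ = f_φ ∘ orb at 1; it makes Υ equivariant and moves every
question about f_φ at p₀ to 𝔤/𝔨. -/
theorem euclDeriv_homogDiffeo_Ups (u : QuotGK m (Isot G p₀)) :
    euclDeriv n n (homogDiffeo (n := n) φ) p₀ (Ups m G n p₀ u) =
      Ups m G n p₀ (quotRep _ φ u) := by
  obtain ⟨X, rfl⟩ := Submodule.Quotient.mk_surjective _ u
  have hs := orb_smooth (m := m) (n := n) G p₀
  have e : orb G p₀ ∘ φ.1 = homogDiffeo (n := n) φ ∘ orb G p₀ :=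
    funext fun h => (homogDiffeo_smul_base φ h).symm
  have h1 := euclDeriv_comp (x := (1 : G)) ((hs (φ.1 1)).mdifferentiableAt (by simp))
    ((φ.2.1 _).mdifferentiableAt (by simp))
  rw [e, euclDeriv_comp (((homogDiffeo (n := n) φ).contMDiff _).mdifferentiableAt (by simp))
    ((hs _).mdifferentiableAt (by simp)), map_one] at h1
  have h0 : orb G p₀ (1 : G) = p₀ := one_smul G p₀
  rw [h0] at h1
  have h2 := congrArg (fun L => L X) h1
  change euclDeriv n n (homogDiffeo (n := n) φ) p₀ (-(euclDeriv m n (orb G p₀) (1 : G) X)) =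
    -(euclDeriv m n (orb G p₀) (1 : G) (euclDeriv m m φ.1 1 X))
  rw [map_neg]
  exact congrArg Neg.neg h2

theorem euclDeriv_homogDiffeo_actBy (h : G) (x : M) (v : EuclideanSpace ℝ (Fin n)) :
    euclDeriv n n (homogDiffeo (n := n) φ) (h • x) (euclDeriv n n (actBy m n M h) x v) =
      euclDeriv n n (actBy m n M (φ.1 h)) (homogDiffeo (n := n) φ x)
        (euclDeriv n n (homogDiffeo (n := n) φ) x v) := by
  have e : (actBy m n M h).trans (homogDiffeo (n := n) φ) =
      (homogDiffeo (n := n) φ).trans (actBy m n M (φ.1 h)) :=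
    Diffeomorph.ext fun y => homogDiffeo_smul φ h y
  have h1 := euclDeriv_diffeo_trans (actBy m n M h) (homogDiffeo (n := n) φ) x
  rw [e, euclDeriv_diffeo_trans] at h1
  exact (congrArg (fun L => L v) h1).symm

/-- The inner product `g_x`, as a bilinear form on the model space. -/
noncomputable def RMetric.euclInner (g : RMetric n M) (x : M) (v w : EuclideanSpace ℝ (Fin n)) :
    ℝ :=
  g.inner x v w

/-- At p₀ this is preservation of g₀ read through Υ; elsewhere it follows from f_φ ∘ σ_h = σ_{φ(h)}
∘ f_φ and invariance of g. -/
theorem isIsometric_homogDiffeo {g : RMetric n M} (hg : IsInvMetric m G g)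
    (φ : AutGKg m G p₀ g) : IsIsometric (homogDiffeo (n := n) φ.1) g g := by
  have hg' : ∀ (h : G) (x : M) (v w : EuclideanSpace ℝ (Fin n)),
      g.euclInner (h • x) (euclDeriv n n (actBy m n M h) x v)
        (euclDeriv n n (actBy m n M h) x w) = g.euclInner x v w := fun h x v w => hg h x v w
  have h0 : ∀ v w : EuclideanSpace ℝ (Fin n), g.euclInner p₀
      (euclDeriv n n (homogDiffeo (n := n) φ.1) p₀ v)
      (euclDeriv n n (homogDiffeo (n := n) φ.1) p₀ w) = g.euclInner p₀ v w := fun v w => by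
    obtain ⟨a, rfl⟩ := (bijective_Ups (m := m) (n := n) (G := G) p₀).2 v
    obtain ⟨b, rfl⟩ := (bijective_Ups (m := m) (n := n) (G := G) p₀).2 w
    rw [euclDeriv_homogDiffeo_Ups, euclDeriv_homogDiffeo_Ups]
    exact φ.2 a b
  intro x v w
  obtain ⟨a, rfl⟩ := MulAction.exists_smul_eq G p₀ x
  obtain ⟨v', rfl⟩ := euclDeriv_actBy_surjective (m := m) (n := n) a p₀ v
  obtain ⟨w', rfl⟩ := euclDeriv_actBy_surjective (m := m) (n := n) a p₀ w
  refine Eq.trans ?_ (hg' a p₀ v' w').symm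
  change g.euclInner (homogDiffeo (n := n) φ.1 (a • p₀))
    (euclDeriv n n (homogDiffeo (n := n) φ.1) (a • p₀) (euclDeriv n n (actBy m n M a) p₀ v'))
    (euclDeriv n n (homogDiffeo (n := n) φ.1) (a • p₀) (euclDeriv n n (actBy m n M a) p₀ w')) = _
  rw [euclDeriv_homogDiffeo_actBy, euclDeriv_homogDiffeo_actBy, homogDiffeo_smul, hg',
    homogDiffeo_base, h0]

end Automorphisms

/-! ### The transported actions are pullbacks -/

section Actions

variable {m n : ℕ} {G : Type v} [TopologicalSpace G] [ChartedSpace (EuclideanSpace ℝ (Fin m)) G]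
  [Group G] [LieGroup (𝓡 m) ∞ G]
  {M : Type u} [TopologicalSpace M] [ChartedSpace (EuclideanSpace ℝ (Fin n)) M]
  [IsManifold (𝓡 n) ∞ M] [MulAction G M] [ContMDiffSMul (𝓡 m) (𝓡 n) ∞ G M]
  [T2Space M] [SecondCountableTopology G] [MulAction.IsPretransitive G M]

variable {p₀ : M} {g : RMetric n M}

/-- A form `B` with `Υ^* B = (φ⁻¹)^* Υ^* C` is the pullback of `C` along the differential of
`f_φ⁻¹`. -/
theorem pullUps_eq_smul {φ : AutGKg m G p₀ g} {B C : S3T m G n p₀}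
    (h : pullUps G p₀ B = φ • pullUps G p₀ C) (v : Fin 3 → EuclideanSpace ℝ (Fin n)) :
    B.1 v = C.1 fun i => euclDeriv n n (homogDiffeo (n := n) φ.1).symm p₀ (v i) := by
  choose u hu using fun i => (bijective_Ups (m := m) (n := n) (G := G) p₀).2 (v i)
  obtain rfl : v = fun i => Ups m G n p₀ (u i) := funext fun i => (hu i).symm
  have h1 := congrArg (fun A : S3Q m (Isot G p₀) => A.1 u) h
  refine Eq.trans h1 (congrArg C.1 (funext fun i => ?_))
  rw [homogDiffeo_symm]
  exact (euclDeriv_homogDiffeo_Ups φ.1⁻¹ (u i)).symm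

/-- An invariant field whose value at `p₀` is the pullback of that of `C` along `f_φ⁻¹` is the
pullback of `C`. -/
theorem InvField.apply_of_base {φ : AutGKg m G p₀ g} {B C : InvField m G n M}
    (h : ∀ v : Fin 3 → EuclideanSpace ℝ (Fin n), B.1 p₀ v =
      C.1 p₀ fun i => euclDeriv n n (homogDiffeo (n := n) φ.1).symm p₀ (v i))
    (x : M) (v : Fin 3 → EuclideanSpace ℝ (Fin n)) :
    B.1 x v = C.1 ((homogDiffeo (n := n) φ.1).symm x)
      fun i => euclDeriv n n (homogDiffeo (n := n) φ.1).symm x (v i) := by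
  obtain ⟨a, rfl⟩ := MulAction.exists_smul_eq G p₀ x
  choose w hw using fun i => euclDeriv_actBy_surjective (m := m) (n := n) a p₀ (v i)
  obtain rfl : v = fun i => euclDeriv n n (actBy m n M a) p₀ (w i) := funext fun i => (hw i).symm
  refine (InvField.apply_smul B a p₀ w).trans ((h w).trans ?_)
  -- f_φ⁻¹ sends a • p₀ to φ⁻¹(a) • p₀, so the form C at p₀ is carried there by φ⁻¹(a).
  refine (InvField.apply_smul C (φ.1⁻¹.1 a) p₀ _).symm.trans ?_
  have key : ∀ y z : M, y = z → ∀ u : Fin 3 → EuclideanSpace ℝ (Fin n),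
      C.1 y u = C.1 z u := by
    rintro y z rfl u
    rfl
  have e : φ.1⁻¹.1 a • p₀ = (homogDiffeo (n := n) φ.1).symm (a • p₀) := by
    rw [homogDiffeo_symm, homogDiffeo_smul_base]
  refine (key _ _ e _).trans (congrArg (C.1 _) (funext fun i => ?_))
  rw [homogDiffeo_symm, euclDeriv_homogDiffeo_actBy, homogDiffeo_base]

end Actions

/-! ### Equivariant homeomorphisms and orbit spaces -/

section OrbitSpaces

variable {A X Y : Type*} [Group A] [MulAction A X] [MulAction A Y]

theorem orbitRel_iff_of_equivariant {f : X → Y} (hf : Function.Injective f)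
    (h : ∀ (a : A) x, f (a • x) = a • f x) (x x' : X) :
    MulAction.orbitRel A X x x' ↔ MulAction.orbitRel A Y (f x) (f x') := by
  refine exists_congr fun a => ?_
  change a • x' = x ↔ a • f x' = f x
  rw [← h, hf.eq_iff]

theorem IsStable.image {S : Set X} (hS : IsStable A S) {f : X → Y}
    (h : ∀ (a : A) x, f (a • x) = a • f x) : IsStable A (f '' S) := by
  rintro a _ ⟨x, hx, rfl⟩
  exact ⟨a • x, hS a x hx, h a x⟩

variable [TopologicalSpace X] [TopologicalSpace Y]

/-- A homeomorphism that matches two relations induces a homeomorphism of the quotients. -/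
def quotHomeomorph {r : X → X → Prop} {s : Y → Y → Prop} (e : X ≃ₜ Y)
    (h : ∀ x x', r x x' ↔ s (e x) (e x')) : Quot r ≃ₜ Quot s where
  toEquiv := Quot.congr e.toEquiv h
  continuous_toFun := continuous_quot_lift _ (continuous_quot_mk.comp e.continuous)
  continuous_invFun := continuous_quot_lift _ (continuous_quot_mk.comp e.symm.continuous)

theorem exists_orbitSpace_homeomorph {f : X → Y} (hf : IsHomeomorph f)
    (h : ∀ (a : A) x, f (a • x) = a • f x) (S : Set X) :
    ∃ Φ : OrbitSpace A S ≃ₜ OrbitSpace A (f '' S), ∀ x (hx : x ∈ S),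
      Φ (OrbitSpace.mk A x hx) = OrbitSpace.mk A (f x) (Set.mem_image_of_mem _ hx) :=
  ⟨quotHomeomorph ((hf.homeomorph f).image S) fun x x' =>
    orbitRel_iff_of_equivariant hf.injective h x.1 x'.1, fun _ _ => rfl⟩

/-- The action transported along a bijection makes the bijection equivariant. -/
theorem exists_mulAction_equivariant {A X Y : Type*} [Group A] [MulAction A Y] {f : X → Y}
    (hf : Function.Bijective f) :
    ∃ _ : MulAction A X, ∀ (a : A) x, f (a • x) = a • f x :=
  ⟨(Equiv.ofBijective f hf).mulAction A, fun _ _ => (Equiv.ofBijective f hf).apply_symm_apply _⟩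

end OrbitSpaces

/-! ### The equivalence relation as an orbit relation -/

section Moduli

variable {m n : ℕ} {G : Type v} [TopologicalSpace G] [ChartedSpace (EuclideanSpace ℝ (Fin m)) G]
  [Group G] [LieGroup (𝓡 m) ∞ G]
  {M : Type u} [TopologicalSpace M] [ChartedSpace (EuclideanSpace ℝ (Fin n)) M]
  [IsManifold (𝓡 n) ∞ M] [MulAction G M] [ContMDiffSMul (𝓡 m) (𝓡 n) ∞ G M]
  [T2Space M] [SecondCountableTopology G] [MulAction.IsPretransitive G M]

variable {g : RMetric n M}

/-- An isomorphism of homogeneous statistical manifolds can be chosen to fix the base point. -/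
theorem hsRel_iff_exists (hg : IsInvMetric m G g) (p₀ : M) (D D' : StatG m G g) :
    HSRel D D' ↔
      ∃ φ : AutGKg m G p₀ g, IsPullback (homogDiffeo (n := n) φ.1) D'.1 D.1 := by
  constructor
  · rintro ⟨φ, f, hφ, hφ', hf, hfg, hfD⟩
    -- Replacing f by σ_c⁻¹ ∘ f and φ by c⁻¹ φ(·) c fixes p₀ and preserves equivariance; g and D'
    -- are invariant under σ_c⁻¹.
    obtain ⟨c, hc⟩ := MulAction.exists_smul_eq G p₀ (f p₀)
    let ψ : MulAut G := φ.trans (MulAut.conj c⁻¹)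
    have hψ : ∀ h, ψ h = c⁻¹ * φ h * c := fun h => by
      change c⁻¹ * φ h * c⁻¹⁻¹ = _
      rw [inv_inv]
    let f' := f.trans (actBy m n M c⁻¹)
    have hf' : ∀ x, f' x = c⁻¹ • f x := fun _ => rfl
    have hf0 : ∀ h, f' (h • p₀) = ψ h • p₀ := fun h => by
      rw [hf', hψ, hf, ← hc, mul_smul, mul_smul]
    have h0 : f' p₀ = p₀ := by rw [hf', ← hc, inv_smul_smul]
    have hψK : ψ ∈ AutGK m (Isot G p₀) := by
      refine ⟨?_, ?_, fun h => ?_⟩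
      · have : ⇑ψ = fun h => c⁻¹ * φ h * c := funext hψ
        rw [this]
        exact (contMDiff_const.mul hφ).mul contMDiff_const
      · have : ⇑ψ.symm = fun h => φ.symm (c * h * c⁻¹) := funext fun h => by
          rw [MulEquiv.symm_apply_eq, hψ, MulEquiv.apply_symm_apply]
          group
        rw [this]
        exact hφ'.comp ((contMDiff_const.mul contMDiff_id).mul contMDiff_const)
      -- ψ h fixes p₀ iff f' (h • p₀) = f' p₀, and f' is injective.
      · rw [MulAction.mem_stabilizer_iff, ← hf0, MulAction.mem_stabilizer_iff]
        nth_rewrite 2 [← h0]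
        exact f'.injective.eq_iff
    have hF : homogDiffeo (n := n) (⟨ψ, hψK⟩ : AutGK m (Isot G p₀)) = f' :=
      Diffeomorph.ext fun x => by
        obtain ⟨a, rfl⟩ := MulAction.exists_smul_eq G p₀ x
        rw [homogDiffeo_smul_base, hf0]
    have hfg' : IsIsometric f' g g := hfg.trans (hg c⁻¹)
    refine ⟨⟨⟨ψ, hψK⟩, fun u v => ?_⟩, ?_⟩
    -- That f' is isometric at p₀, read through Υ, says that ψ preserves g₀.
    · have h1 := hfg' p₀ (Ups m G n p₀ u) (Ups m G n p₀ v)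
      change g.euclInner (f' p₀) (euclDeriv n n f' p₀ (Ups m G n p₀ u))
        (euclDeriv n n f' p₀ (Ups m G n p₀ v)) = _ at h1
      rw [h0, ← hF, euclDeriv_homogDiffeo_Ups, euclDeriv_homogDiffeo_Ups] at h1
      exact h1
    · rw [hF]
      exact hfD.trans (D'.2.2 c⁻¹)
  · rintro ⟨φ, h⟩
    exact ⟨φ.1.1, homogDiffeo φ.1, φ.1.2.1, φ.1.2.2.1, homogDiffeo_smul φ.1,
      isIsometric_homogDiffeo hg φ, h⟩

/-- The action pulls back along f_φ⁻¹ while the relation pulls back along f_φ, so D = f_φ^* D' reads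
D = φ⁻¹ • D'; hence the inverses. -/
theorem hsRel_iff_orbitRel (hg : IsInvMetric m G g) {p₀ : M}
    [MulAction (AutGKg m G p₀ g) (StatG m G g)]
    (h : ∀ (φ : AutGKg m G p₀ g) (D : StatG m G g),
      IsPullback (homogDiffeo (n := n) φ.1).symm D.1 (φ • D).1) (D D' : StatG m G g) :
    HSRel D D' ↔ MulAction.orbitRel (AutGKg m G p₀ g) (StatG m G g) D D' := by
  rw [hsRel_iff_exists hg p₀]
  have h' : ∀ φ : AutGKg m G p₀ g,
      (homogDiffeo (n := n) (φ⁻¹).1).symm = homogDiffeo (n := n) φ.1 := fun φ => by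
    rw [homogDiffeo_symm]
    exact congrArg homogDiffeo (inv_inv φ.1)
  constructor
  · rintro ⟨φ, hφ⟩
    have h1 := h φ⁻¹ D'
    rw [h'] at h1
    exact ⟨φ⁻¹, Subtype.ext (h1.unique hφ)⟩
  · rintro ⟨φ, rfl⟩
    refine ⟨φ⁻¹, ?_⟩
    have h1 := h φ D'
    rw [homogDiffeo_symm] at h1
    exact h1

theorem HSRel.mem_statC [SecondCountableTopology M] {D D' : StatG m G g} (h : HSRel D D')
    (𝒞 : StatClass.{u}) (hD : D ∈ StatC g 𝒞) : D' ∈ StatC g 𝒞 := by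
  obtain ⟨-, f, -, -, -, hf, hfD⟩ := h
  exact 𝒞.replete _ _ ⟨f, hf, hfD⟩ hD

end Moduli

end HomogStat

/-! ### Assembly of the theorem -/

theorem mainTheorem4 {m n : ℕ}
    {G : Type v} [TopologicalSpace G] [T2Space G] [SecondCountableTopology G]
    [ChartedSpace (EuclideanSpace ℝ (Fin m)) G] [Group G] [LieGroup (𝓡 m) ∞ G]
    {M : Type u} [TopologicalSpace M] [T2Space M] [SecondCountableTopology M]
    [ChartedSpace (EuclideanSpace ℝ (Fin n)) M] [IsManifold (𝓡 n) ∞ M]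
    [MulAction G M] [ContMDiffSMul (𝓡 m) (𝓡 n) ∞ G M] [MulAction.IsPretransitive G M]
    (g : RMetric n M) (hg : IsInvMetric m G g) (p₀ : M) :
    (∃! Dg : AffineConnection n M, IsLeviCivita g Dg) ∧
    (∀ D : StatG m G g, IsCubicForm g D.1 (cubic G g D).1) ∧
    FiniteDimensional ℝ (InvField m G n M) ∧
    Function.Bijective (Ups m G n p₀) ∧
    IsHomeomorph (cubic (m := m) G g) ∧
    IsHomeomorph (evalAt (m := m) (n := n) G p₀) ∧
    IsHomeomorph (pullUps (m := m) (n := n) G p₀) ∧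
    ∃ (F : AutGKg m G p₀ g → M ≃ₘ⟮𝓡 n, 𝓡 n⟯ M)
      (_ : MulAction (AutGKg m G p₀ g) (StatG m G g))
      (_ : MulAction (AutGKg m G p₀ g) (InvField m G n M))
      (_ : MulAction (AutGKg m G p₀ g) (S3T m G n p₀)),
      -- the diffeomorphisms `f_φ` and the actions by pullback along `f_φ⁻¹`
      (∀ (φ : AutGKg m G p₀ g) (h : G), F φ (h • p₀) = φ.1.1 h • p₀) ∧
      (∀ (φ : AutGKg m G p₀ g) (D : StatG m G g), IsPullback (F φ).symm D.1 (φ • D).1) ∧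
      (∀ (φ : AutGKg m G p₀ g) (C : InvField m G n M) (x : M)
        (v : Fin 3 → TangentSpace (𝓡 n) x),
        (φ • C).1 x v =
          C.1 ((F φ).symm x) fun i => mfderiv (𝓡 n) (𝓡 n) (F φ).symm x (v i)) ∧
      (∀ (φ : AutGKg m G p₀ g) (C : S3T m G n p₀) (v : Fin 3 → TangentSpace (𝓡 n) p₀),
        (φ • C).1 v = C.1 fun i => mfderiv (𝓡 n) (𝓡 n) (F φ).symm p₀ (v i)) ∧
      -- the `HS`-moduli space is the orbit space of `Stat^G(M, g)`
      Equivalence (HSRel (m := m) (G := G) (g := g)) ∧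
      (∀ D D' : StatG m G g,
        HSRel D D' ↔ MulAction.orbitRel (AutGKg m G p₀ g) (StatG m G g) D D') ∧
      -- the induced homeomorphisms
      (∃ (Φ : Moduli m G g ≃ₜ MulAction.orbitRel.Quotient (AutGKg m G p₀ g) (S3T m G n p₀))
        (Ψ : MulAction.orbitRel.Quotient (AutGKg m G p₀ g) (S3T m G n p₀) ≃ₜ
          MulAction.orbitRel.Quotient (AutGKg m G p₀ g) (S3Q m (Isot G p₀))),
        (∀ D : StatG m G g, Φ (Quot.mk _ D) = Quotient.mk _ (evalAt G p₀ (cubic G g D))) ∧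
        ∀ C : S3T m G n p₀, Ψ (Quotient.mk _ C) = Quotient.mk _ (pullUps G p₀ C)) ∧
      -- the same for every class `𝒞` of statistical manifolds
      ∀ 𝒞 : StatClass.{u},
        (∀ D D' : StatG m G g, HSRel D D' → (D ∈ StatC g 𝒞 ↔ D' ∈ StatC g 𝒞)) ∧
        IsStable (AutGKg m G p₀ g) (StatC (m := m) (G := G) g 𝒞) ∧
        IsStable (AutGKg m G p₀ g) (InvFieldC m G g 𝒞) ∧
        IsStable (AutGKg m G p₀ g) (S3TC m G p₀ g 𝒞) ∧
        IsStable (AutGKg m G p₀ g) (S3QC m G p₀ g 𝒞) ∧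
        ∃ (Φ : ModuliOf (StatC (m := m) (G := G) g 𝒞) ≃ₜ
            OrbitSpace (AutGKg m G p₀ g) (StatC (m := m) (G := G) g 𝒞))
          (Φ₁ : OrbitSpace (AutGKg m G p₀ g) (StatC (m := m) (G := G) g 𝒞) ≃ₜ
            OrbitSpace (AutGKg m G p₀ g) (InvFieldC m G g 𝒞))
          (Φ₂ : OrbitSpace (AutGKg m G p₀ g) (InvFieldC m G g 𝒞) ≃ₜ
            OrbitSpace (AutGKg m G p₀ g) (S3TC m G p₀ g 𝒞))
          (Φ₃ : OrbitSpace (AutGKg m G p₀ g) (S3TC m G p₀ g 𝒞) ≃ₜ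
            OrbitSpace (AutGKg m G p₀ g) (S3QC m G p₀ g 𝒞)),
          (∀ D (hD : D ∈ StatC g 𝒞), Φ (Quot.mk _ ⟨D, hD⟩) = OrbitSpace.mk _ D hD) ∧
          (∀ D (hD : D ∈ StatC g 𝒞), Φ₁ (OrbitSpace.mk _ D hD) =
            OrbitSpace.mk _ (cubic G g D) (Set.mem_image_of_mem _ hD)) ∧
          (∀ C (hC : C ∈ InvFieldC m G g 𝒞), Φ₂ (OrbitSpace.mk _ C hC) =
            OrbitSpace.mk _ (evalAt G p₀ C) (Set.mem_image_of_mem _ hC)) ∧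
          (∀ C (hC : C ∈ S3TC m G p₀ g 𝒞), Φ₃ (OrbitSpace.mk _ C hC) =
            OrbitSpace.mk _ (pullUps G p₀ C) (Set.mem_image_of_mem _ hC)) := by
  have hc := isHomeomorph_cubic hg
  have he := isHomeomorph_evalAt (m := m) (n := n) (G := G) p₀
  have hu := isHomeomorph_pullUps (m := m) (n := n) (G := G) p₀
  -- The actions are transported back one after the other from the algebraic action on `S3Q`.
  -- Equivariance then holds by construction, and what needs proof is that they are the geometric
  -- pullbacks (`hT'`, `hF'`, `hS'`).
  obtain ⟨actT, hT⟩ := exists_mulAction_equivariant (A := AutGKg m G p₀ g) hu.bijective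
  refine Exists.elim (@exists_mulAction_equivariant (AutGKg m G p₀ g) (InvField m G n M)
    (S3T m G n p₀) _ actT _ he.bijective) fun actF hF => ?_
  refine Exists.elim (@exists_mulAction_equivariant (AutGKg m G p₀ g) (StatG m G g)
    (InvField m G n M) _ actF _ hc.bijective) fun actS hS => ?_
  have hT' : ∀ (φ : AutGKg m G p₀ g) (C : S3T m G n p₀) (v : Fin 3 → TangentSpace (𝓡 n) p₀),
      (φ • C).1 v =
        C.1 fun i => mfderiv (𝓡 n) (𝓡 n) (homogDiffeo (n := n) φ.1).symm p₀ (v i) :=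
    fun φ C v => pullUps_eq_smul (hT φ C) v
  have hF' : ∀ (φ : AutGKg m G p₀ g) (C : InvField m G n M) (x : M)
      (v : Fin 3 → TangentSpace (𝓡 n) x), (φ • C).1 x v =
        C.1 ((homogDiffeo (n := n) φ.1).symm x)
          fun i => mfderiv (𝓡 n) (𝓡 n) (homogDiffeo (n := n) φ.1).symm x (v i) := fun φ C =>
    InvField.apply_of_base fun v =>
      (congrArg (fun B : S3T m G n p₀ => B.1 v) (hF φ C)).trans (hT' φ (evalAt G p₀ C) v)
  -- The cubic form of φ • D is the pullback of that of D along the isometry f_φ⁻¹, so the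
  -- connection is too.
  have hS' : ∀ (φ : AutGKg m G p₀ g) (D : StatG m G g),
      IsPullback (homogDiffeo (n := n) φ.1).symm D.1 (φ • D).1 := fun φ D =>
    (isCubicForm_cubic hg (φ • D)).isPullback (isIsometric_homogDiffeo hg φ).symm
      (isCubicForm_cubic hg D) fun x v => by
        rw [hS]
        exact (hF' φ (cubic G g D) x v).symm
  have hrel := hsRel_iff_orbitRel hg hS'
  have hequiv : Equivalence (HSRel (m := m) (G := G) (g := g)) := by
    have : HSRel (m := m) (G := G) (g := g) =
        (MulAction.orbitRel (AutGKg m G p₀ g) (StatG m G g)).r :=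
      funext₂ fun D D' => propext (hrel D D')
    rw [this]
    exact (MulAction.orbitRel (AutGKg m G p₀ g) (StatG m G g)).iseqv
  refine ⟨existsUnique_isLeviCivita g, isCubicForm_cubic hg, finiteDimensional_invField p₀,
    bijective_Ups p₀, hc, he, hu, ?_⟩
  refine ⟨fun φ => homogDiffeo φ.1, actS, actF, actT, ?_⟩
  refine ⟨fun φ => homogDiffeo_smul_base φ.1, hS', hF', hT', ?_⟩
  refine ⟨hequiv, hrel, ?_, fun 𝒞 => ?_⟩
  · refine ⟨quotHomeomorph ((hc.homeomorph _).trans (he.homeomorph _)) fun D D' => ?_,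
      quotHomeomorph (hu.homeomorph _) fun C C' => ?_, fun _ => rfl, fun _ => rfl⟩
    · exact (hrel D D').trans ((orbitRel_iff_of_equivariant hc.injective hS D D').trans
        (orbitRel_iff_of_equivariant he.injective hF _ _))
    · exact orbitRel_iff_of_equivariant hu.injective hT C C'
  -- An orbit is a ∼-class, and the f in the relation is an isomorphism of statistical manifolds,
  -- under which 𝒞 is closed. Stability of the images follows by equivariance.
  · have stS : IsStable (AutGKg m G p₀ g) (StatC (m := m) (G := G) g 𝒞) := fun φ D hD =>
      HSRel.mem_statC ((hrel D (φ • D)).2 ⟨φ⁻¹, inv_smul_smul φ D⟩) 𝒞 hD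
    have stF := stS.image hS
    have stT := IsStable.image stF hF
    refine Exists.elim (exists_orbitSpace_homeomorph hc hS (StatC g 𝒞)) fun Φ₁ h₁ => ?_
    refine Exists.elim (exists_orbitSpace_homeomorph he hF (InvFieldC m G g 𝒞)) fun Φ₂ h₂ => ?_
    refine Exists.elim (exists_orbitSpace_homeomorph hu hT (S3TC m G p₀ g 𝒞)) fun Φ₃ h₃ => ?_
    exact ⟨fun D D' h => ⟨h.mem_statC 𝒞, (hequiv.symm h).mem_statC 𝒞⟩, stS, stF, stT,
      IsStable.image stT hT,
      quotHomeomorph (Homeomorph.refl _) fun D D' => hrel D.1 D'.1, Φ₁, Φ₂, Φ₃,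
      fun _ _ => rfl, h₁, h₂, h₃⟩
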